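/- **Setting.** Let $n\ge 2$, $T>0$. Let $g:\mathbb R\to\mathbb R$ be Lipschitz continuous and let $f:\mathbb R\setminus\{0\}\to\mathbb R$ be odd (put $f(0):=0$), with $f\in W^{2,1}_{\mathrm{loc}}(0,\infty)$ (continuous representative), $f\ge 0$, $f'\le 0$, $f''\ge 0$ on $(0,\infty)$, $x f'(x)\to-\infty$ as $x\downarrow 0$, and, for some $a\in(-1,\infty)$ and $C>0$, $f(x)\le C x^{-1-a}$ for all $x\in(0,1)$. Let $$\mathcal Z_n=\{(\mathbf x,\mathbf b)\in\mathbb R^n\times\{-1,0,1\}^n : \ i<j,\ b_ib_j\ne 0\ \Rightarrow\ x_i<x_j\}.$$ A particle $i$ is charged if $b_i\neq 0$ and neutral if $b_i=0$; $i<j$ are neighbors if both are charged and all $k$ with $i<k<j$ are neutral. Let $d^{\pm}\in(0,\infty]$ be the infimum of $x_j-x_i$ over neighbors $i<j$ with $b_i=b_j=\pm1$. A *solution* of $(P_n)$ with initial datum $(\mathbf x^\circ,\mathbf b^\circ)\in\mathcal Z_n$ is a map $(\mathbf x,\mathbf b):[0,T]\to\mathcal Z_n$ for which there is a finite set $S\subset(0,T]$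 such that: $\mathbf x\in C([0,T])\cap C^1((0,T)\setminus S)$ and each $b_i$ is right-continuous; $(\mathbf x,\mathbf b)(0)=(\mathbf x^\circ,\mathbf b^\circ)$; each $b_i$ jumps at most once, and if it jumps at $t$, then $t\in S$, $|b_i(t-)|=1$ and $b_i(t)=0$; $\sum_{i:x_i(t)=y}b_i(t)=\sum_{i:x_i(t)=y}b_i(t-)$ for all $t\in(0,T]$, $y\in\mathbb R$; and on $(0,T)\setminus S$ $$\frac{d}{dt}x_i=\frac1n\sum_{j\ne i}b_ib_j f(x_i-x_j)+b_i g(x_i),\qquad i=1,\dots,n.$$ A *collision point* is a pair $(\tau,y)\in(0,T]\times\mathbb R$ such that $x_i(\tau)=x_j(\tau)=y$ for some $i\neq j$ with $b_i(\tau-)\ne0\neq b_j(\tau-)$; then $\tau$ is a *collision time*. A *relabeling* of a solution on a time interval is a permutation of the indices of its particles. **Theorem.** Let $(\mathbf x^\circ,\mathbf b^\circ)\in\mathcal Z_n$. Then $(P_n)$ has a solution with this initial datum, and it is unique modulo relabeling: for any two solutions with this initial datum there are permutations $\mu_t$ of $\{1,\dots,n\}$, $t\in[0,T]$, which as a function of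 $t$ change only at collision times of the first solution, such that at every time $t\in[0,T]$ the position and charge of particle $i$ in the second solution are those of particle $\mu_t(i)$ in the first. Moreover, every solution $(\mathbf x,\mathbf b)$ with this initial datum has a finite set $\mathcal S=\{\tau_1<\dots<\tau_K\}$ of collision times, and: (i) There is $c>0$ with $d^\pm(t)\ge c$ for all $t\in[0,T]$. (ii) There is $C>0$ such that for every $t_0\in[0,T]$ and all $i<j$ that are neighbors of opposite sign at time $t_0$ there is $c>0$ with $$x_j(t)-x_i(t)\ge\big(c-C(t-t_0)\big)^{1/(2+a)}\quad\text{for all } t_0\le t\le \min\{T,\,t_0+c/C\}.$$ (iii) For all $\tau\in \mathcal S$ and all $i<j$ with $x_i(\tau)=x_j(\tau)$ that are neighbors just before $\tau$ (i.e. with respect to $\mathbf b(\tau-)$), there is $C>0$ with $x_j(t)-x_i(t)\le C(\tau-t)^{1/(2+a)}$ for all $t\in[0,\tau]$. (iv) Suppose that $|xf'(x)|\ge c'/x^{1+a'}$ for all $x\in(0,\varepsilon_0)$, for some $a'\in(-1,a]$ and $c',\varepsilon_0>0$. Then for each collision point $(\tau,y)$ there are $c>0$ and $i<j$ with $x_i(\tau)=x_j(\tau)=y$,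 $b_i(\tau-)\ne0$, $b_j(\tau-)\ne0$, such that $$x_j(t)-y>c(\tau-t)^{1/(2+a')},\qquad x_i(t)-y<-c(\tau-t)^{1/(2+a')}$$ for all $t<\tau$ sufficiently close to $\tau$. (v) Put $\tau_0:=0$ and $\tau_{K+1}:=T$. For $\sigma>0$ let $g^\sigma:\mathbb R\to\mathbb R$ be Lipschitz continuous with $\|g^\sigma-g\|_\infty\to0$ as $\sigma\to 0$, let $(\mathbf x^{\sigma,\circ},\mathbf b^\circ)\in\mathcal Z_n$ with $\mathbf x^{\sigma,\circ}\to\mathbf x^\circ$ as $\sigma\to0$, and let $(\mathbf x^\sigma,\mathbf b^\sigma)$ be a solution of $(P_n)$ with initial datum $(\mathbf x^{\sigma,\circ},\mathbf b^\circ)$ and with $g^\sigma$ in place of $g$. Then for each $k=0,\dots,K$ there is a relabeling of $(\mathbf x^\sigma,\mathbf b^\sigma)$ on $[\tau_k,\tau_{k+1}]$ (which may depend on $k,\sigma$) after which $\mathbf x^\sigma\to\mathbf x$ in $C([\tau_k,\tau_{k+1}];\mathbb R^n)$ as $\sigma\to0$ and, for every $[t_0,t_1]\subset(\tau_k,\tau_{k+1})$,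 $\mathbf b^\sigma=\mathbf b$ on $[t_0,t_1]$ for all $\sigma$ small enough. -/

import Mathlib

open Set Filter Topology MeasureTheory
open scoped ContDiff

namespace ParticleAnnihilation

/-! ### The interaction force `f` and the external force `g` -/

/-- `v` is the weak derivative of `u` on `(0, ∞)`, both being locally integrable there. -/
def IsWeakDeriv (u v : ℝ → ℝ) : Prop :=
  LocallyIntegrableOn u (Ioi 0) ∧ LocallyIntegrableOn v (Ioi 0) ∧
    ∀ φ : ℝ → ℝ, ContDiff ℝ ∞ φ → HasCompactSupport φ → tsupport φ ⊆ Ioi 0 →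
      ∫ x in Ioi 0, u x * deriv φ x = -∫ x in Ioi 0, v x * φ x

/-- The assumptions on the interaction force `f` and the external force `g`.
The force `f` is a function on `ℝ \ {0}` which is extended by `f 0 = 0`; this is part of `odd`. -/
structure ForceAssumption (f g : ℝ → ℝ) (a : ℝ) : Prop where
  lipschitz : ∃ K, LipschitzWith K g
  odd : ∀ x, f (-x) = -f x
  /-- On `(0, ∞)`, `f` is the continuous representative of an element of `W^{2,1}_loc(0, ∞)`,
  and its (weak) derivatives satisfy `f' ≤ 0` and `f'' ≥ 0`. -/
  continuousOn : ContinuousOn f (Ioi 0)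
  sobolev : ∃ f₁ f₂ : ℝ → ℝ, IsWeakDeriv f f₁ ∧ IsWeakDeriv f₁ f₂ ∧
    (∀ᵐ x ∂volume.restrict (Ioi 0), f₁ x ≤ 0) ∧ (∀ᵐ x ∂volume.restrict (Ioi 0), 0 ≤ f₂ x)
  nonneg : ∀ x, 0 < x → 0 ≤ f x
  /-- A continuous element of `W^{2,1}_loc(0, ∞)` is continuously differentiable on `(0, ∞)`, so
  `deriv f` is the classical derivative. -/
  singLB : Tendsto (fun x => x * deriv f x) (𝓝[>] 0) atBot
  neg_one_lt : -1 < a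
  singUB : ∃ C : ℝ, 0 < C ∧ ∀ x ∈ Ioo (0 : ℝ) 1, f x ≤ C / x ^ (1 + a)

/-! ### States -/

/-- The state space: charged particles are numbered strictly from left to right. -/
def stateSpace (n : ℕ) : Set ((Fin n → ℝ) × (Fin n → SignType)) :=
  {z | ∀ i j, i < j → z.2 i * z.2 j ≠ 0 → z.1 i < z.1 j}

/-- `i < j` are neighbors: both are charged and all particles in between are neutral. -/
def AreNeighbors {n : ℕ} (b : Fin n → SignType) (i j : Fin n) : Prop :=
  i < j ∧ b i * b j ≠ 0 ∧ ∀ k, i < k → k < j → b k = 0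

/-- For `s = 1` (resp. `s = -1`), the smallest distance `d⁺` (resp. `d⁻`) between neighbors of
charge `s`; it is `⊤` if there are none. -/
noncomputable def sameSignDist {n : ℕ} (s : SignType) (x : Fin n → ℝ) (b : Fin n → SignType) :
    EReal :=
  ⨅ (i : Fin n) (j : Fin n) (_ : AreNeighbors b i j ∧ b i = s ∧ b j = s), ((x j - x i : ℝ) : EReal)

/-! ### Solutions -/

/-- `β = b(t-)`. -/
def HasLeftLimit {n : ℕ} (b : ℝ → Fin n → SignType) (t : ℝ) (β : Fin n → SignType) : Prop :=
  Tendsto b (𝓝[<] t) (𝓝 β)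

/-- `b i` jumps (is discontinuous, as a function on `[0, T]`) at `t`. -/
def JumpsAt {n : ℕ} (T : ℝ) (b : ℝ → Fin n → SignType) (i : Fin n) (t : ℝ) : Prop :=
  t ∈ Icc 0 T ∧ ¬ ContinuousWithinAt (fun s => b s i) (Icc 0 T) t

/-- The right-hand side of the ODE for particle `i`. -/
noncomputable def velocity {n : ℕ} (f g : ℝ → ℝ) (x : Fin n → ℝ) (b : Fin n → SignType)
    (i : Fin n) : ℝ :=
  1 / (n : ℝ) * ∑ j ∈ Finset.univ.erase i, (b i : ℝ) * (b j : ℝ) * f (x i - x j)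
    + (b i : ℝ) * g (x i)

/-- `(x, b) : [0, T] → stateSpace n` solves the annihilating particle system with initial datum
`(x₀, b₀)`; the values of `x` and `b` outside `[0, T]` are irrelevant. -/
def IsSolution {n : ℕ} (T : ℝ) (f g : ℝ → ℝ) (x₀ : Fin n → ℝ) (b₀ : Fin n → SignType)
    (x : ℝ → Fin n → ℝ) (b : ℝ → Fin n → SignType) : Prop :=
  (∀ t ∈ Icc 0 T, (x t, b t) ∈ stateSpace n) ∧
  ∃ S : Set ℝ, S.Finite ∧ S ⊆ Ioc 0 T ∧
    -- regularity
    ContinuousOn x (Icc 0 T) ∧ ContDiffOn ℝ 1 x (Ioo 0 T \ S) ∧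
    (∀ i, ∀ t ∈ Ico 0 T, ContinuousWithinAt (fun s => b s i) (Ici t) t) ∧
    -- initial condition
    x 0 = x₀ ∧ b 0 = b₀ ∧
    -- annihilation rule
    (∀ i s t, JumpsAt T b i s → JumpsAt T b i t → s = t) ∧
    (∀ i t, JumpsAt T b i t →
      t ∈ S ∧ (∃ β, HasLeftLimit b t β ∧ β i ≠ 0) ∧ b t i = 0) ∧
    (∀ t ∈ Ioc 0 T, ∃ β, HasLeftLimit b t β ∧
      ∀ y, ∑ i with x t i = y, (b t i : ℤ) = ∑ i with x t i = y, (β i : ℤ)) ∧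
    -- ODE
    (∀ t ∈ Ioo 0 T \ S, ∀ i, HasDerivAt (fun s => x s i) (velocity f g (x t) (b t) i) t)

/-- `(τ, y)` is a collision point: at least two particles which are charged just before time `τ`
meet at `y` at time `τ`. -/
def IsCollisionPoint {n : ℕ} (T : ℝ) (x : ℝ → Fin n → ℝ) (b : ℝ → Fin n → SignType)
    (τ y : ℝ) : Prop :=
  τ ∈ Ioc 0 T ∧ ∃ β, HasLeftLimit b τ β ∧
    ∃ i j, i ≠ j ∧ β i ≠ 0 ∧ β j ≠ 0 ∧ x τ i = y ∧ x τ j = y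

/-- The set of all collision times. -/
def collisionTimes {n : ℕ} (T : ℝ) (x : ℝ → Fin n → ℝ) (b : ℝ → Fin n → SignType) : Set ℝ :=
  {τ | ∃ y, IsCollisionPoint T x b τ y}

/-- `(x', b')` is obtained from `(x, b)` by a relabeling of the particles: a permutation of the
indices which may change only at the collision times. -/
def IsRelabeling {n : ℕ} (T : ℝ) (x : ℝ → Fin n → ℝ) (b : ℝ → Fin n → SignType)
    (x' : ℝ → Fin n → ℝ) (b' : ℝ → Fin n → SignType) : Prop :=
  ∃ μ : ℝ → Equiv.Perm (Fin n),
    (∀ s t, 0 ≤ s → s ≤ t → t ≤ T → Disjoint (Ioc s t) (collisionTimes T x b) → μ s = μ t) ∧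
    ∀ t ∈ Icc 0 T, ∀ i, x' t i = x t (μ t i) ∧ b' t i = b t (μ t i)

end ParticleAnnihilation

open ParticleAnnihilation

namespace ParticleAnnihilation

/-! When particles meet, the signs of the charges in the meeting cluster alternate, and the proof
rests on what alternation does to the forces.

Equal neighbors never come close. If `d` is the smallest distance between equal neighbors, then for
a pair at distance `d` the influence of all other charges is screened (`sum_sub_shift_le`): the
interaction does not shrink the gap (`SameSignSep.force_le`). Only the Lipschitz force `g` can, and
then at most exponentially (`Sol.exists_sameSignSep`). Hence charges that meet alternate in sign.

The predicate `Alternating` is phrased by net charges of initial segments of a cluster, because net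
charge is what annihilation conserves; it therefore survives any collision within the cluster
(`Alternating.annihilate`). Summation by parts shows that the outermost charges of an alternating
cluster are pulled inward. Subtracting from `f` its tangent at the diameter `R`, or a constant,
makes this quantitative: the attraction is at least the smaller of `f R` and `-R * f'(R)`
(`Alternating.internalForce_sub_le`). Both blow up as `R` tends to zero. This gives the central
result `collapse`: a solution that starts close enough to an alternating configuration stays close
to it, and after a short time each cluster contains at most one charge. The order and number of the
collisions on the way are irrelevant.

Existence: between collisions the equation is solved by Picard–Lindelöf. At the end of a maximal
interval, a priori bounds give a cluster point, `collapse` turns it into a limit, and one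
annihilates there; the number of charges drops, so finitely many steps suffice (`exists_sol`).

Stability: while the charges are constant, use Grönwall (`Sol.continuous_dependence`). Across a
collision, `collapse` keeps the perturbed solution near the limit and leaves at most one charge per
cluster; with the conserved net charges this determines the outcome up to a permutation inside the
clusters (`ConvergesOn.extend`, `ConvergesOn.restart`). Uniqueness modulo relabeling is stability of
a constant family.

Rates: near a collision the velocities are those caused by the own cluster, up to a bounded error.
For opposite neighbors the rest of the cluster pulls outward, so the gap satisfies `D' ≥ -κ / D ^ (1
+ a)`; the diameter of the cluster satisfies the reverse inequality with `a'`. Both integrate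
explicitly. Since the internal forces sum to zero, the center of mass hardly moves, so the lower
bound on the diameter passes to both outermost particles. -/

/-! ### Monotonicity and convexity from weak derivatives -/

/-- The integral of `ψ` over the window `[y, y + h]`. -/
noncomputable def window (h : ℝ) (ψ : ℝ → ℝ) (y : ℝ) : ℝ := ∫ t in y..(y + h), ψ t

lemma hasDerivAt_window (h : ℝ) {ψ : ℝ → ℝ} (hψ : Continuous ψ) (y : ℝ) :
    HasDerivAt (window h ψ) (ψ (y + h) - ψ y) y := by
  have h1 : ∀ z, window h ψ z = (∫ t in (0 : ℝ)..(z + h), ψ t) - ∫ t in (0 : ℝ)..z, ψ t := fun z => by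
    rw [window, intervalIntegral.integral_interval_sub_left] <;>
      exact hψ.intervalIntegrable _ _
  rw [funext h1]
  have h2 : ∀ z, HasDerivAt (fun u => ∫ t in (0 : ℝ)..u, ψ t) (ψ z) z := fun z =>
    intervalIntegral.integral_hasDerivAt_right (hψ.intervalIntegrable _ _)
      (hψ.stronglyMeasurableAtFilter _ _) hψ.continuousAt
  exact ((h2 (y + h)).comp_add_const y h).sub (h2 y)

lemma deriv_window (h : ℝ) {ψ : ℝ → ℝ} (hψ : Continuous ψ) :
    deriv (window h ψ) = fun y => ψ (y + h) - ψ y :=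
  funext fun y => (hasDerivAt_window h hψ y).deriv

lemma contDiff_window (h : ℝ) {ψ : ℝ → ℝ} (hψ : ContDiff ℝ ∞ ψ) : ContDiff ℝ ∞ (window h ψ) := by
  rw [contDiff_infty_iff_deriv, deriv_window h hψ.continuous]
  exact ⟨fun y => (hasDerivAt_window h hψ.continuous y).differentiableAt,
    (hψ.comp (contDiff_id.add contDiff_const)).sub hψ⟩

lemma window_nonneg {h : ℝ} (hh : 0 ≤ h) {ψ : ℝ → ℝ} (hψ : ∀ y, 0 ≤ ψ y) (y : ℝ) :
    0 ≤ window h ψ y :=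
  intervalIntegral.integral_nonneg (by linarith) fun t _ => hψ t

lemma tsupport_window {h : ℝ} (hh : 0 ≤ h) {ψ : ℝ → ℝ} {p q : ℝ} (hψ : tsupport ψ ⊆ Icc p q) :
    tsupport (window h ψ) ⊆ Icc (p - h) q := by
  refine closure_minimal (fun y hy => ?_) isClosed_Icc
  by_contra hcon
  apply hy
  have h0 : ∀ t ∈ uIcc y (y + h), ψ t = 0 := fun t ht => by
    rw [uIcc_of_le (by linarith)] at ht
    refine image_eq_zero_of_notMem_tsupport fun ht' => hcon ?_
    have := hψ ht'
    exact ⟨by linarith [ht.2, this.1], by linarith [ht.1, this.2]⟩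
  rw [window, intervalIntegral.integral_congr (g := fun _ => (0 : ℝ)) h0]
  simp

/-- A continuous function on `(0, ∞)` whose integral against each bump is nonnegative. -/
lemma nonneg_of_integral_bump_nonneg {F : ℝ → ℝ} (hF : Continuous F) {x r : ℝ} (hr : 0 < r)
    (h : ∀ ρ : ℝ → ℝ, ContDiff ℝ ∞ ρ → (∀ y, 0 ≤ ρ y) → tsupport ρ ⊆ Icc (x - r) (x + r) →
      0 ≤ ∫ y, F y * ρ y) : 0 ≤ F x := by
  by_contra! hx
  obtain ⟨δ, hδ, hball⟩ := Metric.continuous_iff.1 hF x (-F x) (by linarith)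
  let ρ : ContDiffBump x := ⟨min r (δ / 2) / 2, min r (δ / 2), by positivity, by
    have : 0 < min r (δ / 2) := by positivity
    linarith⟩
  have hts : tsupport ρ = Metric.closedBall x (min r (δ / 2)) := ρ.tsupport_eq
  have h1 := h ρ ρ.contDiff (fun y => ρ.nonneg) (by
    rw [hts, Real.closedBall_eq_Icc]
    exact Icc_subset_Icc (by linarith [min_le_left r (δ / 2)]) (by linarith [min_le_left r (δ / 2)]))
  have h2 : 0 < ∫ y, -F y * ρ y := by
    refine Continuous.integral_pos_of_hasCompactSupport_nonneg_nonzero (x := x)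
      (hF.neg.mul ρ.continuous) ρ.hasCompactSupport.mul_left (fun y => ?_) ?_
    · by_cases hy : y ∈ tsupport ρ
      · rw [hts] at hy
        have := hball y (lt_of_le_of_lt hy (lt_of_le_of_lt (min_le_right _ _) (by linarith)))
        rw [Real.dist_eq, abs_lt] at this
        exact mul_nonneg (by linarith [this.2]) ρ.nonneg
      · simp [image_eq_zero_of_notMem_tsupport hy]
    · have : ρ x = 1 := ρ.one_of_mem_closedBall (Metric.mem_closedBall_self (by
        have : 0 < min r (δ / 2) := by positivity
        show 0 ≤ min r (δ / 2) / 2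
        linarith))
      simp only [this]
      linarith
  have h3 : ∫ y, -F y * ρ y = -∫ y, F y * ρ y := by
    rw [← integral_neg]; simp
  linarith

lemma setIntegral_eq_integral_extend {f ρ : ℝ → ℝ} {p : ℝ} (hp : 0 < p)
    (hρ : tsupport ρ ⊆ Ici p) :
    ∫ y in Ioi 0, f y * ρ y = ∫ y, f (max p y) * ρ y := by
  have h1 : ∀ y, y ∉ Ioi (0 : ℝ) → f (max p y) * ρ y = 0 := fun y hy => by
    rw [image_eq_zero_of_notMem_tsupport (f := ρ), mul_zero]
    intro h; exact hy (lt_of_lt_of_le hp (hρ h))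
  rw [← setIntegral_eq_integral_of_forall_compl_eq_zero h1]
  refine setIntegral_congr_fun measurableSet_Ioi fun y _ => ?_
  by_cases hy : y ∈ tsupport ρ
  · have : max p y = y := max_eq_right (mem_Ici.1 (hρ hy))
    simp only [this]
  · simp [image_eq_zero_of_notMem_tsupport hy]

lemma integral_mul_shift {F : ℝ → ℝ} {ρ : ℝ → ℝ} (h : ℝ) :
    ∫ y, F y * ρ (y + h) = ∫ y, F (y - h) * ρ y := by
  rw [← integral_sub_right_eq_self (fun y => F y * ρ (y + h)) h]
  simp

/-- The test function is the window integral of a bump `ρ`, with derivative `ρ (y + h) - ρ y`. This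
turns the sign of `f₁` into `∫ (f (y - h) - f y) * ρ y ≥ 0`, and concentrating `ρ` gives the
pointwise inequality. -/
lemma antitone_of_weakDeriv {f f₁ : ℝ → ℝ} (hf : ContinuousOn f (Ioi 0)) (h1 : IsWeakDeriv f f₁)
    (hneg : ∀ᵐ x ∂volume.restrict (Ioi 0), f₁ x ≤ 0) : AntitoneOn f (Ioi 0) := by
  intro x hx z hz hxz
  have hx : 0 < x := hx
  rcases hxz.eq_or_lt with rfl | hxz
  · exact le_rfl
  obtain ⟨h, hh, rfl⟩ : ∃ h, 0 < h ∧ z = x + h := ⟨z - x, by linarith, by ring⟩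
  -- Freezing `f` to the left of `x / 2` makes it continuous on the whole line without changing it
  -- on the supports of the test functions.
  set F : ℝ → ℝ := fun y => f (max (x / 2) y) with hFdef
  have hF : Continuous F := continuousOn_univ.1 <| hf.comp (by fun_prop) fun y _ =>
    lt_of_lt_of_le (by linarith : 0 < x / 2) (le_max_left _ _)
  have key : 0 ≤ F (x + h - h) - F (x + h) := by
    refine nonneg_of_integral_bump_nonneg (F := fun y => F (y - h) - F y) (by fun_prop)
      (r := x / 2) (by linarith) fun ρ hρ hρ0 hρs => ?_
    have hρc : HasCompactSupport ρ := isCompact_Icc.of_isClosed_subset (isClosed_tsupport _) hρs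
    have hws := tsupport_window hh.le hρs
    have e := h1.2.2 (window h ρ) (contDiff_window h hρ)
      (isCompact_Icc.of_isClosed_subset (isClosed_tsupport _) hws)
      (hws.trans fun y hy => show 0 < y by linarith [hy.1])
    have e2 : 0 ≤ -∫ y in Ioi 0, f₁ y * window h ρ y := by
      rw [← integral_neg]
      refine integral_nonneg_of_ae ?_
      filter_upwards [hneg] with y hy
      have := mul_nonneg (neg_nonneg.2 hy) (window_nonneg hh.le hρ0 y)
      simp only [Pi.zero_apply]; linarith
    rw [← e, deriv_window h hρ.continuous, setIntegral_eq_integral_extend (p := x / 2) (by linarith)] at e2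
    · have i1 : Integrable fun y => F y * ρ (y + h) :=
        Continuous.integrable_of_hasCompactSupport (by fun_prop)
          ((hρc.comp_homeomorph (Homeomorph.addRight h)).mul_left)
      have i2 : Integrable fun y => F y * ρ y :=
        Continuous.integrable_of_hasCompactSupport (by fun_prop) hρc.mul_left
      have i3 : Integrable fun y => F (y - h) * ρ y :=
        Continuous.integrable_of_hasCompactSupport (by fun_prop) hρc.mul_left
      simp only [mul_sub] at e2
      rw [integral_sub i1 i2, integral_mul_shift] at e2
      simp only [sub_mul]
      rwa [integral_sub i3 i2]
    · refine closure_minimal (fun y hy => ?_) isClosed_Ici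
      by_contra hc
      have hc : y < x / 2 := not_le.1 hc
      apply hy
      have hz : ∀ c, 0 ≤ c → c ≤ h → ρ (y + c) = 0 := fun c _ _ =>
        image_eq_zero_of_notMem_tsupport fun h' => by linarith [(hρs h').1]
      have z0 := hz 0 le_rfl hh.le
      rw [add_zero] at z0
      simp [z0, hz h hh.le le_rfl]
  simp only [hFdef, add_sub_cancel_right] at key
  rw [max_eq_right (by linarith), max_eq_right (by linarith)] at key
  linarith

/-- The window integral is applied twice: its second derivative is a second difference of `ρ`, so
the sign of `f₂` passes to second differences of `f`. -/
lemma midpoint_convex_of_weakDeriv {f f₁ f₂ : ℝ → ℝ} (hf : ContinuousOn f (Ioi 0))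
    (h1 : IsWeakDeriv f f₁) (h2 : IsWeakDeriv f₁ f₂)
    (hpos : ∀ᵐ x ∂volume.restrict (Ioi 0), 0 ≤ f₂ x) {x h : ℝ} (hx : 0 < x) (hh : 0 < h) :
    2 * f (x + h) ≤ f x + f (x + 2 * h) := by
  set F : ℝ → ℝ := fun y => f (max (x / 2) y) with hFdef
  have hF : Continuous F := continuousOn_univ.1 <| hf.comp (by fun_prop) fun y _ =>
    lt_of_lt_of_le (by linarith : 0 < x / 2) (le_max_left _ _)
  have key : 0 ≤ F (x + 2 * h - 2 * h) - 2 * F (x + 2 * h - h) + F (x + 2 * h) := by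
    refine nonneg_of_integral_bump_nonneg (F := fun y => F (y - 2 * h) - 2 * F (y - h) + F y)
      (by fun_prop) (r := x / 2) (by linarith) fun ρ hρ hρ0 hρs => ?_
    have hρc : HasCompactSupport ρ := isCompact_Icc.of_isClosed_subset (isClosed_tsupport _) hρs
    have hws := tsupport_window hh.le hρs
    have hws2 := tsupport_window hh.le hws
    have hw := contDiff_window h hρ
    have hw2 := contDiff_window h hw
    have hd : deriv (window h (window h ρ)) = fun y => window h ρ (y + h) - window h ρ y :=
      deriv_window h hw.continuous
    have hdd : deriv (deriv (window h (window h ρ))) =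
        fun y => (ρ (y + h + h) - ρ (y + h)) - (ρ (y + h) - ρ y) := by
      rw [hd]
      funext y
      exact (((hasDerivAt_window h hρ.continuous (y + h)).comp_add_const y h).sub
        (hasDerivAt_window h hρ.continuous y)).deriv
    have hcs : HasCompactSupport (window h (window h ρ)) :=
      isCompact_Icc.of_isClosed_subset (isClosed_tsupport _) hws2
    have hsub : tsupport (window h (window h ρ)) ⊆ Ioi 0 :=
      hws2.trans fun y hy => show 0 < y by linarith [hy.1]
    have e := h1.2.2 (deriv (window h (window h ρ))) (contDiff_infty_iff_deriv.1 hw2).2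
      hcs.deriv (tsupport_deriv_subset.trans hsub)
    have e' := h2.2.2 _ hw2 hcs hsub
    have e2 : 0 ≤ ∫ y in Ioi 0, f₂ y * window h (window h ρ) y := by
      refine integral_nonneg_of_ae ?_
      filter_upwards [hpos] with y hy
      exact mul_nonneg hy (window_nonneg hh.le (window_nonneg hh.le hρ0) y)
    have e3 : 0 ≤ ∫ y in Ioi 0, f y * deriv (deriv (window h (window h ρ))) y := by
      rw [e, e', neg_neg]; exact e2
    rw [hdd, setIntegral_eq_integral_extend (p := x / 2) (by linarith)] at e3
    · have j : ∀ c, Integrable fun y => F y * ρ (y + c) := fun c =>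
        Continuous.integrable_of_hasCompactSupport (by fun_prop)
          ((hρc.comp_homeomorph (Homeomorph.addRight c)).mul_left)
      have i2 : Integrable fun y => F y * ρ y :=
        Continuous.integrable_of_hasCompactSupport (by fun_prop) hρc.mul_left
      have i3 : ∀ c, Integrable fun y => F (y - c) * ρ y := fun c =>
        Continuous.integrable_of_hasCompactSupport (by fun_prop) hρc.mul_left
      have e4 : (fun y => f (max (x / 2) y) * ((ρ (y + h + h) - ρ (y + h)) - (ρ (y + h) - ρ y))) =
          fun y => (F y * ρ (y + 2 * h) - 2 * (F y * ρ (y + h))) + F y * ρ y := by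
        funext y
        rw [show y + 2 * h = y + h + h by ring]
        simp only [hFdef]; ring
      have j' : Integrable fun y => F y * ρ (y + 2 * h) - 2 * (F y * ρ (y + h)) :=
        (j _).sub ((j _).const_mul 2)
      have i3' : Integrable fun y => F (y - 2 * h) * ρ y - 2 * (F (y - h) * ρ y) :=
        (i3 _).sub ((i3 _).const_mul 2)
      rw [e4, integral_add j' i2, integral_sub (j _) ((j _).const_mul 2),
        integral_const_mul, integral_mul_shift, integral_mul_shift] at e3
      have e5 : (fun y => (F (y - 2 * h) - 2 * F (y - h) + F y) * ρ y) =
          fun y => (F (y - 2 * h) * ρ y - 2 * (F (y - h) * ρ y)) + F y * ρ y := by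
        funext y; ring
      rw [e5, integral_add i3' i2,
        integral_sub (i3 _) ((i3 _).const_mul 2), integral_const_mul]
      exact e3
    · refine closure_minimal (fun y hy => ?_) isClosed_Ici
      by_contra hc
      have hc : y < x / 2 := not_le.1 hc
      apply hy
      have hz : ∀ c, 0 ≤ c → c ≤ 2 * h → ρ (y + c) = 0 := fun c _ _ =>
        image_eq_zero_of_notMem_tsupport fun h' => by linarith [(hρs h').1]
      have z0 := hz 0 le_rfl (by linarith)
      have z1 := hz h hh.le (by linarith)
      have z2 := hz (2 * h) (by linarith) le_rfl
      rw [add_zero] at z0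
      rw [show y + 2 * h = y + h + h by ring] at z2
      simp [z0, z1, z2]
  simp only [hFdef] at key
  rw [max_eq_right (by linarith), max_eq_right (by linarith), max_eq_right (by linarith)] at key
  rw [show x + 2 * h - 2 * h = x by ring, show x + 2 * h - h = x + h by ring] at key
  linarith

/-- If chord slopes decreased somewhere, `f` minus its chord over `[x, z]` would have an interior
maximum. At the last maximizer the midpoint inequality fails, strictly because no point to its right
attains the maximum. -/
lemma convexOn_of_midpoint {f : ℝ → ℝ} (hf : ContinuousOn f (Ioi 0))
    (hmid : ∀ x h, 0 < x → 0 < h → 2 * f (x + h) ≤ f x + f (x + 2 * h)) :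
    ConvexOn ℝ (Ioi 0) f := by
  refine convexOn_of_slope_mono_adjacent (convex_Ioi 0) fun {x y z} hx hz hxy hyz => ?_
  have hx : 0 < x := hx
  by_contra! hcon
  set m := (f z - f x) / (z - x) with hm
  set D : ℝ → ℝ := fun t => f t - m * (t - x) with hD
  have hDc : ContinuousOn D (Icc x z) :=
    (hf.mono fun t ht => lt_of_lt_of_le hx ht.1).sub (by fun_prop)
  have hDz : D z = D x := by
    simp only [hD, hm]; field_simp [(by linarith : z - x ≠ 0)]; ring
  have hDy : D x < D y := by
    have hxy' : 0 < y - x := by linarith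
    have hyz' : 0 < z - y := by linarith
    have hxz' : 0 < z - x := by linarith
    rw [div_lt_div_iff₀ hyz' hxy'] at hcon
    simp only [hD, hm]
    have : (f z - f x) / (z - x) * (y - x) < f y - f x := by
      rw [div_mul_eq_mul_div, div_lt_iff₀ hxz']
      nlinarith
    linarith
  obtain ⟨v, hv, hmax⟩ := isCompact_Icc.exists_isMaxOn ⟨x, by constructor <;> linarith⟩ hDc
  have hK : IsCompact (Icc x z ∩ D ⁻¹' {D v}) :=
    isCompact_Icc.of_isClosed_subset
      (hDc.preimage_isClosed_of_isClosed isClosed_Icc isClosed_singleton) inter_subset_left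
  obtain ⟨⟨hw, hwv⟩, hwmax⟩ := hK.isGreatest_sSup ⟨v, hv, rfl⟩
  set w := sSup (Icc x z ∩ D ⁻¹' {D v})
  have hwv : D w = D v := hwv
  have hle : ∀ t ∈ Icc x z, D t ≤ D w := fun t ht => hwv ▸ hmax ht
  have hyw := hle y ⟨hxy.le, hyz.le⟩
  have hxw : x < w := lt_of_le_of_ne hw.1 fun h => by rw [← h] at hyw; linarith
  have hwz : w < z := lt_of_le_of_ne hw.2 fun h => by rw [h] at hyw; linarith
  set h := min (w - x) (z - w) with hh
  have hh0 : 0 < h := lt_min (by linarith) (by linarith)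
  have hh1 : h ≤ w - x := min_le_left _ _
  have hh2 : h ≤ z - w := min_le_right _ _
  have h1 := hle (w - h) ⟨by linarith, by linarith⟩
  have h2 : D (w + h) < D w := lt_of_le_of_ne (hle _ ⟨by linarith, by linarith⟩) fun heq => by
    have : w + h ≤ w := hwmax ⟨⟨by linarith, by linarith⟩, by
      rw [mem_preimage, mem_singleton_iff, heq, hwv]⟩
    linarith
  have h3 := hmid (w - h) h (by linarith) hh0
  rw [show w - h + h = w by ring, show w - h + 2 * h = w + h by ring] at h3
  simp only [hD] at h1 h2
  linarith

/-! ### Singular repulsive forces -/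

/-- The properties of the interaction force that are used throughout. -/
structure Repulsive (f : ℝ → ℝ) : Prop where
  odd : ∀ x, f (-x) = -f x
  nonneg : ∀ x, 0 < x → 0 ≤ f x
  anti : AntitoneOn f (Ioi 0)
  convex : ConvexOn ℝ (Ioi 0) f
  sing : Tendsto (fun x => x * deriv f x) (𝓝[>] 0) atBot

lemma ForceAssumption.repulsive {f g : ℝ → ℝ} {a : ℝ} (h : ForceAssumption f g a) :
    Repulsive f := by
  obtain ⟨f₁, f₂, h1, h2, hneg, hpos⟩ := h.sobolev
  exact ⟨h.odd, h.nonneg, antitone_of_weakDeriv h.continuousOn h1 hneg,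
    convexOn_of_midpoint h.continuousOn fun x k hx hk =>
      midpoint_convex_of_weakDeriv h.continuousOn h1 h2 hpos hx hk, h.singLB⟩

namespace Repulsive

variable {f : ℝ → ℝ} (hf : Repulsive f)
include hf

lemma map_zero : f 0 = 0 := by
  have := hf.odd 0
  rw [neg_zero] at this; linarith

lemma map_sub_comm (x y : ℝ) : f (x - y) = -f (y - x) := by
  rw [← hf.odd, neg_sub]

lemma le_of_le {u v : ℝ} (hu : 0 < u) (h : u ≤ v) : f v ≤ f u :=
  hf.anti hu (lt_of_lt_of_le hu h) h

lemma abs_le {c u : ℝ} (hc : 0 < c) (h : c ≤ |u|) : |f u| ≤ f c := by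
  have hpos : ∀ v, c ≤ v → |f v| ≤ f c := fun v hv => by
    rw [abs_of_nonneg (hf.nonneg v (lt_of_lt_of_le hc hv))]; exact hf.le_of_le hc hv
  rcases le_total 0 u with hu | hu
  · exact hpos u (by rwa [abs_of_nonneg hu] at h)
  · have := hpos (-u) (by rwa [abs_of_nonpos hu] at h)
    rwa [hf.odd, abs_neg] at this

/-- The increments of `f` are monotone. -/
lemma sub_le_sub {u v h : ℝ} (hu : 0 < u) (huv : u ≤ v) (hh : 0 ≤ h) :
    f v - f (v + h) ≤ f u - f (u + h) := by
  rcases hh.eq_or_lt with rfl | hh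
  · simp
  rcases huv.eq_or_lt with rfl | huv
  · exact le_rfl
  have hv : 0 < v := hu.trans huv
  have hc := hf.convex.2
  have h1 := hc (show u ∈ Ioi 0 from hu) (show v + h ∈ Ioi 0 from by simp only [mem_Ioi]; linarith)
    (a := h / (v + h - u)) (b := (v - u) / (v + h - u))
    (div_nonneg (by linarith) (by linarith)) (div_nonneg (by linarith) (by linarith))
    (by rw [← add_div, div_eq_one_iff_eq (by linarith)]; ring)
  have h2 := hc (show u ∈ Ioi 0 from hu) (show v + h ∈ Ioi 0 from by simp only [mem_Ioi]; linarith)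
    (a := (v - u) / (v + h - u)) (b := h / (v + h - u))
    (div_nonneg (by linarith) (by linarith)) (div_nonneg (by linarith) (by linarith))
    (by rw [← add_div, div_eq_one_iff_eq (by linarith)]; ring)
  have hne : v + h - u ≠ 0 := by linarith
  simp only [smul_eq_mul] at h1 h2
  rw [show h / (v + h - u) * u + (v - u) / (v + h - u) * (v + h) = v by field_simp; ring] at h1
  rw [show (v - u) / (v + h - u) * u + h / (v + h - u) * (v + h) = u + h by field_simp; ring] at h2
  have h3 : h / (v + h - u) + (v - u) / (v + h - u) = 1 := by
    rw [← add_div, div_eq_one_iff_eq (by linarith)]; ring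
  have h4 : (v - u) / (v + h - u) = 1 - h / (v + h - u) := by linarith
  rw [h4] at h1 h2
  linarith

/-- The tangent at `R` has a smaller slope than the chords to the left of `R`. -/
lemma tangent_le {u v R : ℝ} (hu : 0 < u) (huv : u ≤ v) (hvR : v ≤ R) :
    -deriv f R * (v - u) ≤ f u - f v := by
  -- Convexity alone does not exclude kinks; there `deriv f R` has the default value `0` and
  -- monotonicity is enough.
  by_cases hd : DifferentiableAt ℝ f R
  · rcases huv.eq_or_lt with rfl | huv
    · simp
    have hv : 0 < v := hu.trans huv
    have h1 : slope f u v ≤ deriv f R := by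
      rcases hvR.eq_or_lt with rfl | hvR
      · exact hf.convex.slope_le_of_hasDerivAt hu hv huv hd.hasDerivAt
      · have := hf.convex.slope_le_of_hasDerivAt hv (hv.trans hvR) hvR hd.hasDerivAt
        refine le_trans ?_ this
        rw [slope_def_field, slope_def_field]
        exact hf.convex.slope_mono_adjacent hu (hv.trans hvR) huv hvR
    rw [slope_def_field, div_le_iff₀ (by linarith)] at h1
    linarith
  · rw [deriv_zero_of_not_differentiableAt hd]
    linarith [hf.le_of_le hu huv]

lemma deriv_nonpos {R : ℝ} (hR : 0 < R) : deriv f R ≤ 0 := by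
  by_contra! h
  have hd : DifferentiableAt ℝ f R := by
    by_contra hd
    rw [deriv_zero_of_not_differentiableAt hd] at h; exact h.false
  have h2R : R < 2 * R := by linarith
  have := hf.convex.le_slope_of_hasDerivAt hR (show 0 < 2 * R by linarith) h2R hd.hasDerivAt
  rw [slope_def_field] at this
  have h3 := hf.le_of_le hR h2R.le
  have : (f (2 * R) - f R) / (2 * R - R) ≤ 0 := div_nonpos_of_nonpos_of_nonneg (by linarith) (by linarith)
  linarith

/-- The tangent inequality on `[R, 2 * R]` together with `f (2 * R) ≥ 0`. It transfers the
singularity of `x * deriv f x` to `f` itself, with explicit constants. -/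
lemma half_mul_abs_deriv_le {R : ℝ} (hR : 0 < R) : |2 * R * deriv f (2 * R)| / 2 ≤ f R := by
  have h1 := hf.tangent_le hR (by linarith : R ≤ 2 * R) le_rfl
  have h2 := hf.nonneg (2 * R) (by linarith)
  have h3 := hf.deriv_nonpos (by linarith : 0 < 2 * R)
  rw [abs_of_nonpos (mul_nonpos_of_nonneg_of_nonpos (by linarith) h3)]
  linarith

lemma exists_le_neg_mul_deriv (M : ℝ) : ∃ r > 0, ∀ R, 0 < R → R ≤ r → M ≤ -(R * deriv f R) := by
  have := (hf.sing.eventually (eventually_le_atBot (-M)))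
  obtain ⟨r, hr, h⟩ := mem_nhdsGT_iff_exists_Ioc_subset.1 this
  exact ⟨r, hr, fun R h1 h2 => by have := h ⟨h1, h2⟩; simp only [mem_ofPred_eq] at this; linarith⟩

lemma exists_le (M : ℝ) : ∃ r > 0, ∀ R, 0 < R → R ≤ r → M ≤ f R := by
  obtain ⟨r, hr, h⟩ := hf.exists_le_neg_mul_deriv (2 * M)
  refine ⟨r / 2, by linarith, fun R h1 h2 => ?_⟩
  have := hf.half_mul_abs_deriv_le h1
  have h3 := h (2 * R) (by linarith) (by linarith)
  have := neg_le_abs (2 * R * deriv f (2 * R))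
  linarith

/-- `f` is Lipschitz away from the singularity. -/
lemma exists_lipschitz {c : ℝ} (hc : 0 < c) :
    ∃ K ≥ 0, ∀ u v, c ≤ u → c ≤ v → |f u - f v| ≤ K * |u - v| := by
  -- By convexity no chord in `[c, ∞)` is steeper than the chord over `[c / 2, c]`.
  have key : ∀ u v, c ≤ u → u ≤ v → f u - f v ≤ (f (c / 2) - f c) / (c / 2) * (v - u) := by
    intro u v hu huv
    rcases huv.eq_or_lt with rfl | huv
    · simp
    have hu0 : 0 < u := by linarith
    have h2 := hf.convex.slope_mono_adjacent (x := u - c / 2) (y := u) (z := v)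
      (show 0 < u - c / 2 by linarith) (hu0.trans huv) (by linarith) huv
    have h3 := hf.sub_le_sub (u := c / 2) (v := u - c / 2) (h := c / 2) (by linarith)
      (by linarith) (by linarith)
    rw [show u - c / 2 + c / 2 = u by ring, show c / 2 + c / 2 = c by ring] at h3
    rw [show u - (u - c / 2) = c / 2 by ring, div_le_div_iff₀ (by linarith) (by linarith)] at h2
    rw [div_mul_eq_mul_div, le_div_iff₀ (by linarith)]
    nlinarith
  refine ⟨(f (c / 2) - f c) / (c / 2), div_nonneg ?_ (by linarith), fun u v hu hv => ?_⟩
  · linarith [hf.le_of_le (u := c / 2) (v := c) (by linarith) (by linarith)]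
  · rcases le_total u v with h | h
    · rw [abs_of_nonneg (by linarith [hf.le_of_le (lt_of_lt_of_le hc hu) h]), abs_sub_comm,
        abs_of_nonneg (sub_nonneg.2 h)]
      exact key u v hu h
    · rw [abs_sub_comm, abs_of_nonneg (by linarith [hf.le_of_le (lt_of_lt_of_le hc hv) h]),
        abs_of_nonneg (sub_nonneg.2 h)]
      exact key v u hv h

end Repulsive

/-! ### Induction along an interval and barriers -/

/-- Real induction: the set of times up to which `P` holds throughout is closed by `hl` and can be
continued to the right by `hr`. -/
lemma icc_induction {p q : ℝ} {P : ℝ → Prop} (h0 : P p)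
    (hr : ∀ t ∈ Ico p q, (∀ u ∈ Icc p t, P u) → ∀ᶠ s in 𝓝[>] t, P s)
    (hl : ∀ t ∈ Ioc p q, (∀ u ∈ Ico p t, P u) → P t) : ∀ t ∈ Icc p q, P t := by
  suffices h : Icc p q ⊆ {t | ∀ u ∈ Icc p t, P u} from
    fun t ht => h ht t ⟨ht.1, le_rfl⟩
  refine IsClosed.Icc_subset_of_forall_exists_gt ?_ ?_ ?_
  · rw [← closure_subset_iff_isClosed]
    intro t ht
    have htq : t ∈ Icc p q := (isClosed_Icc.closure_subset_iff.2 inter_subset_right) ht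
    refine ⟨fun u hu => ?_, htq⟩
    have hlt : ∀ u ∈ Ico p t, P u := fun u hu => by
      obtain ⟨v, ⟨hv1, hv2⟩, hv⟩ := (mem_closure_iff_nhds.1 ht) (Ioi u) (Ioi_mem_nhds hu.2)
        |>.imp fun v hv => (⟨hv.2, hv.1⟩ : _ ∧ _)
      exact hv1 u ⟨hu.1, (mem_Ioi.1 hv).le⟩
    rcases hu.2.eq_or_lt with rfl | h
    · rcases hu.1.eq_or_lt with rfl | h'
      · exact h0
      · exact hl u ⟨h', htq.2⟩ hlt
    · exact hlt u ⟨hu.1, h⟩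
  · intro u hu
    rw [le_antisymm hu.2 hu.1]; exact h0
  · rintro t ⟨ht, htpq⟩ y hy
    obtain ⟨r, hr1, hr2⟩ := mem_nhdsGT_iff_exists_Ioc_subset.1 (hr t htpq ht)
    have hr1 : t < r := hr1
    have hy : t < y := hy
    refine ⟨min r y, fun u hu => ?_, lt_min hr1 hy, min_le_right _ _⟩
    rcases le_or_gt u t with h | h
    · exact ht u ⟨hu.1, h⟩
    · exact hr2 ⟨h, hu.2.trans (min_le_left _ _)⟩

lemma eventually_pos_of_hasDerivWithinAt {φ : ℝ → ℝ} {t d : ℝ} (h0 : φ t = 0) (hd : 0 < d)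
    (h : HasDerivWithinAt φ d (Ici t) t) : ∀ᶠ s in 𝓝[>] t, 0 < φ s := by
  rw [← hasDerivWithinAt_Ioi_iff_Ici, hasDerivWithinAt_iff_tendsto_slope' (by simp)] at h
  filter_upwards [h.eventually (lt_mem_nhds hd), self_mem_nhdsWithin] with s hs hts
  rw [slope_def_field, h0, sub_zero] at hs
  have hts : t < s := hts
  rwa [div_pos_iff_of_pos_right (by linarith)] at hs

lemma eventually_nhdsGT_mem_Ioc {t q : ℝ} (h : t < q) : ∀ᶠ s in 𝓝[>] t, s ∈ Ioc t q :=
  Ioc_mem_nhdsGT h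

lemma eventually_nhdsLT_mem_Ico {p t : ℝ} (h : p < t) : ∀ᶠ s in 𝓝[<] t, s ∈ Ico p t :=
  Ico_mem_nhdsLT h

lemma ContinuousOn.tendsto_nhdsGT {E : Type*} [TopologicalSpace E] {φ : ℝ → E} {p q t : ℝ}
    (h : ContinuousOn φ (Icc p q)) (ht : t ∈ Ico p q) : Tendsto φ (𝓝[>] t) (𝓝 (φ t)) :=
  (h t ⟨ht.1, ht.2.le⟩).tendsto.mono_left <| nhdsWithin_le_of_mem <|
    mem_of_superset (Ioc_mem_nhdsGT ht.2) fun _ hs => ⟨ht.1.trans hs.1.le, hs.2⟩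

lemma ContinuousOn.tendsto_nhdsLT {E : Type*} [TopologicalSpace E] {φ : ℝ → E} {p q t : ℝ}
    (h : ContinuousOn φ (Icc p q)) (ht : t ∈ Ioc p q) : Tendsto φ (𝓝[<] t) (𝓝 (φ t)) :=
  (h t ⟨ht.1.le, ht.2⟩).tendsto.mono_left <| nhdsWithin_le_of_mem <|
    mem_of_superset (Ico_mem_nhdsLT ht.1) fun _ hs => ⟨hs.1, hs.2.le.trans ht.2⟩

/-- A finite family of functions, of which the active ones have positive right derivative whenever
they vanish while all active functions have been nonnegative so far, stays nonnegative. -/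
lemma barrier {ι : Type*} [Finite ι] {p q : ℝ} {φ : ι → ℝ → ℝ} {Act : ℝ → ι → Prop}
    (hcont : ∀ i, ContinuousOn (φ i) (Icc p q))
    (hact : ∀ i s t, p ≤ s → s ≤ t → t ≤ q → Act t i → Act s i)
    (h0 : ∀ i, Act p i → 0 ≤ φ i p)
    (hstep : ∀ t ∈ Ico p q, (∀ u ∈ Icc p t, ∀ j, Act u j → 0 ≤ φ j u) → ∀ i, Act t i → φ i t = 0 →
      ∃ d > 0, HasDerivWithinAt (φ i) d (Ici t) t) :
    ∀ t ∈ Icc p q, ∀ i, Act t i → 0 ≤ φ i t := by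
  refine icc_induction h0 (fun t ht hP => ?_) (fun t ht hP i hi => ?_)
  · rw [eventually_all]
    intro i
    by_cases hi : Act t i
    · rcases (hP t ⟨ht.1, le_rfl⟩ i hi).eq_or_lt with h | h
      · obtain ⟨d, hd, hder⟩ := hstep t ht hP i hi h.symm
        filter_upwards [eventually_pos_of_hasDerivWithinAt h.symm hd hder] with s hs _ using hs.le
      · filter_upwards [(ContinuousOn.tendsto_nhdsGT (hcont i) ht).eventually (lt_mem_nhds h)]
          with s hs _ using hs.le
    · filter_upwards [eventually_nhdsGT_mem_Ioc ht.2] with s hs his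
      exact absurd (hact i t s ht.1 hs.1.le hs.2 his) hi
  · refine ge_of_tendsto (ContinuousOn.tendsto_nhdsLT (hcont i) ht) ?_
    filter_upwards [eventually_nhdsLT_mem_Ico ht.1] with s hs
    exact hP s hs i (hact i s t hs.1 hs.2.le ht.2 hi)

/-! ### Two summation lemmas -/

/-- Summation by parts: nonpositive suffix sums against a monotone weight bounded below by `r`. -/
lemma sum_mul_le_of_suffix {ι : Type*} [LinearOrder ι] {c φ : ι → ℝ} (s : Finset ι)
    (hφ : ∀ i ∈ s, ∀ j ∈ s, i ≤ j → φ i ≤ φ j) (hc : ∀ k ∈ s, ∑ j ∈ s with k ≤ j, c j ≤ 0) :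
    ∀ r, (∀ i ∈ s, r ≤ φ i) → ∑ i ∈ s, c i * φ i ≤ r * ∑ i ∈ s, c i := by
  induction s using Finset.induction_on_min with
  | empty => simp
  | insert a s ha ih =>
    intro r hr
    have has : a ∉ s := fun h => (ha a h).false
    -- The smallest index `a` is peeled off and the rest is bounded with `φ a` in place of `r`. The
    -- total sum of `c` is nonpositive, so `φ a` may then be lowered to `r`.
    have h1 := ih (fun i hi j hj => hφ i (by simp [hi]) j (by simp [hj])) (fun k hk => by
      have := hc k (by simp [hk])
      rwa [Finset.filter_insert, if_neg (not_le.2 (ha k hk))] at this) (φ a)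
      (fun i hi => hφ a (by simp) i (by simp [hi]) (ha i hi).le)
    have h2 := hc a (by simp)
    rw [Finset.filter_true_of_mem (fun j hj => ?_)] at h2
    · rw [Finset.sum_insert has] at h2 ⊢
      rw [Finset.sum_insert has]
      have h3 := hr a (by simp)
      nlinarith
    · rcases Finset.mem_insert.1 hj with rfl | h
      · exact le_rfl
      · exact (ha j h).le

lemma signType_mul_self {s : SignType} (h : s ≠ 0) : (s : ℝ) * s = 1 := by
  rcases s with _ | _ | _ <;> simp_all

lemma signType_mul_of_ne {s t : SignType} (hs : s ≠ 0) (ht : t ≠ 0) (h : s ≠ t) :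
    (s : ℝ) * t = -1 := by
  rcases s with _ | _ | _ <;> rcases t with _ | _ | _ <;> simp_all

/-- If charges of equal sign which follow each other are at distance at least `d`, then the
charges of sign `σ` that are not screened contribute as an arithmetic progression. -/
lemma sum_sub_shift_le {ι : Type*} [LinearOrder ι] [Fintype ι] {z : ι → ℝ} {b : ι → SignType}
    {φ : ℝ → ℝ} {d : ℝ} (hd : 0 < d) (hφ0 : ∀ u, 0 < u → 0 ≤ φ u) (hφ : AntitoneOn φ (Ioi 0))
    (hz : ∀ i j, i < j → b i ≠ 0 → b j ≠ 0 → z i < z j)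
    (hsep : ∀ i j, i < j → b i ≠ 0 → b i = b j → (∀ k, i < k → k < j → b k = 0) → d ≤ z j - z i)
    {σ : SignType} (hσ : σ ≠ 0) (k : ι) (hk : b k ≠ 0) (hk0 : 0 ≤ z k) (hk1 : b k = σ ∨ 0 < z k) :
    ∑ j with k < j, (σ : ℝ) * b j * (φ (z j) - φ (z j + d)) ≤
      if b k = σ then φ (z k + d) else φ (z k) := by
  induction k using WellFoundedGT.induction with
  | ind k ih =>
    have hRHS : 0 ≤ if b k = σ then φ (z k + d) else φ (z k) := by
      split_ifs with h
      · exact hφ0 _ (by linarith)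
      · exact hφ0 _ (hk1.resolve_left h)
    -- The bound is handed from the next charge `m` to `k`. If `b m = σ`, the term of `m` turns the
    -- bound `φ (z m + d)` into `φ (z m)`; otherwise it turns `φ (z m)` into `φ (z m + d)`. The
    -- separation is needed only when both `k` and `m` have sign `σ`.
    by_cases hex : (Finset.univ.filter fun j => k < j ∧ b j ≠ 0).Nonempty
    · set m := Finset.min' _ hex with hm
      have hmem := Finset.min'_mem _ hex
      rw [← hm, Finset.mem_filter] at hmem
      obtain ⟨-, hkm, hbm⟩ := hmem
      have hmin : ∀ j, k < j → j < m → b j = 0 := fun j h1 h2 => by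
        by_contra h
        exact absurd (Finset.min'_le _ j (by simp [h1, h])) (not_le.2 (hm ▸ h2))
      have hzm := hz k m hkm hk hbm
      have hzm0 : 0 < z m := lt_of_le_of_lt hk0 hzm
      have hsum : ∑ j with k < j, (σ : ℝ) * b j * (φ (z j) - φ (z j + d)) =
          (σ : ℝ) * b m * (φ (z m) - φ (z m + d)) +
            ∑ j with m < j, (σ : ℝ) * b j * (φ (z j) - φ (z j + d)) := by
        rw [← Finset.sum_insert (f := fun j => (σ : ℝ) * b j * (φ (z j) - φ (z j + d))) (a := m)
          (s := Finset.univ.filter (m < ·)) (by simp)]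
        refine (Finset.sum_subset (fun j hj => ?_) fun j hj hj' => ?_).symm
        · rcases Finset.mem_insert.1 hj with rfl | h
          · simpa using hkm
          · simpa using hkm.trans (by simpa using h)
        · rw [hmin j (by simpa using hj)]
          · simp
          · simp only [Finset.mem_insert, Finset.mem_filter, Finset.mem_univ, true_and, not_or,
              not_lt] at hj'
            exact lt_of_le_of_ne hj'.2 hj'.1
      have h1 := ih m hkm hbm hzm0.le (Or.inr hzm0)
      rw [hsum]
      by_cases hmσ : b m = σ
      · rw [if_pos hmσ] at h1
        rw [hmσ, signType_mul_self hσ]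
        have h2 : φ (z m) ≤ if b k = σ then φ (z k + d) else φ (z k) := by
          split_ifs with h
          · have := hsep k m hkm hk (h.trans hmσ.symm) hmin
            exact hφ (show 0 < z k + d by linarith) hzm0 (by linarith)
          · exact hφ (show 0 < z k from hk1.resolve_left h) hzm0 hzm.le
        linarith
      · rw [if_neg hmσ] at h1
        rw [signType_mul_of_ne hσ hbm (Ne.symm hmσ)]
        have h2 : φ (z m + d) ≤ if b k = σ then φ (z k + d) else φ (z k) := by
          split_ifs with h
          · exact hφ (show 0 < z k + d by linarith) (show 0 < z m + d by linarith) (by linarith)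
          · have := hk1.resolve_left h
            exact hφ this (show 0 < z m + d by linarith) (by linarith)
        linarith
    · rw [Finset.sum_eq_zero]
      · exact hRHS
      · intro j hj
        rw [Finset.not_nonempty_iff_eq_empty, Finset.filter_eq_empty_iff] at hex
        have := hex (Finset.mem_univ j)
        simp only [Finset.mem_filter, Finset.mem_univ, true_and] at hj
        rw [show b j = 0 by by_contra h; exact this ⟨hj, h⟩]
        simp

/-! ### Forces between separated charges -/

variable {n : ℕ}

/-- The unnormalized interaction force on particle `i`. -/
noncomputable def force (f : ℝ → ℝ) (x : Fin n → ℝ) (b : Fin n → SignType) (i : Fin n) : ℝ :=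
  ∑ j, (b i : ℝ) * b j * f (x i - x j)

lemma velocity_eq {f g : ℝ → ℝ} (hf : Repulsive f) (x : Fin n → ℝ) (b : Fin n → SignType)
    (i : Fin n) : velocity f g x b i = 1 / (n : ℝ) * force f x b i + b i * g (x i) := by
  rw [velocity, force, ← Finset.add_sum_erase _ _ (Finset.mem_univ i), sub_self, hf.map_zero]
  simp

lemma velocity_of_neutral {f g : ℝ → ℝ} {x : Fin n → ℝ} {b : Fin n → SignType}
    {i : Fin n} (h : b i = 0) : velocity f g x b i = 0 := by
  simp [velocity, h]

lemma charged_lt {x : Fin n → ℝ} {b : Fin n → SignType} (h : (x, b) ∈ stateSpace n) {i j : Fin n}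
    (hij : i < j) (hi : b i ≠ 0) (hj : b j ≠ 0) : x i < x j :=
  h i j hij (mul_ne_zero hi hj)

/-- Neighbors of equal sign are at distance at least `c`. -/
def SameSignSep (c : ℝ) (x : Fin n → ℝ) (b : Fin n → SignType) : Prop :=
  ∀ i j, AreNeighbors b i j → b i = b j → c ≤ x j - x i

/-- This sum is the change of the force from the right when particle `i` is moved to the left by
`d`. Screening bounds it independently of the number of charges. -/
lemma SameSignSep.right_sum {f : ℝ → ℝ} (hf : Repulsive f) {x : Fin n → ℝ} {b : Fin n → SignType}
    (hx : (x, b) ∈ stateSpace n) {d : ℝ} (hd : 0 < d) (h : SameSignSep d x b) {i : Fin n}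
    (hi : b i ≠ 0) :
    ∑ j with i < j, (b i : ℝ) * b j * (f (x j - x i) - f (x j - x i + d)) ≤ f d := by
  have := sum_sub_shift_le (z := fun j => x j - x i) (b := b) hd hf.nonneg hf.anti
    (fun j k hjk hj hk => by linarith [charged_lt hx hjk hj hk])
    (fun j k hjk hj hk hn => by
      have := h j k ⟨hjk, mul_ne_zero hj (hk ▸ hj), hn⟩ hk
      linarith) hi i hi (by simp) (Or.inl rfl)
  simpa using this

lemma SameSignSep.left_sum {f : ℝ → ℝ} (hf : Repulsive f) {x : Fin n → ℝ} {b : Fin n → SignType}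
    (hx : (x, b) ∈ stateSpace n) {d : ℝ} (hd : 0 < d) (h : SameSignSep d x b) {i : Fin n}
    (hi : b i ≠ 0) :
    ∑ j with j < i, (b i : ℝ) * b j * (f (x i - x j) - f (x i - x j + d)) ≤ f d := by
  have := sum_sub_shift_le (ι := (Fin n)ᵒᵈ) (z := fun j => x i - x (OrderDual.ofDual j))
    (b := fun j => b (OrderDual.ofDual j)) hd hf.nonneg hf.anti
    (fun j k hjk hj hk => by linarith [charged_lt hx (OrderDual.ofDual_lt_ofDual.2 hjk) hk hj])
    (fun j k hjk hj hk hn => by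
      have := h (OrderDual.ofDual k) (OrderDual.ofDual j) ⟨hjk, mul_ne_zero (hk ▸ hj) hj,
        fun l h1 h2 => hn (OrderDual.toDual l) h2 h1⟩ hk.symm
      linarith) hi (OrderDual.toDual i) hi (by simp) (Or.inl rfl)
  simp only [OrderDual.ofDual_toDual, sub_self, zero_add, if_true] at this
  exact this

/-- The smallest distance between neighbors of equal sign does not shrink by the interaction. -/
lemma SameSignSep.force_le {f : ℝ → ℝ} (hf : Repulsive f) {x : Fin n → ℝ} {b : Fin n → SignType}
    (hx : (x, b) ∈ stateSpace n) {d : ℝ} (h : SameSignSep d x b) {i j : Fin n}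
    (hij : AreNeighbors b i j) (hb : b i = b j) (hxd : x j - x i = d) :
    force f x b i ≤ force f x b j := by
  have hi : b i ≠ 0 := fun h0 => hij.2.1 (by simp [h0])
  have hj : b j ≠ 0 := hb ▸ hi
  have hlt := charged_lt hx hij.1 hi hj
  have hd : 0 < d := by linarith
  have h1 := h.right_sum hf hx hd hj
  have h2 := h.left_sum hf hx hd hi
  -- Since `x j = x i + d`, the force of a third charge on one of the two particles is its force on
  -- the other with the distance shifted by `d`. The pair itself contributes `2 * f d`, and the
  -- charges on each side take away at most `f d`.
  have hsplit : ∀ k, (b j : ℝ) * b k * f (x j - x k) - (b i : ℝ) * b k * f (x i - x k) =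
      (-(if j < k then (b j : ℝ) * b k * (f (x k - x j) - f (x k - x j + d)) else 0) -
        (if k < i then (b i : ℝ) * b k * (f (x i - x k) - f (x i - x k + d)) else 0)) +
        ((if k = i then f d else 0) + if k = j then f d else 0) := by
    intro k
    rcases lt_trichotomy k i with hk | rfl | hk
    · rw [if_neg (not_lt.2 (hk.trans hij.1).le), if_pos hk, if_neg hk.ne,
        if_neg (hk.trans hij.1).ne, show x j - x k = x i - x k + d by linarith, hb]
      ring
    · rw [if_neg (not_lt.2 hij.1.le), if_neg (lt_irrefl _), if_pos rfl, if_neg hij.1.ne, hxd,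
        sub_self, hf.map_zero, ← hb, signType_mul_self hi]
      ring
    · rcases lt_trichotomy k j with hk' | rfl | hk'
      · rw [hij.2.2 k hk hk', if_neg (not_lt.2 hk'.le), if_neg (not_lt.2 hk.le), if_neg hk.ne',
          if_neg hk'.ne]
        simp
      · rw [if_neg (lt_irrefl _), if_neg (not_lt.2 hk.le), if_neg hk.ne', if_pos rfl, sub_self,
          hf.map_zero, hf.map_sub_comm (x i), hxd, hb, signType_mul_self hj]
        ring
      · rw [if_pos hk', if_neg (not_lt.2 hk.le), if_neg hk.ne', if_neg hk'.ne',
          hf.map_sub_comm (x i), hf.map_sub_comm (x j), show x k - x i = x k - x j + d by linarith,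
          hb]
        ring
  have key : force f x b j - force f x b i = ∑ k, ((b j : ℝ) * b k * f (x j - x k) -
      (b i : ℝ) * b k * f (x i - x k)) := by
    rw [Finset.sum_sub_distrib]; rfl
  simp only [hsplit, Finset.sum_add_distrib, Finset.sum_sub_distrib, Finset.sum_neg_distrib,
    Finset.sum_ite_eq', Finset.mem_univ, if_true] at key
  rw [Finset.sum_filter] at h1 h2
  linarith

/-- Replacing `f u` by `f u - f (u + c)` costs at most `f c` per particle, and the differences obey
the screening bound. This is the force bound behind the a priori estimate of the positions. -/
lemma SameSignSep.force_rightmost_le {f : ℝ → ℝ} (hf : Repulsive f) {x : Fin n → ℝ}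
    {b : Fin n → SignType} (hx : (x, b) ∈ stateSpace n) {c : ℝ} (hc : 0 < c)
    (h : SameSignSep c x b) {i : Fin n} (hi : ∀ j, i < j → b j = 0) :
    force f x b i ≤ (n + 1) * f c := by
  have hfc := hf.nonneg c hc
  by_cases hi0 : b i = 0
  · simp only [force, hi0]; simp; positivity
  have h2 := h.left_sum hf hx hc hi0
  have key : ∀ j, (b i : ℝ) * b j * f (x i - x j) ≤
      (if j < i then (b i : ℝ) * b j * (f (x i - x j) - f (x i - x j + c)) else 0) + f c := by
    intro j
    rcases lt_trichotomy j i with hj | rfl | hj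
    · rw [if_pos hj]
      by_cases hj0 : b j = 0
      · simp [hj0, hfc]
      have hlt := charged_lt hx hj hj0 hi0
      have h3 := hf.nonneg (x i - x j + c) (by linarith)
      have h4 := hf.le_of_le hc (by linarith : c ≤ x i - x j + c)
      by_cases he : b i = b j
      · rw [← he, signType_mul_self hi0]; linarith
      · rw [signType_mul_of_ne hi0 hj0 he]; linarith
    · simp [hf.map_zero, hfc]
    · simp [hi j hj, not_lt.2 hj.le, hfc]
  calc force f x b i ≤ ∑ j, ((if j < i then (b i : ℝ) * b j *
          (f (x i - x j) - f (x i - x j + c)) else 0) + f c) := Finset.sum_le_sum fun j _ => key j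
    _ = (∑ j with j < i, (b i : ℝ) * b j * (f (x i - x j) - f (x i - x j + c))) + n * f c := by
        rw [Finset.sum_add_distrib, Finset.sum_filter]; simp
    _ ≤ (n + 1) * f c := by linarith

lemma SameSignSep.le_force_leftmost {f : ℝ → ℝ} (hf : Repulsive f) {x : Fin n → ℝ}
    {b : Fin n → SignType} (hx : (x, b) ∈ stateSpace n) {c : ℝ} (hc : 0 < c)
    (h : SameSignSep c x b) {i : Fin n} (hi : ∀ j, j < i → b j = 0) :
    -((n + 1) * f c) ≤ force f x b i := by
  have hfc := hf.nonneg c hc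
  by_cases hi0 : b i = 0
  · simp only [force, hi0]; simp; positivity
  have h2 := h.right_sum hf hx hc hi0
  have key : ∀ j, -((b i : ℝ) * b j * f (x i - x j)) ≤
      (if i < j then (b i : ℝ) * b j * (f (x j - x i) - f (x j - x i + c)) else 0) + f c := by
    intro j
    rcases lt_trichotomy i j with hj | rfl | hj
    · rw [if_pos hj, hf.map_sub_comm]
      by_cases hj0 : b j = 0
      · simp [hj0, hfc]
      have hlt := charged_lt hx hj hi0 hj0
      have h3 := hf.nonneg (x j - x i + c) (by linarith)
      have h4 := hf.le_of_le hc (by linarith : c ≤ x j - x i + c)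
      by_cases he : b i = b j
      · rw [← he, signType_mul_self hi0]; linarith
      · rw [signType_mul_of_ne hi0 hj0 he]; linarith
    · simp [hf.map_zero, hfc]
    · simp [hi j hj, not_lt.2 hj.le, hfc]
  have : -force f x b i ≤ (n + 1) * f c := by
    calc -force f x b i = ∑ j, -((b i : ℝ) * b j * f (x i - x j)) := by
          rw [Finset.sum_neg_distrib]; rfl
      _ ≤ ∑ j, ((if i < j then (b i : ℝ) * b j *
          (f (x j - x i) - f (x j - x i + c)) else 0) + f c) := Finset.sum_le_sum fun j _ => key j
      _ = (∑ j with i < j, (b i : ℝ) * b j * (f (x j - x i) - f (x j - x i + c))) + n * f c := by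
        rw [Finset.sum_add_distrib, Finset.sum_filter]; simp
      _ ≤ (n + 1) * f c := by linarith
  linarith

/-! ### Solutions with one-sided derivatives -/

lemma hasLeftLimit_iff {b : ℝ → Fin n → SignType} {t : ℝ} {β : Fin n → SignType} :
    HasLeftLimit b t β ↔ ∀ᶠ s in 𝓝[<] t, b s = β := by
  rw [HasLeftLimit, nhds_discrete, tendsto_pure]

lemma HasLeftLimit.unique {b : ℝ → Fin n → SignType} {t : ℝ} {β β' : Fin n → SignType}
    (h : HasLeftLimit b t β) (h' : HasLeftLimit b t β') : β = β' :=
  tendsto_nhds_unique h h'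

lemma Repulsive.continuousAt {f : ℝ → ℝ} (hf : Repulsive f) {u : ℝ} (hu : u ≠ 0) :
    ContinuousAt f u := by
  have hpos : ∀ v, 0 < v → ContinuousAt f v := fun v hv =>
    (hf.convex.continuousOn isOpen_Ioi).continuousAt (Ioi_mem_nhds hv)
  rcases hu.lt_or_gt with h | h
  · have h1 : f = fun v => -f (-v) := funext fun v => by rw [hf.odd, neg_neg]
    rw [h1]
    exact (ContinuousAt.comp (f := fun v : ℝ => -v) (g := f) (hpos (-u) (by linarith))
      continuousAt_neg).neg
  · exact hpos u h

lemma continuousAt_velocity {f g : ℝ → ℝ} (hf : Repulsive f) (hg : Continuous g)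
    {x : Fin n → ℝ} {b : Fin n → SignType} (hx : ∀ i j, i ≠ j → b i ≠ 0 → b j ≠ 0 → x i ≠ x j) :
    ContinuousAt (fun y => velocity f g y b) x := by
  rw [continuousAt_pi]
  intro i
  unfold velocity
  refine ContinuousAt.add (continuousAt_const.mul (tendsto_finsetSum _ fun j hj => ?_))
    (continuousAt_const.mul (hg.continuousAt.comp (continuousAt_apply i x)))
  have hji : j ≠ i := Finset.ne_of_mem_erase hj
  by_cases hb : b i ≠ 0 ∧ b j ≠ 0
  · have : ContinuousAt (fun y : Fin n → ℝ => f (y i - y j)) x :=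
      ContinuousAt.comp (f := fun y : Fin n → ℝ => y i - y j) (g := f)
        (hf.continuousAt (sub_ne_zero.2 (hx i j hji.symm hb.1 hb.2)))
        ((continuousAt_apply i x).sub (continuousAt_apply j x))
    exact (continuousAt_const.mul this)
  · have : ((b i : ℝ) * (b j : ℝ)) = 0 := by
      by_cases h : b i = 0
      · simp [h]
      · have : b j = 0 := by by_contra h'; exact hb ⟨h, h'⟩
        simp [this]
    simp only [this, zero_mul]
    exact tendsto_const_nhds

lemma stateSpace_ne {x : Fin n → ℝ} {b : Fin n → SignType} (h : (x, b) ∈ stateSpace n) :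
    ∀ i j, i ≠ j → b i ≠ 0 → b j ≠ 0 → x i ≠ x j := fun i j hij hi hj => by
  rcases hij.lt_or_gt with h' | h'
  · exact (charged_lt h h' hi hj).ne
  · exact (charged_lt h h' hj hi).ne'

/-- The evolution on `[p, q]`, with the equation in terms of right derivatives. -/
structure Sol (f g : ℝ → ℝ) (p q : ℝ) (x : ℝ → Fin n → ℝ) (b : ℝ → Fin n → SignType) : Prop where
  cont : ContinuousOn x (Icc p q)
  mem : ∀ t ∈ Icc p q, (x t, b t) ∈ stateSpace n
  right : ∀ t ∈ Ico p q, ∀ᶠ s in 𝓝[>] t, b s = b t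
  left : ∀ t ∈ Ioc p q, ∃ β, HasLeftLimit b t β ∧ (∀ i, b t i = β i ∨ b t i = 0) ∧
    ∀ y, ∑ i with x t i = y, (b t i : ℤ) = ∑ i with x t i = y, (β i : ℤ)
  deriv : ∀ t ∈ Ico p q, HasDerivWithinAt x (velocity f g (x t) (b t)) (Ici t) t

/-- A time at which some charge changes. -/
def IsJumpTime (b : ℝ → Fin n → SignType) (t : ℝ) : Prop := ¬ HasLeftLimit b t (b t)

namespace Sol

variable {f g : ℝ → ℝ} {p q : ℝ} {x : ℝ → Fin n → ℝ} {b : ℝ → Fin n → SignType}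

lemma mono (h : Sol f g p q x b) {p' q' : ℝ} (hp : p ≤ p') (hq : q' ≤ q) : Sol f g p' q' x b where
  cont := h.cont.mono (Icc_subset_Icc hp hq)
  mem t ht := h.mem t ⟨hp.trans ht.1, ht.2.trans hq⟩
  right t ht := h.right t ⟨hp.trans ht.1, ht.2.trans_le hq⟩
  left t ht := h.left t ⟨hp.trans_lt ht.1, ht.2.trans hq⟩
  deriv t ht := h.deriv t ⟨hp.trans ht.1, ht.2.trans_le hq⟩

lemma cont_apply (h : Sol f g p q x b) (i : Fin n) : ContinuousOn (fun t => x t i) (Icc p q) :=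
  fun t ht => continuousWithinAt_pi.1 (h.cont t ht) i

lemma deriv_apply (h : Sol f g p q x b) {t : ℝ} (ht : t ∈ Ico p q) (i : Fin n) :
    HasDerivWithinAt (fun s => x s i) (velocity f g (x t) (b t) i) (Ici t) t :=
  hasDerivWithinAt_pi.1 (h.deriv t ht) i

lemma charge_eq (h : Sol f g p q x b) {s t : ℝ} (hs : p ≤ s) (hst : s ≤ t) (ht : t ≤ q)
    (i : Fin n) : b t i = b s i ∨ b t i = 0 := by
  refine icc_induction (p := s) (q := q) (P := fun t => b t i = b s i ∨ b t i = 0) (Or.inl rfl)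
    (fun t ht hP => ?_) (fun t ht hP => ?_) t ⟨hst, ht⟩
  · filter_upwards [h.right t ⟨hs.trans ht.1, ht.2⟩] with u hu
    rw [hu]; exact hP t ⟨ht.1, le_rfl⟩
  · obtain ⟨β, hβ, hb, -⟩ := h.left t ⟨hs.trans_lt ht.1, ht.2⟩
    obtain ⟨u, hu, hut⟩ := ((hasLeftLimit_iff.1 hβ).and (eventually_nhdsLT_mem_Ico ht.1)).exists
    have := hP u hut
    rw [hu] at this
    rcases hb i with h' | h'
    · rw [h']; exact this
    · exact Or.inr h'

lemma charge_zero (h : Sol f g p q x b) {s t : ℝ} (hs : p ≤ s) (hst : s ≤ t) (ht : t ≤ q)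
    {i : Fin n} (hi : b s i = 0) : b t i = 0 := by
  rcases h.charge_eq hs hst ht i with h' | h'
  · rw [h', hi]
  · exact h'

lemma charge_of_ne (h : Sol f g p q x b) {s t : ℝ} (hs : p ≤ s) (hst : s ≤ t) (ht : t ≤ q)
    {i : Fin n} (hi : b t i ≠ 0) : b s i = b t i :=
  ((h.charge_eq hs hst ht i).resolve_right hi).symm

lemma charged_before (h : Sol f g p q x b) {s t : ℝ} (hs : p ≤ s) (hst : s ≤ t) (ht : t ≤ q)
    {i : Fin n} (hi : b t i ≠ 0) : b s i ≠ 0 := h.charge_of_ne hs hst ht hi ▸ hi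

lemma left_of_ne (h : Sol f g p q x b) {s t : ℝ} (hs : p ≤ s) (hst : s < t) (ht : t ≤ q)
    {β : Fin n → SignType} (hβ : HasLeftLimit b t β) :
    (∀ i, β i = b s i ∨ β i = 0) ∧ (∀ i, b t i = β i ∨ b t i = 0) ∧
    ∀ y, ∑ i with x t i = y, (b t i : ℤ) = ∑ i with x t i = y, (β i : ℤ) := by
  obtain ⟨β', hβ', h1, h2⟩ := h.left t ⟨hs.trans_lt hst, ht⟩
  obtain rfl := hβ.unique hβ'
  obtain ⟨u, hu, hut⟩ := ((hasLeftLimit_iff.1 hβ).and (eventually_nhdsLT_mem_Ico hst)).exists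
  exact ⟨fun i => hu ▸ h.charge_eq hs hut.1 (hut.2.le.trans ht) i, h1, h2⟩

/-- Left limits of states are ordered, though not strictly. -/
lemma left_le (h : Sol f g p q x b) {t : ℝ} (ht : t ∈ Ioc p q) {β : Fin n → SignType}
    (hβ : HasLeftLimit b t β) {i j : Fin n} (hij : i < j) (hi : β i ≠ 0) (hj : β j ≠ 0) :
    x t i ≤ x t j := by
  refine le_of_tendsto_of_tendsto (ContinuousOn.tendsto_nhdsLT (h.cont_apply i) ht)
    (ContinuousOn.tendsto_nhdsLT (h.cont_apply j) ht) ?_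
  filter_upwards [hasLeftLimit_iff.1 hβ, eventually_nhdsLT_mem_Ico ht.1] with s hs hst
  exact (charged_lt (h.mem s ⟨hst.1, hst.2.le.trans ht.2⟩) hij (hs ▸ hi) (hs ▸ hj)).le

/-- A charge which changes meets another charge. -/
lemma exists_collision (h : Sol f g p q x b) {t : ℝ} (ht : t ∈ Ioc p q) {β : Fin n → SignType}
    (hβ : HasLeftLimit b t β) {i : Fin n} (hi : b t i ≠ β i) :
    ∃ j, j ≠ i ∧ β i ≠ 0 ∧ β j ≠ 0 ∧ x t j = x t i := by
  obtain ⟨-, h1, h2⟩ := h.left_of_ne le_rfl ht.1 ht.2 hβ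
  have hbi : b t i = 0 := (h1 i).resolve_left hi
  have hβi : β i ≠ 0 := fun h' => hi (by rw [hbi, h'])
  by_contra! hcon
  have h3 := h2 (x t i)
  have hz : ∀ j, j ≠ i → x t j = x t i → β j = 0 := fun j hji hx => by
    by_contra hj; exact hcon j hji hβi hj hx
  rw [Finset.sum_eq_zero, Finset.sum_eq_single i] at h3
  · apply hβi
    revert h3
    rcases β i with _ | _ | _ <;> simp
  · intro j hj hji
    simp [hz j hji (by simpa using hj)]
  · simp
  · intro j hj
    by_cases hji : j = i
    · simp [hji, hbi]
    · rcases h1 j with h' | h'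
      · simp [h', hz j hji (by simpa using hj)]
      · simp [h']

lemma isJumpTime_of_collision (h : Sol f g p q x b) {t : ℝ} (ht : t ∈ Ioc p q)
    {β : Fin n → SignType} (hβ : HasLeftLimit b t β) {i j : Fin n} (hij : i ≠ j)
    (hi : β i ≠ 0) (hj : β j ≠ 0) (hx : x t i = x t j) : IsJumpTime b t := fun h' => by
  obtain rfl := hβ.unique h'
  exact stateSpace_ne (h.mem t ⟨ht.1.le, ht.2⟩) i j hij hi hj hx

/-- Without jump times the charges are constant. -/
lemma charge_const (h : Sol f g p q x b) {s t : ℝ} (hs : p ≤ s) (hst : s ≤ t) (ht : t ≤ q)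
    (hj : ∀ u ∈ Ioc s t, ¬ IsJumpTime b u) : b t = b s := by
  refine icc_induction (p := s) (q := t) (P := fun t => b t = b s) rfl
    (fun u hu hP => ?_) (fun u hu hP => ?_) t ⟨hst, le_rfl⟩
  · filter_upwards [h.right u ⟨hs.trans hu.1, hu.2.trans_le ht⟩] with v hv
    rw [hv]; exact hP u ⟨hu.1, le_rfl⟩
  · have hl := not_not.1 (hj u hu)
    obtain ⟨v, hv, hvu⟩ := ((hasLeftLimit_iff.1 hl).and (eventually_nhdsLT_mem_Ico hu.1)).exists
    rw [← hv]; exact hP v hvu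

/-- The number of charged particles. -/
def chargeCount (β : Fin n → SignType) : ℕ := (Finset.univ.filter fun i => β i ≠ 0).card

lemma chargeCount_lt {β β' : Fin n → SignType} (h1 : ∀ i, β' i = β i ∨ β' i = 0) (h2 : β' ≠ β) :
    chargeCount β' < chargeCount β := by
  obtain ⟨i, hi⟩ := Function.ne_iff.1 h2
  have hi0 := (h1 i).resolve_left hi
  refine Finset.card_lt_card ⟨fun j hj => ?_, fun h => ?_⟩
  · simp only [Finset.mem_filter, Finset.mem_univ, true_and] at hj ⊢
    exact ((h1 j).resolve_right hj) ▸ hj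
  · have := h (show i ∈ _ by simpa using fun h' => hi (by rw [hi0, h']))
    simp [hi0] at this

/-- The number of charges drops strictly from one jump time to the next, so it is injective on the
set of jump times; its values are at most `n`. -/
lemma finite_jumpTimes (h : Sol f g p q x b) : {t | t ∈ Ioc p q ∧ IsJumpTime b t}.Finite := by
  refine Set.Finite.of_finite_image (f := fun t => chargeCount (b t))
    ((Set.finite_Iic (n : ℕ)).subset ?_) ?_
  · rintro _ ⟨t, -, rfl⟩
    exact (Finset.card_le_univ _).trans (by simp)
  · have key : ∀ s t, s ∈ Ioc p q → t ∈ Ioc p q → IsJumpTime b t → s < t →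
        chargeCount (b t) < chargeCount (b s) := by
      intro s t hs ht hj hst
      refine chargeCount_lt (fun i => h.charge_eq hs.1.le hst.le ht.2 i) fun heq => hj ?_
      rw [hasLeftLimit_iff]
      filter_upwards [eventually_nhdsLT_mem_Ico hst] with u hu
      funext i
      rcases h.charge_eq hs.1.le hu.1 (hu.2.le.trans ht.2) i with h1 | h1
      · rw [h1, heq]
      · rw [h1, h.charge_zero (hs.1.le.trans hu.1) hu.2.le ht.2 h1]
    intro s hs t ht heq
    simp only at heq
    rcases lt_trichotomy s t with h' | h' | h'
    · exact absurd heq (key s t hs.1 ht.1 ht.2 h').ne'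
    · exact h'
    · exact absurd heq (key t s ht.1 hs.1 hs.2 h').ne

/-- Near the left of `t` the charges equal the left limit on a whole interval. -/
lemma exists_left (h : Sol f g p q x b) {t : ℝ} (ht : t ∈ Ioc p q) :
    ∃ β, HasLeftLimit b t β ∧ ∃ l, p ≤ l ∧ l < t ∧ ∀ s ∈ Ico l t, b s = β := by
  obtain ⟨β, hβ, -⟩ := h.left t ht
  obtain ⟨l, hl, hs⟩ := mem_nhdsLT_iff_exists_Ico_subset.1 (hasLeftLimit_iff.1 hβ)
  exact ⟨β, hβ, max p l, le_max_left _ _, max_lt ht.1 hl, fun s hs' =>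
    hs ⟨(le_max_right _ _).trans hs'.1, hs'.2⟩⟩

lemma exists_right (h : Sol f g p q x b) {t : ℝ} (ht : t ∈ Ico p q) :
    ∃ r, t < r ∧ r ≤ q ∧ ∀ s ∈ Icc t r, b s = b t := by
  obtain ⟨r, hr, hs⟩ := mem_nhdsGT_iff_exists_Ioc_subset.1 (h.right t ht)
  refine ⟨min r q, lt_min hr ht.2, min_le_right _ _, fun s hs' => ?_⟩
  rcases hs'.1.eq_or_lt with rfl | h'
  · rfl
  · exact hs ⟨h', hs'.2.trans (min_le_left _ _)⟩

/-- Concatenation of solutions. -/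
lemma glue {r : ℝ} {x' : ℝ → Fin n → ℝ} {b' : ℝ → Fin n → SignType}
    (hpq : p ≤ q) (hqr : q ≤ r) (h : Sol f g p q x b) (h' : Sol f g q r x' b')
    (hx : x' q = x q) (hb : b' q = b q) :
    Sol f g p r (fun t => if t < q then x t else x' t) (fun t => if t < q then b t else b' t) := by
  have eL : ∀ {α : Type} (u v : ℝ → α) t, t < q →
      (fun s => if s < q then u s else v s) =ᶠ[𝓝 t] u := fun u v t ht => by
    filter_upwards [Iio_mem_nhds ht] with s hs
    rw [if_pos (mem_Iio.1 hs)]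
  have eR : ∀ {α : Type} (u v : ℝ → α) t, q ≤ t →
      (fun s => if s < q then u s else v s) =ᶠ[𝓝[≥] t] v := fun u v t ht => by
    filter_upwards [self_mem_nhdsWithin] with s hs
    rw [if_neg (not_lt.2 (ht.trans hs))]
  have eLL : ∀ {α : Type} (u v : ℝ → α) t, t ≤ q →
      (fun s => if s < q then u s else v s) =ᶠ[𝓝[<] t] u := fun u v t ht => by
    filter_upwards [self_mem_nhdsWithin] with s hs
    rw [if_pos (lt_of_lt_of_le hs ht)]
  have eRL : ∀ {α : Type} (u v : ℝ → α) t, q < t →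
      (fun s => if s < q then u s else v s) =ᶠ[𝓝[<] t] v := fun u v t ht => by
    filter_upwards [eventually_nhdsLT_mem_Ico ht] with s hs
    rw [if_neg (not_lt.2 hs.1)]
  refine ⟨?_, fun t ht => ?_, fun t ht => ?_, fun t ht => ?_, fun t ht => ?_⟩
  · have hL : ContinuousOn (fun t => if t < q then x t else x' t) (Icc p q) := by
      refine h.cont.congr fun t ht => ?_
      split_ifs with h1
      · rfl
      · rw [le_antisymm ht.2 (not_lt.1 h1), hx]
    have hR : ContinuousOn (fun t => if t < q then x t else x' t) (Icc q r) :=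
      h'.cont.congr fun t ht => by rw [if_neg (not_lt.2 ht.1)]
    have := hL.union_of_isClosed hR isClosed_Icc isClosed_Icc
    rwa [Icc_union_Icc_eq_Icc hpq hqr] at this
  · split_ifs with h1
    · exact h.mem t ⟨ht.1, h1.le⟩
    · exact h'.mem t ⟨not_lt.1 h1, ht.2⟩
  · rcases lt_or_ge t q with h1 | h1
    · rw [if_pos h1]
      filter_upwards [h.right t ⟨ht.1, h1⟩, (eL b b' t h1).filter_mono nhdsWithin_le_nhds]
        with s hs hs'
      rw [hs', hs]
    · rw [if_neg (not_lt.2 h1)]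
      filter_upwards [h'.right t ⟨h1, ht.2⟩, (eR b b' t h1).filter_mono
        (nhdsWithin_mono _ Ioi_subset_Ici_self)] with s hs hs'
      rw [hs', hs]
  · simp only [hasLeftLimit_iff]
    rcases lt_or_ge q t with h1 | h1
    · obtain ⟨β, hβ, h2⟩ := h'.left t ⟨h1, ht.2⟩
      refine ⟨β, ?_, ?_⟩
      · filter_upwards [hasLeftLimit_iff.1 hβ, eRL b b' t h1] with s hs hs'
        rw [hs', hs]
      · simpa only [if_neg (not_lt.2 h1.le)] using h2
    · obtain ⟨β, hβ, h2⟩ := h.left t ⟨ht.1, h1⟩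
      refine ⟨β, ?_, ?_⟩
      · filter_upwards [hasLeftLimit_iff.1 hβ, eLL b b' t h1] with s hs hs'
        rw [hs', hs]
      · have e1 : (if t < q then x t else x' t) = x t := by
          split_ifs with h3
          · rfl
          · rw [le_antisymm h1 (not_lt.1 h3), hx]
        have e2 : (if t < q then b t else b' t) = b t := by
          split_ifs with h3
          · rfl
          · rw [le_antisymm h1 (not_lt.1 h3), hb]
        rw [e1, e2]; exact h2
  · rcases lt_or_ge t q with h1 | h1
    · rw [if_pos h1, if_pos h1]
      exact (h.deriv t ⟨ht.1, h1⟩).congr_of_eventuallyEq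
        ((eL x x' t h1).filter_mono nhdsWithin_le_nhds) (if_pos h1)
    · rw [if_neg (not_lt.2 h1), if_neg (not_lt.2 h1)]
      exact (h'.deriv t ⟨h1, ht.2⟩).congr_of_eventuallyEq (eR x x' t h1) (if_neg (not_lt.2 h1))

/-- Relabeling by a permutation which preserves the order of the charged particles. -/
lemma perm (h : Sol f g p q x b) (hpq : p ≤ q) (μ : Equiv.Perm (Fin n))
    (hμ : ∀ i j, i < j → b p (μ i) ≠ 0 → b p (μ j) ≠ 0 → x p (μ i) < x p (μ j)) :
    Sol f g p q (fun t i => x t (μ i)) (fun t i => b t (μ i)) where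
  cont := continuousOn_pi.2 fun i => h.cont_apply (μ i)
  mem t ht i j hij hb := by
    simp only at hb ⊢
    have hi : b t (μ i) ≠ 0 := left_ne_zero_of_mul hb
    have hj : b t (μ j) ≠ 0 := right_ne_zero_of_mul hb
    have hi' := h.charged_before le_rfl ht.1 ht.2 hi
    have hj' := h.charged_before le_rfl ht.1 ht.2 hj
    have hlt : μ i < μ j := by
      by_contra hcon
      have hlt := lt_of_le_of_ne (not_lt.1 hcon) fun h' => hij.ne (μ.injective h').symm
      have := charged_lt (h.mem p ⟨le_rfl, hpq⟩) hlt hj' hi'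
      exact (this.trans (hμ i j hij hi' hj')).false
    exact charged_lt (h.mem t ht) hlt hi hj
  right t ht := by
    filter_upwards [h.right t ht] with s hs
    rw [hs]
  left t ht := by
    obtain ⟨β, hβ, h1, h2⟩ := h.left t ht
    refine ⟨fun i => β (μ i), ?_, fun i => h1 (μ i), fun y => ?_⟩
    · rw [hasLeftLimit_iff] at hβ ⊢
      filter_upwards [hβ] with s hs
      rw [hs]
    · have e : ∀ c : Fin n → SignType, ∑ i with x t (μ i) = y, (c (μ i) : ℤ) =
          ∑ i with x t i = y, (c i : ℤ) := fun c => by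
        rw [Finset.sum_filter, Finset.sum_filter]
        exact Equiv.sum_comp μ fun i => if x t i = y then (c i : ℤ) else 0
      rw [e (b t), e β, h2 y]
  deriv t ht := by
    rw [hasDerivWithinAt_pi]
    intro i
    have := h.deriv_apply ht (μ i)
    have hv : velocity f g (fun i => x t (μ i)) (fun i => b t (μ i)) i =
        velocity f g (x t) (b t) (μ i) := by
      unfold velocity
      congr 2
      refine Finset.sum_bij (fun j _ => μ j) (fun j hj => ?_) (fun j _ k _ h' => μ.injective h')
        (fun j hj => ⟨μ.symm j, ?_, by simp⟩) (fun j _ => rfl)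
      · simpa using hj
      · simp only [Finset.mem_erase, Finset.mem_univ, and_true] at hj ⊢
        intro h'; exact hj (by simp [← h'])
    rw [hv]; exact this

/-- Away from jump times the equation holds in the usual sense. -/
lemma hasDerivAt (h : Sol f g p q x b) (hf : Repulsive f) (hg : Continuous g) {t : ℝ}
    (ht : t ∈ Ioo p q) (hj : ¬ IsJumpTime b t) :
    HasDerivAt x (velocity f g (x t) (b t)) t ∧ ∀ᶠ s in 𝓝 t, b s = b t := by
  obtain ⟨r, hr, hrq, hbr⟩ := h.exists_right ⟨ht.1.le, ht.2⟩
  obtain ⟨β, hβ, l, hpl, hl, hbl⟩ := h.exists_left ⟨ht.1, ht.2.le⟩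
  obtain rfl := (not_not.1 hj).unique hβ
  have hb : ∀ s ∈ Icc l r, b s = b t := fun s hs => by
    rcases lt_or_ge s t with h' | h'
    · exact hbl s ⟨hs.1, h'⟩
    · exact hbr s ⟨h', hs.2⟩
  set w : ℝ → Fin n → ℝ := fun s => velocity f g (x s) (b t) with hw
  have hwc : ContinuousOn w (Icc l r) := fun s hs => by
    have hs' : s ∈ Icc p q := ⟨hpl.trans hs.1, hs.2.trans hrq⟩
    exact (continuousAt_velocity hf hg (stateSpace_ne (hb s hs ▸ h.mem s hs'))).comp_continuousWithinAt
      (h.cont.mono (Icc_subset_Icc hpl hrq) s hs)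
  have hlr : l < r := hl.trans hr
  -- A continuous function with a continuous right derivative is the integral of that derivative,
  -- hence differentiable from both sides.
  have hint : ∀ s ∈ Icc l r, ∫ u in l..s, w u = x s - x l := fun s hs => by
    refine intervalIntegral.integral_eq_sub_of_hasDeriv_right_of_le hs.1
      (h.cont.mono (Icc_subset_Icc hpl (hs.2.trans hrq))) (fun u hu => ?_)
      ((hwc.mono (by rw [uIcc_of_le hs.1]; exact Icc_subset_Icc_right hs.2)).intervalIntegrable)
    have := h.deriv u ⟨hpl.trans hu.1.le, hu.2.trans_le (hs.2.trans hrq)⟩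
    rw [hb u ⟨hu.1.le, hu.2.le.trans hs.2⟩] at this
    exact hasDerivWithinAt_Ioi_iff_Ici.2 this
  have hnhds : Icc l r ∈ 𝓝 t := Icc_mem_nhds hl hr
  constructor
  · have h1 : HasDerivAt (fun s => x l + ∫ u in l..s, w u) (w t) t := by
      refine (intervalIntegral.integral_hasDerivAt_right ?_ ?_ (hwc.continuousAt hnhds)).const_add _
      · exact (hwc.mono (by rw [uIcc_of_le hl.le]; exact Icc_subset_Icc_right hr.le)).intervalIntegrable
      · exact (hwc.mono Ioo_subset_Icc_self).stronglyMeasurableAtFilter isOpen_Ioo t ⟨hl, hr⟩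
    refine h1.congr_of_eventuallyEq ?_
    filter_upwards [hnhds] with s hs
    rw [hint s hs]; abel
  · filter_upwards [hnhds] with s hs using hb s hs

end Sol

/-! ### Comparison of the two notions of solutions -/

variable {T : ℝ} {f g : ℝ → ℝ} {x₀ : Fin n → ℝ} {b₀ : Fin n → SignType} {x : ℝ → Fin n → ℝ}
  {b : ℝ → Fin n → SignType}

/-- Also at `0` and at the exceptional times the right derivative exists: the charges are constant
just afterwards, so the velocities converge as the time is approached from the right. -/
lemma IsSolution.sol (hf : Repulsive f) (hg : Continuous g) (h : IsSolution T f g x₀ b₀ x b) :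
    Sol f g 0 T x b := by
  obtain ⟨hmem, S, hS, -, hcont, -, hright, -, -, -, hjump, hnet, hode⟩ := h
  have hright' : ∀ t ∈ Ico 0 T, ∀ᶠ s in 𝓝[>] t, b s = b t := fun t ht => by
    have : ContinuousWithinAt b (Ici t) t := continuousWithinAt_pi.2 fun i => hright i t ht
    rw [ContinuousWithinAt, nhds_discrete, tendsto_pure] at this
    exact this.filter_mono (nhdsWithin_mono _ Ioi_subset_Ici_self)
  refine ⟨hcont, hmem, hright', fun t ht => ?_, fun t ht => ?_⟩
  · obtain ⟨β, hβ, hsum⟩ := hnet t ht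
    refine ⟨β, hβ, fun i => ?_, hsum⟩
    by_cases hj : JumpsAt T b i t
    · exact Or.inr (hjump i t hj).2.2
    · left
      have hc : ContinuousWithinAt (fun s => b s i) (Icc 0 T) t := by
        by_contra hc; exact hj ⟨⟨ht.1.le, ht.2⟩, hc⟩
      have h1 : Tendsto (fun s => b s i) (𝓝[<] t) (𝓝 (b t i)) :=
        hc.tendsto.mono_left <| nhdsWithin_le_of_mem <|
          mem_of_superset (Ico_mem_nhdsLT ht.1) fun _ hs => ⟨hs.1, hs.2.le.trans ht.2⟩
      exact tendsto_nhds_unique h1 (tendsto_pi_nhds.1 hβ i)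
  · obtain ⟨r, hr, hbr⟩ := mem_nhdsGT_iff_exists_Ioc_subset.1 (hright' t ht)
    have hS' : ∀ᶠ s in 𝓝[>] t, s ∉ S := by
      have : (S \ {t})ᶜ ∈ 𝓝 t := (hS.subset sdiff_subset).isClosed.isOpen_compl.mem_nhds (by simp)
      filter_upwards [nhdsWithin_le_nhds this, self_mem_nhdsWithin] with s hs hst hsS
      exact hs ⟨hsS, (mem_Ioi.1 hst).ne'⟩
    obtain ⟨r', hr', hSr'⟩ := mem_nhdsGT_iff_exists_Ioc_subset.1 hS'
    have hr : t < r := hr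
    have hr' : t < r' := hr'
    set m := min (min r r') T
    have htm : t < m := lt_min (lt_min hr hr') ht.2
    have hder : ∀ s ∈ Ioo t m, HasDerivAt x (velocity f g (x s) (b t)) s := fun s hs => by
      have h1 : s ≤ r := hs.2.le.trans ((min_le_left _ _).trans (min_le_left _ _))
      have h2 : s ≤ r' := hs.2.le.trans ((min_le_left _ _).trans (min_le_right _ _))
      have h3 : s < T := hs.2.trans_le (min_le_right _ _)
      have hbs : b s = b t := hbr ⟨hs.1, h1⟩
      rw [← hbs, hasDerivAt_pi]
      exact hode s ⟨⟨ht.1.trans_lt hs.1, h3⟩, hSr' ⟨hs.1, h2⟩⟩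
    have hxt : Tendsto x (𝓝[>] t) (𝓝 (x t)) := ContinuousOn.tendsto_nhdsGT hcont ht
    refine hasDerivWithinAt_Ici_of_tendsto_deriv (s := Ioo t m)
      (fun s hs => (hder s hs).differentiableAt.differentiableWithinAt)
      (hxt.mono_left (nhdsWithin_mono _ Ioo_subset_Ioi_self)) (Ioo_mem_nhdsGT htm) ?_
    have h4 := (continuousAt_velocity hf hg
      (stateSpace_ne (hmem t ⟨ht.1, ht.2.le⟩))).tendsto.comp hxt
    refine h4.congr' ?_
    filter_upwards [Ioo_mem_nhdsGT htm] with s hs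
    exact (hder s hs).deriv.symm

/-- The jump times serve as the exceptional set; elsewhere the charges are locally constant and the
right derivative is a derivative. -/
lemma Sol.isSolution (hT : 0 < T) (hf : Repulsive f) (hg : Continuous g) (h : Sol f g 0 T x b) :
    IsSolution T f g (x 0) (b 0) x b := by
  have hright : ∀ i, ∀ t ∈ Ico 0 T, ContinuousWithinAt (fun s => b s i) (Ici t) t := fun i t ht => by
    rw [ContinuousWithinAt, nhds_discrete, tendsto_pure]
    obtain ⟨r, hr, -, hbr⟩ := h.exists_right ht
    filter_upwards [Icc_mem_nhdsGE hr] with s hs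
    rw [hbr s hs]
  have hcontT : ∀ i, ∀ t ∈ Ioc 0 T, ∀ β, HasLeftLimit b t β → β i = b t i →
      ContinuousWithinAt (fun s => b s i) (Icc 0 T) t := fun i t ht β hβ hi => by
    have h1 : ContinuousWithinAt (fun s => b s i) (Iio t) t := by
      rw [ContinuousWithinAt, nhds_discrete, tendsto_pure]
      filter_upwards [hasLeftLimit_iff.1 hβ] with s hs
      rw [hs, hi]
    rcases ht.2.eq_or_lt with rfl | htT
    · refine (h1.union (continuousWithinAt_singleton)).mono fun s hs => ?_
      rcases hs.2.eq_or_lt with h' | h'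
      · exact Or.inr h'
      · exact Or.inl h'
    · refine (h1.union (hright i t ⟨ht.1.le, htT⟩)).mono fun s _ => ?_
      rcases lt_or_ge s t with h' | h'
      · exact Or.inl h'
      · exact Or.inr h'
  have hjump : ∀ i t, JumpsAt T b i t → t ∈ Ioc 0 T ∧ IsJumpTime b t ∧
      ∃ β, HasLeftLimit b t β ∧ β i ≠ 0 ∧ b t i = 0 := fun i t ⟨ht, hj⟩ => by
    have ht0 : t ∈ Ioc 0 T := ⟨lt_of_le_of_ne ht.1 fun h0 => hj (by
      rw [← h0]
      exact (hright i 0 ⟨le_rfl, hT⟩).mono Icc_subset_Ici_self), ht.2⟩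
    obtain ⟨β, hβ, h1, -⟩ := h.left t ht0
    have hne : β i ≠ b t i := fun h' => hj (hcontT i t ht0 β hβ h')
    have h0 : b t i = 0 := (h1 i).resolve_left hne.symm
    exact ⟨ht0, fun h' => hj (hcontT i t ht0 _ h' rfl), β, hβ, fun h' => hne (by rw [h0, h']), h0⟩
  refine ⟨h.mem, {t | t ∈ Ioc 0 T ∧ IsJumpTime b t}, h.finite_jumpTimes, fun t ht => ht.1,
    h.cont, ?_, hright, rfl, rfl, ?_, ?_, ?_, ?_⟩
  · have hopen : IsOpen (Ioo 0 T \ {t | t ∈ Ioc 0 T ∧ IsJumpTime b t}) :=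
      isOpen_Ioo.sdiff h.finite_jumpTimes.isClosed
    have hd : ∀ t ∈ Ioo 0 T \ {t | t ∈ Ioc 0 T ∧ IsJumpTime b t},
        HasDerivAt x (velocity f g (x t) (b t)) t ∧ ∀ᶠ s in 𝓝 t, b s = b t := fun t ht =>
      h.hasDerivAt hf hg ht.1 fun hj => ht.2 ⟨⟨ht.1.1, ht.1.2.le⟩, hj⟩
    rw [show (1 : WithTop ℕ∞) = 0 + 1 by simp, contDiffOn_succ_iff_deriv_of_isOpen hopen]
    refine ⟨fun t ht => (hd t ht).1.differentiableAt.differentiableWithinAt, by simp, ?_⟩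
    rw [contDiffOn_zero]
    intro t ht
    refine ContinuousAt.continuousWithinAt ?_
    have h1 : ContinuousAt (fun s => velocity f g (x s) (b t)) t :=
      ContinuousAt.comp (g := fun y => velocity f g y (b t)) (continuousAt_velocity hf hg
        (stateSpace_ne (h.mem t ⟨ht.1.1.le, ht.1.2.le⟩))) (hd t ht).1.continuousAt
    refine h1.congr ?_
    filter_upwards [(hd t ht).2, hopen.mem_nhds ht] with s hs hs'
    rw [(hd s hs').1.deriv, hs]
  · intro i s t hs ht
    have key : ∀ s t, JumpsAt T b i s → JumpsAt T b i t → ¬ s < t := fun s t hs ht hlt => by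
      obtain ⟨hs0, -, -, -, -, hbs⟩ := hjump i s hs
      obtain ⟨ht0, -, β, hβ, hβi, -⟩ := hjump i t ht
      rcases (h.left_of_ne hs0.1.le hlt ht0.2 hβ).1 i with h' | h'
      · exact hβi (h'.trans hbs)
      · exact hβi h'
    exact le_antisymm (not_lt.1 (key t s ht hs)) (not_lt.1 (key s t hs ht))
  · intro i t ht
    obtain ⟨h1, h2, β, h3, h4, h5⟩ := hjump i t ht
    exact ⟨⟨h1, h2⟩, ⟨β, h3, h4⟩, h5⟩
  · intro t ht
    obtain ⟨β, h1, -, h2⟩ := h.left t ht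
    exact ⟨β, h1, h2⟩
  · intro t ht i
    exact hasDerivAt_pi.1 (h.hasDerivAt hf hg ht.1 fun hj => ht.2 ⟨⟨ht.1.1, ht.1.2.le⟩, hj⟩).1 i

/-- By conservation of net charge, a charge can vanish only together with another one at the same
place. Conversely two charges at the same place cannot both persist in `stateSpace`. -/
lemma Sol.mem_collisionTimes_iff (h : Sol f g 0 T x b) {τ : ℝ} :
    τ ∈ collisionTimes T x b ↔ τ ∈ Ioc 0 T ∧ IsJumpTime b τ := by
  constructor
  · rintro ⟨y, hτ, β, hβ, i, j, hij, hi, hj, hxi, hxj⟩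
    exact ⟨hτ, h.isJumpTime_of_collision hτ hβ hij hi hj (hxi.trans hxj.symm)⟩
  · rintro ⟨hτ, hj⟩
    obtain ⟨β, hβ, -⟩ := h.left τ hτ
    have hne : b τ ≠ β := fun h' => hj (h'.symm ▸ hβ)
    obtain ⟨i, hi⟩ := Function.ne_iff.1 hne
    obtain ⟨j, hji, h1, h2, h3⟩ := h.exists_collision hτ hβ hi
    exact ⟨x τ i, hτ, β, hβ, i, j, hji.symm, h1, h2, rfl, h3⟩

lemma Sol.finite_collisionTimes (h : Sol f g 0 T x b) : (collisionTimes T x b).Finite :=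
  h.finite_jumpTimes.subset fun _ ht => h.mem_collisionTimes_iff.1 ht

/-! ### The distance between neighbors of equal sign -/

lemma exists_pos_le {ι : Type*} [Finite ι] {φ : ι → ℝ} (h : ∀ i, 0 < φ i) :
    ∃ c > 0, ∀ i, c ≤ φ i := by
  rcases isEmpty_or_nonempty ι with hι | hι
  · exact ⟨1, one_pos, fun i => isEmptyElim i⟩
  · obtain ⟨i, hi⟩ := Finite.exists_min φ
    exact ⟨φ i, h i, hi⟩

lemma exists_sameSignSep {x : Fin n → ℝ} {b : Fin n → SignType} (h : (x, b) ∈ stateSpace n) :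
    ∃ c > 0, SameSignSep c x b := by
  classical
  obtain ⟨c, hc, hle⟩ := exists_pos_le
    (φ := fun k : Fin n × Fin n => if AreNeighbors b k.1 k.2 then x k.2 - x k.1 else 1)
    fun k => by
      split_ifs with hk
      · exact sub_pos.2 (h _ _ hk.1 hk.2.1)
      · exact one_pos
  exact ⟨c, hc, fun i j hij _ => by simpa [hij] using hle (i, j)⟩

lemma SameSignSep.anti {c c' : ℝ} {x : Fin n → ℝ} {b : Fin n → SignType}
    (h : SameSignSep c x b) (hc : c' ≤ c) : SameSignSep c' x b :=
  fun i j hij hb => hc.trans (h i j hij hb)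

lemma SameSignSep.le_sameSignDist {c : ℝ} {x : Fin n → ℝ} {b : Fin n → SignType}
    (h : SameSignSep c x b) (s : SignType) : (c : EReal) ≤ sameSignDist s x b :=
  le_iInf fun i => le_iInf fun j => le_iInf fun hij =>
    EReal.coe_le_coe_iff.2 (h i j hij.1 (hij.2.1.trans hij.2.2.symm))

lemma abs_signType_le (s : SignType) : |(s : ℝ)| ≤ 1 := by
  rcases s with _ | _ | _ <;> simp

namespace Sol

variable {f g : ℝ → ℝ} {p q : ℝ} {x : ℝ → Fin n → ℝ} {b : ℝ → Fin n → SignType}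

lemma sameSignSep_of_const (hf : Repulsive f) {K : NNReal} (hg : LipschitzWith K g)
    (h : Sol f g p q x b) {β : Fin n → SignType} (hβ : ∀ t ∈ Ico p q, b t = β) {c : ℝ}
    (hc : 0 < c) (h0 : SameSignSep c (x p) β) :
    ∀ t ∈ Icc p q, SameSignSep (c * Real.exp (-(K + 1) * (t - p))) (x t) β := by
  -- The force `g` shrinks a gap at relative rate at most `K`; the rate `K + 1` makes the barrier
  -- condition strict.
  set B : ℝ → ℝ := fun t => c * Real.exp (-(K + 1) * (t - p)) with hB
  have hBd : ∀ t, HasDerivAt B (-(K + 1) * B t) t := fun t => by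
    have h1 : HasDerivAt (fun t : ℝ => -((K : ℝ) + 1) * (t - p)) (-(K + 1)) t := by
      simpa using ((hasDerivAt_id t).sub_const p).const_mul (-((K : ℝ) + 1))
    have := (h1.exp).const_mul c
    rw [show -(K + 1) * B t = c * (Real.exp (-(K + 1) * (t - p)) * -(K + 1)) by simp only [hB]; ring]
    exact this
  have key := barrier (p := p) (q := q)
    (φ := fun (k : Fin n × Fin n) t => x t k.2 - x t k.1 - B t)
    (Act := fun _ k => AreNeighbors β k.1 k.2 ∧ β k.1 = β k.2)
    (fun k => ((h.cont_apply k.2).sub (h.cont_apply k.1)).sub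
      fun t _ => (hBd t).continuousAt.continuousWithinAt)
    (fun _ _ _ _ _ _ h => h)
    (fun k hk => by
      have := h0 k.1 k.2 hk.1 hk.2
      simp only [hB, sub_self, mul_zero, Real.exp_zero, mul_one]; linarith)
    (fun t ht hP k hk hφ => by
      have hbt := hβ t ht
      have hd := ((h.deriv_apply ht k.2).sub (h.deriv_apply ht k.1)).sub (hBd t).hasDerivWithinAt
      refine ⟨_, ?_, hd⟩
      have hBpos : 0 < B t := by positivity
      have hsep : SameSignSep (B t) (x t) (b t) := fun i j hij hb => by
        have := hP t ⟨ht.1, le_rfl⟩ (i, j) (hbt ▸ ⟨hij, hb⟩)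
        simp only at this; linarith
      have hmem := h.mem t ⟨ht.1, ht.2.le⟩
      have hforce := hsep.force_le hf hmem (hbt ▸ hk.1) (hbt ▸ hk.2)
        (by linarith : x t k.2 - x t k.1 = B t)
      rw [velocity_eq hf, velocity_eq hf]
      have hbk : b t k.1 = b t k.2 := hbt ▸ hk.2
      have hlip : |(b t k.2 : ℝ) * (g (x t k.2) - g (x t k.1))| ≤ K * B t := by
        rw [abs_mul]
        have h1 := hg.dist_le_mul (x t k.2) (x t k.1)
        rw [Real.dist_eq, Real.dist_eq, show x t k.2 - x t k.1 = B t by linarith,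
          abs_of_pos hBpos] at h1
        calc _ ≤ 1 * (K * B t) := mul_le_mul (abs_signType_le _) h1 (abs_nonneg _) zero_le_one
          _ = _ := one_mul _
      rw [hbk]
      have h2 := neg_le_of_abs_le hlip
      have h3 : 0 ≤ 1 / (n : ℝ) * (force f (x t) (b t) k.2 - force f (x t) (b t) k.1) :=
        mul_nonneg (by positivity) (by linarith)
      nlinarith)
  intro t ht i j hij hb
  have := key t ht (i, j) ⟨hij, hb⟩
  simp only [hB] at this
  linarith

/-- Neighbors of equal sign stay at a positive distance from each other. -/
lemma exists_sameSignSep (hf : Repulsive f) {K : NNReal} (hg : LipschitzWith K g)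
    (h : Sol f g p q x b) (hpq : p ≤ q) : ∃ c > 0, ∀ t ∈ Icc p q, SameSignSep c (x t) (b t) := by
  suffices hP : ∀ t ∈ Icc p q, ∃ c > 0, ∀ s ∈ Icc p t, SameSignSep c (x s) (b s) from
    hP q ⟨hpq, le_rfl⟩
  have hexp : ∀ u v w : ℝ, v ≤ w → Real.exp (-(K + 1) * (w - u)) ≤ Real.exp (-(K + 1) * (v - u)) :=
    fun u v w hvw => Real.exp_le_exp.2 (by nlinarith [K.coe_nonneg])
  have hexp1 : ∀ u v : ℝ, u ≤ v → Real.exp (-(K + 1) * (v - u)) ≤ 1 :=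
    fun u v huv => Real.exp_le_one_iff.2 (by nlinarith [K.coe_nonneg])
  refine icc_induction ?_ (fun t ht hP => ?_) (fun t ht hP => ?_)
  · obtain ⟨c, hc, h1⟩ := ParticleAnnihilation.exists_sameSignSep (h.mem p ⟨le_rfl, hpq⟩)
    exact ⟨c, hc, fun s hs => by rw [le_antisymm hs.2 hs.1]; exact h1⟩
  · obtain ⟨c, hc, h1⟩ := hP t ⟨ht.1, le_rfl⟩
    obtain ⟨r, hr, hrq, hbr⟩ := h.exists_right ht
    have h2 := (h.mono ht.1 hrq).sameSignSep_of_const hf hg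
      (fun s hs => hbr s ⟨hs.1, hs.2.le⟩) hc (h1 t ⟨ht.1, le_rfl⟩)
    filter_upwards [eventually_nhdsGT_mem_Ioc hr] with s hs
    refine ⟨c * Real.exp (-(K + 1) * (r - t)), by positivity, fun u hu => ?_⟩
    rcases le_or_gt u t with h3 | h3
    · exact (h1 u ⟨hu.1, h3⟩).anti (mul_le_of_le_one_right hc.le (hexp1 t r hr.le))
    · have hur : u ∈ Icc t r := ⟨h3.le, hu.2.trans hs.2⟩
      rw [hbr u hur]
      exact (h2 u hur).anti (mul_le_mul_of_nonneg_left (hexp _ _ _ hur.2) hc.le)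
  · obtain ⟨β, hβ, l, hpl, hlt, hbl⟩ := h.exists_left ht
    obtain ⟨c, hc, h1⟩ := hP l ⟨hpl, hlt⟩
    have h2 := (h.mono hpl ht.2).sameSignSep_of_const hf hg hbl hc
      (hbl l ⟨le_rfl, hlt⟩ ▸ h1 l ⟨hpl, le_rfl⟩)
    -- At time `t` an annihilation may have created new neighbors; the strict order of the state at
    -- `t` supplies a separate constant for this time.
    obtain ⟨c', hc', h3⟩ := ParticleAnnihilation.exists_sameSignSep (h.mem t ⟨ht.1.le, ht.2⟩)
    refine ⟨min (c * Real.exp (-(K + 1) * (t - l))) c', by positivity, fun u hu => ?_⟩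
    rcases le_or_gt u l with h4 | h4
    · exact (h1 u ⟨hu.1, h4⟩).anti
        ((min_le_left _ _).trans (mul_le_of_le_one_right hc.le (hexp1 l t hlt.le)))
    · rcases hu.2.eq_or_lt with rfl | h5
      · exact h3.anti (min_le_right _ _)
      · rw [hbl u ⟨h4.le, h5⟩]
        exact (h2 u ⟨h4.le, hu.2⟩).anti
          ((min_le_left _ _).trans (mul_le_mul_of_nonneg_left (hexp _ _ _ hu.2) hc.le))

/-- The gap survives the passage to the left limit of the charges. Thus neighbors that meet at `t`
have opposite signs, and the colliding clusters alternate. -/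
lemma exists_sameSignSep_left (hf : Repulsive f) {K : NNReal} (hg : LipschitzWith K g)
    (h : Sol f g p q x b) {t : ℝ} (ht : t ∈ Ioc p q) {β : Fin n → SignType}
    (hβ : HasLeftLimit b t β) : ∃ c > 0, SameSignSep c (x t) β := by
  obtain ⟨c, hc, h1⟩ := h.exists_sameSignSep hf hg (ht.1.le.trans ht.2)
  refine ⟨c, hc, fun i j hij hb => ?_⟩
  refine ge_of_tendsto ((ContinuousOn.tendsto_nhdsLT (h.cont_apply j) ht).sub
    (ContinuousOn.tendsto_nhdsLT (h.cont_apply i) ht)) ?_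
  filter_upwards [hasLeftLimit_iff.1 hβ, eventually_nhdsLT_mem_Ico ht.1] with s hs hst
  exact h1 s ⟨hst.1, hst.2.le.trans ht.2⟩ i j (hs ▸ hij) (hs ▸ hb)

end Sol

/-! ### Alternating clusters -/

/-- `A` contains, with each index, all smaller indices of charged particles of the cluster. -/
def IsInitial (X : Fin n → ℝ) (b : Fin n → SignType) (y : ℝ) (A : Finset (Fin n)) : Prop :=
  ∀ i ∈ A, ∀ j, j < i → b j ≠ 0 → X j = y → j ∈ A

/-- The particles with equal values of `X` form a cluster; in each cluster the signs of the charges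
alternate. -/
def Alternating (X : Fin n → ℝ) (b : Fin n → SignType) : Prop :=
  ∀ y A B, IsInitial X b y A → IsInitial X b y B →
    ∑ i ∈ A with X i = y, (b i : ℤ) - ∑ i ∈ B with X i = y, (b i : ℤ) ≤ 1

lemma isInitial_univ (X : Fin n → ℝ) (b : Fin n → SignType) (y : ℝ) :
    IsInitial X b y Finset.univ := fun _ _ _ _ _ _ => Finset.mem_univ _

lemma isInitial_empty (X : Fin n → ℝ) (b : Fin n → SignType) (y : ℝ) :
    IsInitial X b y ∅ := fun i hi => absurd hi (Finset.notMem_empty i)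

lemma isInitial_lt (X : Fin n → ℝ) (b : Fin n → SignType) (y : ℝ) (k : Fin n) :
    IsInitial X b y (Finset.univ.filter (· < k)) := fun i hi j hj _ _ => by
  simp only [Finset.mem_filter, Finset.mem_univ, true_and] at hi ⊢
  exact hj.trans hi

lemma isInitial_le (X : Fin n → ℝ) (b : Fin n → SignType) (y : ℝ) (k : Fin n) :
    IsInitial X b y (Finset.univ.filter (· ≤ k)) := fun i hi j hj _ _ => by
  simp only [Finset.mem_filter, Finset.mem_univ, true_and] at hi ⊢
  exact hj.le.trans hi

lemma signType_cast_neg_of_ne {s t : SignType} (hs : s ≠ 0) (ht : t ≠ 0) (h : s ≠ t) :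
    (s : ℤ) = -t := by
  rcases s with _ | _ | _ <;> rcases t with _ | _ | _ <;> simp_all

lemma abs_signType_int_le (s : SignType) : |(s : ℤ)| ≤ 1 := by
  rcases s with _ | _ | _ <;> simp

/-- The net charge of an initial segment of the cluster is `0` or the sign `s` of its first charge,
so two such net charges differ by at most one. -/
lemma alternating_of_neighbors {X : Fin n → ℝ} {b : Fin n → SignType}
    (hX : ∀ i j, i < j → b i ≠ 0 → b j ≠ 0 → X i ≤ X j)
    (h : ∀ i j, AreNeighbors b i j → X i = X j → b i ≠ b j) : Alternating X b := by
  intro y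
  obtain ⟨s, hs⟩ : ∃ s : SignType, ∀ i, b i ≠ 0 → X i = y →
      (∀ j, j < i → b j ≠ 0 → X j ≠ y) → b i = s := by
    by_cases hex : (Finset.univ.filter fun i => b i ≠ 0 ∧ X i = y).Nonempty
    · refine ⟨b (Finset.min' _ hex), fun i hi hiy hmin => ?_⟩
      have hm := Finset.min'_mem _ hex
      have hle : Finset.min' _ hex ≤ i := Finset.min'_le _ i (Finset.mem_filter.2 ⟨Finset.mem_univ i, hi, hiy⟩)
      rcases hle.eq_or_lt with h' | h'
      · rw [h']
      · simp only [Finset.mem_filter, Finset.mem_univ, true_and] at hm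
        exact absurd hm.2 (hmin _ h' hm.1)
    · refine ⟨0, fun i hi hiy _ => absurd ⟨i, ?_⟩ hex⟩
      simp [hi, hiy]
  have main : ∀ C : Finset (Fin n), (∀ i ∈ C, b i ≠ 0 ∧ X i = y) → IsInitial X b y C →
      (C = ∅ ∧ ∑ i ∈ C, (b i : ℤ) = 0) ∨ ∃ l ∈ C, (∀ k ∈ C, k ≤ l) ∧
        ((∑ i ∈ C, (b i : ℤ) = s ∧ b l = s) ∨ (∑ i ∈ C, (b i : ℤ) = 0 ∧ (b l : ℤ) = -s)) := by
    intro C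
    induction C using Finset.induction_on_max with
    | empty => simp
    | insert a C hC ih =>
      intro hch hin
      right
      have haC : a ∉ C := fun h' => (hC a h').false
      have hca := hch a (by simp)
      have hinC : IsInitial X b y C := fun i hi j hj hbj hXj => by
        rcases Finset.mem_insert.1 (hin i (by simp [hi]) j hj hbj hXj) with rfl | h'
        · exact absurd (hC i hi) hj.not_gt
        · exact h'
      refine ⟨a, by simp, fun k hk => ?_, ?_⟩
      · rcases Finset.mem_insert.1 hk with rfl | h'
        · exact le_rfl
        · exact (hC k h').le
      rw [Finset.sum_insert haC]
      rcases ih (fun i hi => hch i (by simp [hi])) hinC with ⟨rfl, hsum⟩ | ⟨l, hl, hmax, hcase⟩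
      · have has := hs a hca.1 hca.2 fun j hj hbj hXj => by
          have := hin a (by simp) j hj hbj hXj
          simp only [insert_empty_eq, Finset.mem_singleton] at this
          exact hj.ne this
        left
        simp [has]
      · have hcl := hch l (by simp [hl])
        have hla := hC l hl
        have hne : b l ≠ b a := by
          refine h l a ⟨hla, mul_ne_zero hcl.1 hca.1, fun k hk1 hk2 => ?_⟩
            (hcl.2.trans hca.2.symm)
          by_contra hk
          have h1 := hX l k hk1 hcl.1 hk
          have h2 := hX k a hk2 hk hca.1
          have hXk : X k = y := le_antisymm (h2.trans hca.2.le) (hcl.2 ▸ h1)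
          rcases Finset.mem_insert.1 (hin a (by simp) k hk2 hk hXk) with h3 | h3
          · exact hk2.ne h3
          · exact absurd (hmax k h3) (not_le.2 hk1)
        have hneg := signType_cast_neg_of_ne hca.1 hcl.1 hne.symm
        rcases hcase with ⟨h1, h2⟩ | ⟨h1, h2⟩
        · right
          rw [h1, hneg, h2]; simp
        · left
          rw [h1, hneg, h2]
          refine ⟨by simp, ?_⟩
          have : (b a : ℤ) = s := by rw [hneg, h2, neg_neg]
          revert this
          rcases b a with _ | _ | _ <;> rcases s with _ | _ | _ <;> simp
  have main' : ∀ A, IsInitial X b y A → ∑ i ∈ A with X i = y, (b i : ℤ) = 0 ∨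
      ∑ i ∈ A with X i = y, (b i : ℤ) = s := by
    intro A hA
    have h1 := main (A.filter fun i => b i ≠ 0 ∧ X i = y) (fun i hi => (Finset.mem_filter.1 hi).2)
      (fun i hi j hj hbj hXj => Finset.mem_filter.2
        ⟨hA i (Finset.mem_filter.1 hi).1 j hj hbj hXj, hbj, hXj⟩)
    have h2 : ∑ i ∈ A with b i ≠ 0 ∧ X i = y, (b i : ℤ) = ∑ i ∈ A with X i = y, (b i : ℤ) := by
      refine Finset.sum_subset (fun i hi => ?_) (fun i hi hi' => ?_)
      · simp only [Finset.mem_filter] at hi ⊢; exact ⟨hi.1, hi.2.2⟩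
      · simp only [Finset.mem_filter, not_and] at hi hi'
        have : b i = 0 := by by_contra hb; exact hi' hi.1 hb hi.2
        simp [this]
    rw [← h2]
    rcases h1 with ⟨-, h1⟩ | ⟨l, -, -, ⟨h1, -⟩ | ⟨h1, -⟩⟩
    · exact Or.inl h1
    · exact Or.inr h1
    · exact Or.inl h1
  intro A B hA hB
  have hs1 := abs_le.1 (abs_signType_int_le s)
  rcases main' A hA with h1 | h1 <;> rcases main' B hB with h2 | h2 <;> rw [h1, h2] <;> omega

/-- Sums over unions of fibers of `z` are determined by the sums over the fibers. -/
lemma sum_eq_of_fibers {z : Fin n → ℝ} {b β : Fin n → SignType}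
    (h : ∀ y, ∑ i with z i = y, (b i : ℤ) = ∑ i with z i = y, (β i : ℤ)) {S : Finset (Fin n)}
    (hS : ∀ i ∈ S, ∀ j, z j = z i → j ∈ S) : ∑ i ∈ S, (b i : ℤ) = ∑ i ∈ S, (β i : ℤ) := by
  classical
  have hmaps : ∀ i ∈ S, z i ∈ S.image z := fun i hi => Finset.mem_image_of_mem z hi
  rw [← Finset.sum_fiberwise_of_maps_to hmaps, ← Finset.sum_fiberwise_of_maps_to hmaps]
  refine Finset.sum_congr rfl fun y hy => ?_
  obtain ⟨i, hi, rfl⟩ := Finset.mem_image.1 hy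
  have : S.filter (fun j => z j = z i) = Finset.univ.filter fun j => z j = z i := by
    ext j
    simp only [Finset.mem_filter, Finset.mem_univ, true_and, and_iff_right_iff_imp]
    exact hS i hi j
  rw [this, h]

/-- The annihilation rule preserves alternation. -/
lemma Alternating.annihilate {X z : Fin n → ℝ} {b β : Fin n → SignType} (hA : Alternating X β)
    (hnet : ∀ y, ∑ i with z i = y, (b i : ℤ) = ∑ i with z i = y, (β i : ℤ))
    (hβz : ∀ i j, i < j → β i ≠ 0 → β j ≠ 0 → z i ≤ z j) (hbz : (z, b) ∈ stateSpace n)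
    (hXz : ∀ i j, z i = z j → X i = X j) : Alternating X b := by
  classical
  intro y
  have main : ∀ A, IsInitial X b y A → ∃ A', IsInitial X β y A' ∧
      ∑ i ∈ A with X i = y, (b i : ℤ) = ∑ i ∈ A' with X i = y, (β i : ℤ) := by
    intro A hA
    -- An initial segment `A` after the annihilation corresponds to all particles of the cluster
    -- which, at the positions `z`, are not to the right of some surviving charge of `A`. This is a
    -- union of fibers of `z`, so `b` and `β` have the same net charge on it.
    set Q : Fin n → Prop := fun k => X k = y ∧ ∃ j ∈ A, b j ≠ 0 ∧ X j = y ∧ z k ≤ z j with hQ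
    refine ⟨Finset.univ.filter fun k => β k ≠ 0 ∧ Q k, fun i hi j hj hbj hXj => ?_, ?_⟩
    · simp only [Finset.mem_filter, Finset.mem_univ, true_and] at hi ⊢
      obtain ⟨hbi, -, k, hk, h1, h2, h3⟩ := hi
      exact ⟨hbj, hXj, k, hk, h1, h2, (hβz j i hj hbj hbi).trans h3⟩
    · have e1 : ∑ i ∈ (Finset.univ.filter fun k => β k ≠ 0 ∧ Q k) with X i = y, (β i : ℤ) =
          ∑ i with Q i, (β i : ℤ) := by
        refine Finset.sum_subset (fun i hi => ?_) (fun i hi hi' => ?_)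
        · simp only [Finset.mem_filter, Finset.mem_univ, true_and] at hi ⊢; exact hi.1.2
        · simp only [Finset.mem_filter, Finset.mem_univ, true_and, not_and] at hi hi'
          have : β i = 0 := by by_contra hb; exact hi' ⟨hb, hi⟩ hi.1
          simp [this]
      rw [e1, ← sum_eq_of_fibers hnet]
      · have hmem : ∀ i, b i ≠ 0 → (Q i ↔ i ∈ A ∧ X i = y) := fun i hi => by
          constructor
          · rintro ⟨hXi, j, hj, hbj, hXj, hz⟩
            refine ⟨?_, hXi⟩
            rcases lt_trichotomy i j with h' | rfl | h'
            · exact hA j hj i h' hi hXi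
            · exact hj
            · exact absurd (charged_lt hbz h' hbj hi) (not_lt.2 hz)
          · rintro ⟨h1, h2⟩
            exact ⟨h2, i, h1, hi, h2, le_rfl⟩
        rw [Finset.sum_filter, Finset.sum_filter, ← Finset.sum_filter, ← Finset.sum_filter,
          ← Finset.sum_filter_ne_zero, ← Finset.sum_filter_ne_zero (s := Finset.univ.filter Q)]
        refine Finset.sum_congr ?_ fun _ _ => rfl
        ext i
        simp only [Finset.mem_filter, Finset.mem_univ, true_and]
        refine and_congr_left fun hi => (hmem i fun h' => hi (by simp [h'])).symm
      · intro i hi j hij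
        simp only [Finset.mem_filter, Finset.mem_univ, true_and] at hi ⊢
        obtain ⟨hXi, k, hk, h1, h2, h3⟩ := hi
        exact ⟨(hXz j i hij).trans hXi, k, hk, h1, h2, hij.le.trans h3⟩
  intro A B hA' hB'
  obtain ⟨A', hA1, hA2⟩ := main A hA'
  obtain ⟨B', hB1, hB2⟩ := main B hB'
  rw [hA2, hB2]
  exact hA y A' B' hA1 hB1

/-! ### Forces inside an alternating cluster -/

lemma signType_int_mul_self {s : SignType} (h : s ≠ 0) : (s : ℤ) * s = 1 := by
  rcases s with _ | _ | _ <;> simp_all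

lemma signType_int_mul_le (s : SignType) {D : ℤ} (h1 : D ≤ 1) (h2 : -D ≤ 1) : (s : ℤ) * D ≤ 1 := by
  rcases s with _ | _ | _ <;> simp <;> omega

/-- Summation by parts: nonpositive prefix sums against an antitone nonnegative weight. -/
lemma sum_mul_nonpos_of_prefix {ι : Type*} [LinearOrder ι] {c φ : ι → ℝ} (s : Finset ι)
    (hφ : ∀ i ∈ s, ∀ j ∈ s, i ≤ j → φ j ≤ φ i) (hc : ∀ k ∈ s, ∑ j ∈ s with j ≤ k, c j ≤ 0)
    (h0 : ∀ i ∈ s, 0 ≤ φ i) : ∑ i ∈ s, c i * φ i ≤ 0 := by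
  have := sum_mul_le_of_suffix (ι := ιᵒᵈ) (c := c) (φ := φ) s (fun i hi j hj hij => hφ j hj i hi hij)
    hc 0 h0
  rw [zero_mul] at this
  exact this

/-- The interaction of particle `i` with the other particles of its cluster. -/
noncomputable def internalForce (X : Fin n → ℝ) (φ : ℝ → ℝ) (x : Fin n → ℝ) (b : Fin n → SignType)
    (i : Fin n) : ℝ := ∑ k with X k = X i ∧ k ≠ i, (b i : ℝ) * b k * φ (x i - x k)

lemma Alternating.sum_rightmost_nonpos {X x : Fin n → ℝ} {b : Fin n → SignType}
    (hA : Alternating X b) (hx : (x, b) ∈ stateSpace n) {j : Fin n} (hj : b j ≠ 0)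
    (hmax : ∀ k, j < k → X k = X j → b k = 0) {φ : ℝ → ℝ} {R : ℝ}
    (hφ : ∀ u v, 0 < u → u ≤ v → v ≤ R → φ v ≤ φ u) (hφ0 : ∀ u, 0 < u → u ≤ R → 0 ≤ φ u)
    (hR : ∀ k, b k ≠ 0 → X k = X j → x j - x k ≤ R) :
    internalForce X φ x b j ≤ 0 := by
  classical
  set C : Finset (Fin n) := Finset.univ.filter fun k => (X k = X j ∧ k ≠ j) ∧ b k ≠ 0 with hC
  have hmem : ∀ k ∈ C, X k = X j ∧ b k ≠ 0 ∧ k < j := fun k hk => by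
    simp only [hC, Finset.mem_filter, Finset.mem_univ, true_and] at hk
    refine ⟨hk.1.1, hk.2, lt_of_le_of_ne (not_lt.1 fun h => hk.2 (hmax k h hk.1.1)) hk.1.2⟩
  have e1 : internalForce X φ x b j = ∑ k ∈ C, (b j : ℝ) * b k * φ (x j - x k) := by
    refine (Finset.sum_subset (fun k hk => ?_) (fun k hk hk' => ?_)).symm
    · simp only [hC, Finset.mem_filter, Finset.mem_univ, true_and] at hk ⊢; exact hk.1
    · simp only [hC, Finset.mem_filter, Finset.mem_univ, true_and, not_and, not_not] at hk hk'
      simp [hk' hk]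
  rw [e1]
  have hpos : ∀ k ∈ C, 0 < x j - x k := fun k hk => by
    linarith [charged_lt hx (hmem k hk).2.2 (hmem k hk).2.1 hj]
  have := sum_mul_le_of_suffix (c := fun k => (b j : ℝ) * b k) (φ := fun k => φ (x j - x k)) C
    (fun k hk l hl hkl => by
      refine hφ _ _ (hpos l hl) ?_ (hR k (hmem k hk).2.1 (hmem k hk).1)
      rcases hkl.eq_or_lt with rfl | h
      · exact le_rfl
      · linarith [charged_lt hx h (hmem k hk).2.1 (hmem l hl).2.1])
    (fun k hk => by
      have h1 := hA (X j) _ _ (isInitial_univ X b _) (isInitial_lt X b _ k)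
      have h2 := hA (X j) _ _ (isInitial_lt X b _ k) (isInitial_univ X b _)
      set D := ∑ i with X i = X j, (b i : ℤ) - ∑ i ∈ Finset.univ.filter (· < k) with X i = X j, (b i : ℤ)
        with hD
      have h3 : D = b j + ∑ l ∈ C with k ≤ l, (b l : ℤ) := by
        rw [hD, sub_eq_iff_eq_add, ← Finset.sum_insert (s := C.filter (k ≤ ·)) (a := j)
          (f := fun l => (b l : ℤ)) (by simp [hC]), ← Finset.sum_union]
        · refine (Finset.sum_subset (fun l _ => ?_) (fun l hl hl' => ?_)).symm
          · rename_i hl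
            rcases Finset.mem_union.1 hl with h | h
            · rcases Finset.mem_insert.1 h with rfl | h
              · simp
              · simpa using (hmem l (Finset.mem_filter.1 h).1).1
            · simpa using (Finset.mem_filter.1 h).2
          · simp only [Finset.mem_filter, Finset.mem_univ, true_and] at hl
            have : b l = 0 := by
              by_contra hb
              apply hl'
              rcases lt_or_ge l k with h | h
              · simp [h, hl]
              · by_cases hlj : l = j
                · simp [hlj]
                · simp [hC, hl, hlj, hb, h]
            simp [this]
        · rw [Finset.disjoint_left]
          intro l hl hl'
          simp only [Finset.mem_filter, Finset.mem_univ, true_and] at hl'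
          rcases Finset.mem_insert.1 hl with rfl | h
          · exact absurd (hmem k hk).2.2 hl'.1.not_gt
          · exact absurd (Finset.mem_filter.1 h).2 (not_le.2 hl'.1)
      have h4 := signType_int_mul_le (b j) h1 (by linarith : -D ≤ 1)
      rw [h3, mul_add, signType_int_mul_self hj] at h4
      rw [← Finset.mul_sum]
      have h5 : ((b j : ℤ) : ℝ) * ((∑ l ∈ C with k ≤ l, (b l : ℤ) : ℤ) : ℝ) ≤ 0 := by
        exact_mod_cast (by linarith : (b j : ℤ) * ∑ l ∈ C with k ≤ l, (b l : ℤ) ≤ 0)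
      push_cast at h5
      exact h5)
    0 (fun k hk => hφ0 _ (hpos k hk) (hR k (hmem k hk).2.1 (hmem k hk).1))
  simpa using this

lemma Alternating.sum_leftmost_nonpos {X x : Fin n → ℝ} {b : Fin n → SignType}
    (hA : Alternating X b) (hx : (x, b) ∈ stateSpace n) {j : Fin n} (hj : b j ≠ 0)
    (hmin : ∀ k, k < j → X k = X j → b k = 0) {φ : ℝ → ℝ} {R : ℝ}
    (hφ : ∀ u v, 0 < u → u ≤ v → v ≤ R → φ v ≤ φ u) (hφ0 : ∀ u, 0 < u → u ≤ R → 0 ≤ φ u)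
    (hR : ∀ k, b k ≠ 0 → X k = X j → x k - x j ≤ R) :
    internalForce X (fun u => φ (-u)) x b j ≤ 0 := by
  classical
  set C : Finset (Fin n) := Finset.univ.filter fun k => (X k = X j ∧ k ≠ j) ∧ b k ≠ 0 with hC
  have hmem : ∀ k ∈ C, X k = X j ∧ b k ≠ 0 ∧ j < k := fun k hk => by
    simp only [hC, Finset.mem_filter, Finset.mem_univ, true_and] at hk
    refine ⟨hk.1.1, hk.2, lt_of_le_of_ne (not_lt.1 fun h => hk.2 (hmin k h hk.1.1)) hk.1.2.symm⟩
  have e1 : internalForce X (fun u => φ (-u)) x b j =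
      ∑ k ∈ C, (b j : ℝ) * b k * φ (x k - x j) := by
    simp only [internalForce, neg_sub]
    refine (Finset.sum_subset (fun k hk => ?_) (fun k hk hk' => ?_)).symm
    · simp only [hC, Finset.mem_filter, Finset.mem_univ, true_and] at hk ⊢; exact hk.1
    · simp only [hC, Finset.mem_filter, Finset.mem_univ, true_and, not_and, not_not] at hk hk'
      simp [hk' hk]
  rw [e1]
  have hpos : ∀ k ∈ C, 0 < x k - x j := fun k hk => by
    linarith [charged_lt hx (hmem k hk).2.2 hj (hmem k hk).2.1]
  have := sum_mul_nonpos_of_prefix (c := fun k => (b j : ℝ) * b k)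
    (φ := fun k => φ (x k - x j)) C
    (fun k hk l hl hkl => by
      refine hφ _ _ (hpos k hk) ?_ (hR l (hmem l hl).2.1 (hmem l hl).1)
      rcases hkl.eq_or_lt with rfl | h
      · exact le_rfl
      · linarith [charged_lt hx h (hmem k hk).2.1 (hmem l hl).2.1])
    (fun k hk => by
      have h1 := hA (X j) _ _ (isInitial_le X b _ k) (isInitial_empty X b _)
      have h2 := hA (X j) _ _ (isInitial_empty X b _) (isInitial_le X b _ k)
      have hkj : j < k := (hmem k hk).2.2
      simp only [Finset.filter_empty, Finset.sum_empty, sub_zero, zero_sub] at h1 h2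
      set D := ∑ i ∈ Finset.univ.filter (· ≤ k) with X i = X j, (b i : ℤ) with hD
      have h3 : D = b j + ∑ l ∈ C with l ≤ k, (b l : ℤ) := by
        rw [hD, ← Finset.sum_insert (s := C.filter (· ≤ k)) (a := j)
          (f := fun l => (b l : ℤ)) (by simp [hC])]
        refine (Finset.sum_subset (fun l hl => ?_) (fun l hl hl' => ?_)).symm
        · rcases Finset.mem_insert.1 hl with rfl | h
          · simp [hkj.le]
          · simpa using ⟨(Finset.mem_filter.1 h).2, (hmem l (Finset.mem_filter.1 h).1).1⟩
        · simp only [Finset.mem_filter, Finset.mem_univ, true_and] at hl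
          have : b l = 0 := by
            by_contra hb
            apply hl'
            by_cases hlj : l = j
            · simp [hlj]
            · simp [hC, hl, hlj, hb]
          simp [this]
      have h4 := signType_int_mul_le (b j) h1 h2
      rw [h3, mul_add, signType_int_mul_self hj] at h4
      rw [← Finset.mul_sum]
      have h5 : ((b j : ℤ) : ℝ) * ((∑ l ∈ C with l ≤ k, (b l : ℤ) : ℤ) : ℝ) ≤ 0 := by
        exact_mod_cast (by linarith :
          (b j : ℤ) * ∑ l ∈ C with l ≤ k, (b l : ℤ) ≤ 0)
      push_cast at h5
      exact h5)
    (fun k hk => hφ0 _ (hpos k hk) (hR k (hmem k hk).2.1 (hmem k hk).1))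
  exact this

lemma abs_force_sub_internalForce_le {f : ℝ → ℝ} (hf : Repulsive f) {X x : Fin n → ℝ}
    {b : Fin n → SignType} {r : ℝ} (hr : 0 < r) {i : Fin n}
    (hfar : ∀ k, X k ≠ X i → r ≤ |x i - x k|) :
    |force f x b i - internalForce X f x b i| ≤ n * f r := by
  have e1 : internalForce X f x b i =
      ∑ k with X k = X i, (b i : ℝ) * b k * f (x i - x k) := by
    refine Finset.sum_subset (fun k hk => ?_) (fun k hk hk' => ?_)
    · simp only [Finset.mem_filter, Finset.mem_univ, true_and] at hk ⊢; exact hk.1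
    · simp only [Finset.mem_filter, Finset.mem_univ, true_and, not_and, not_not, ne_eq] at hk hk'
      simp [hk' hk, hf.map_zero]
  have e2 : force f x b i - internalForce X f x b i =
      ∑ k with ¬ X k = X i, (b i : ℝ) * b k * f (x i - x k) := by
    rw [e1, force, ← Finset.sum_filter_add_sum_filter_not Finset.univ (fun k => X k = X i)]
    ring
  rw [e2]
  refine (Finset.abs_sum_le_sum_abs _ _).trans ((Finset.sum_le_card_nsmul _ _ (f r) ?_).trans ?_)
  · intro k hk
    simp only [Finset.mem_filter, Finset.mem_univ, true_and] at hk
    have h1 := hf.abs_le hr (hfar k hk)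
    rw [abs_mul, abs_mul]
    calc _ ≤ 1 * 1 * f r := mul_le_mul (mul_le_mul (abs_signType_le _) (abs_signType_le _)
          (abs_nonneg _) zero_le_one) h1 (abs_nonneg _) (by norm_num)
      _ = f r := by ring
  · rw [nsmul_eq_mul]
    refine mul_le_mul_of_nonneg_right ?_ (hf.nonneg r hr)
    exact_mod_cast (Finset.card_le_univ _).trans (by simp)

lemma Alternating.internalForce_rightmost_nonpos {f : ℝ → ℝ} (hf : Repulsive f)
    {X x : Fin n → ℝ} {b : Fin n → SignType}
    (hA : Alternating X b) (hx : (x, b) ∈ stateSpace n) {j : Fin n}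
    (hmax : ∀ k, j < k → X k = X j → b k = 0) : internalForce X f x b j ≤ 0 := by
  by_cases hj : b j = 0
  · simp [internalForce, hj]
  obtain ⟨R, hR⟩ : ∃ R, ∀ k, x j - x k ≤ R := by
    obtain ⟨R, hR⟩ := (Set.finite_range fun k => x j - x k).bddAbove
    exact ⟨R, fun k => hR ⟨k, rfl⟩⟩
  exact hA.sum_rightmost_nonpos hx hj hmax (R := R) (fun u v hu huv _ => hf.le_of_le hu huv)
    (fun u hu _ => hf.nonneg u hu) fun k _ _ => hR k

lemma internalForce_eq_neg {f : ℝ → ℝ} (hf : Repulsive f) (X x : Fin n → ℝ)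
    (b : Fin n → SignType) (j : Fin n) :
    internalForce X f x b j = -internalForce X (fun u => f (-u)) x b j := by
  simp only [internalForce, neg_sub]
  rw [← Finset.sum_neg_distrib]
  exact Finset.sum_congr rfl fun k _ => by rw [hf.map_sub_comm]; ring

lemma Alternating.internalForce_leftmost_nonneg {f : ℝ → ℝ} (hf : Repulsive f)
    {X x : Fin n → ℝ} {b : Fin n → SignType}
    (hA : Alternating X b) (hx : (x, b) ∈ stateSpace n) {j : Fin n}
    (hmin : ∀ k, k < j → X k = X j → b k = 0) : 0 ≤ internalForce X f x b j := by
  by_cases hj : b j = 0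
  · simp [internalForce, hj]
  obtain ⟨R, hR⟩ : ∃ R, ∀ k, x k - x j ≤ R := by
    obtain ⟨R, hR⟩ := (Set.finite_range fun k => x k - x j).bddAbove
    exact ⟨R, fun k => hR ⟨k, rfl⟩⟩
  have := hA.sum_leftmost_nonpos hx hj hmin (φ := f) (R := R)
    (fun u v hu huv _ => hf.le_of_le hu huv) (fun u hu _ => hf.nonneg u hu) fun k _ _ => hR k
  rw [internalForce_eq_neg hf]
  linarith

/-- The net charge of an alternating cluster in terms of its outermost charges. -/
lemma Alternating.net_charge {X : Fin n → ℝ} {b : Fin n → SignType} (hA : Alternating X b)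
    {i j : Fin n} (hX : X i = X j) (hi : b i ≠ 0) (hj : b j ≠ 0)
    (hmin : ∀ k, k < i → X k = X i → b k = 0) (hmax : ∀ k, j < k → X k = X j → b k = 0) :
    ∑ k with X k = X i, (b k : ℤ) = if b i = b j then (b i : ℤ) else 0 := by
  have split : ∀ k (Q : Fin n → Prop) [DecidablePred Q], Q k → X k = X i →
      ∑ l ∈ Finset.univ.filter Q with X l = X i, (b l : ℤ) =
      b k + ∑ l ∈ Finset.univ.filter (fun l => Q l ∧ l ≠ k) with X l = X i, (b l : ℤ) := by
    intro k Q _ hQ hXk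
    rw [← Finset.add_sum_erase _ _ (show k ∈ (Finset.univ.filter Q).filter (fun l => X l = X i) by
      simp [hQ, hXk])]
    congr 2
    ext l
    simp only [Finset.mem_erase, Finset.mem_filter, Finset.mem_univ, true_and]
    tauto
  have a1 := hA (X i) _ _ (isInitial_le X b _ i) (isInitial_empty X b _)
  have eL : ∑ l ∈ Finset.univ.filter (· ≤ i) with X l = X i, (b l : ℤ) = b i := by
    rw [split i (· ≤ i) le_rfl rfl, Finset.sum_eq_zero, add_zero]
    intro k hk
    simp only [Finset.mem_filter, Finset.mem_univ, true_and] at hk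
    simp [hmin k (lt_of_le_of_ne hk.1.1 hk.1.2) hk.2]
  have eR : ∑ l with X l = X i, (b l : ℤ) =
      b j + ∑ l ∈ Finset.univ.filter (· < j) with X l = X i, (b l : ℤ) := by
    have h1 := split j (fun _ => True) trivial hX.symm
    simp only [Finset.filter_true, true_and] at h1
    rw [h1]
    congr 1
    refine (Finset.sum_subset (fun k hk => ?_) (fun k hk hk' => ?_)).symm
    · simp only [Finset.mem_filter, Finset.mem_univ, true_and] at hk ⊢
      exact ⟨hk.1.ne, hk.2⟩
    · simp only [Finset.mem_filter, Finset.mem_univ, true_and, not_and] at hk hk'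
      have : j < k := lt_of_le_of_ne (not_lt.1 fun h => hk' h hk.2) hk.1.symm
      simp [hmax k this (hk.2.trans hX)]
  have h1 := hA (X i) _ _ (isInitial_univ X b _) (isInitial_le X b _ i)
  have h2 := hA (X i) _ _ (isInitial_le X b _ i) (isInitial_univ X b _)
  have h3 := hA (X i) _ _ (isInitial_univ X b _) (isInitial_empty X b _)
  have h4 := hA (X i) _ _ (isInitial_empty X b _) (isInitial_univ X b _)
  have h5 := hA (X i) _ _ (isInitial_lt X b _ j) (isInitial_empty X b _)
  have h6 := hA (X i) _ _ (isInitial_empty X b _) (isInitial_lt X b _ j)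
  have h7 := hA (X i) _ _ (isInitial_lt X b _ j) (isInitial_le X b _ i)
  have h8 := hA (X i) _ _ (isInitial_le X b _ i) (isInitial_lt X b _ j)
  simp only [Finset.filter_empty, Finset.sum_empty, sub_zero, zero_sub] at h3 h4 h5 h6
  rw [eL] at h1 h2 h7 h8
  rw [eR] at h1 h2 h3 h4 ⊢
  -- The net charges `b i`, `P` and `b j + P` of three initial segments are pitted against each
  -- other and against `0`, except for the pair `P`, `b j + P`; differences of at most one leave
  -- only the claimed total.
  set P := ∑ l ∈ Finset.univ.filter (· < j) with X l = X i, (b l : ℤ)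
  revert hi hj h1 h2 h3 h4 h7 h8
  rcases b i with _ | _ | _ <;> rcases b j with _ | _ | _ <;> simp <;> omega

/-- The outermost charges of an alternating cluster attract each other. -/
lemma Alternating.internalForce_sub_le {f : ℝ → ℝ} (hf : Repulsive f)
    {X x : Fin n → ℝ} {b : Fin n → SignType}
    (hA : Alternating X b) (hx : (x, b) ∈ stateSpace n)
    {i j : Fin n} (hij : i < j) (hX : X i = X j) (hi : b i ≠ 0) (hj : b j ≠ 0)
    (hmin : ∀ k, k < i → X k = X i → b k = 0) (hmax : ∀ k, j < k → X k = X j → b k = 0)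
    {M : ℝ} (hM0 : 0 ≤ M) (hM1 : M ≤ f (x j - x i))
    (hM2 : M ≤ -((x j - x i) * deriv f (x j - x i))) :
    internalForce X f x b j - internalForce X f x b i ≤ -M := by
  classical
  set R := x j - x i with hR
  have hRpos : 0 < R := by linarith [charged_lt hx hij hi hj]
  have hle : ∀ k, b k ≠ 0 → X k = X i → x i ≤ x k ∧ x k ≤ x j := fun k hk hXk => by
    constructor
    · rcases lt_trichotomy k i with h | rfl | h
      · exact absurd (hmin k h hXk) hk
      · exact le_rfl
      · exact (charged_lt hx h hi hk).le
    · rcases lt_trichotomy k j with h | rfl | h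
      · exact (charged_lt hx h hk hj).le
      · exact le_rfl
      · exact absurd (hmax k h (hXk.trans hX)) hk
  -- a lower affine bound `κ - ℓ u` for `f` on `(0, R]`
  have main : ∀ κ ℓ : ℝ, (∀ u v, 0 < u → u ≤ v → v ≤ R →
      f v - (κ - ℓ * v) ≤ f u - (κ - ℓ * u)) → (∀ u, 0 < u → u ≤ R → 0 ≤ f u - (κ - ℓ * u)) →
      internalForce X f x b j - internalForce X f x b i ≤
        ∑ k with X k = X i, ((b j : ℝ) * b k * (κ - ℓ * (x j - x k)) +
          (b i : ℝ) * b k * (κ - ℓ * (x k - x i))) - 2 * κ := by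
    intro κ ℓ h1 h2
    -- Here `f` minus the affine function has a nonpositive sum. The affine part is then summed over
    -- the whole cluster, and `2 * κ` removes the two self-interactions at distance zero.
    have r1 := hA.sum_rightmost_nonpos hx hj hmax (φ := fun u => f u - (κ - ℓ * u)) (R := R) h1 h2
      (fun k hk hXk => by linarith [(hle k hk (hXk.trans hX.symm)).1])
    have r2 := hA.sum_leftmost_nonpos hx hi hmin (φ := fun u => f u - (κ - ℓ * u)) (R := R) h1 h2
      (fun k hk hXk => by linarith [(hle k hk hXk).2])
    have split : ∀ m, X m = X i → ∀ F : Fin n → ℝ, ∑ k with X k = X i, F k =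
        F m + ∑ k with X k = X m ∧ k ≠ m, F k := fun m hm F => by
      rw [← Finset.add_sum_erase _ _ (show m ∈ Finset.univ.filter (fun l => X l = X i) by
        simp [hm])]
      congr 2
      ext l
      simp only [Finset.mem_erase, Finset.mem_filter, Finset.mem_univ, true_and, hm]
      tauto
    rw [Finset.sum_add_distrib, split j hX.symm (fun k => (b j : ℝ) * b k * (κ - ℓ * (x j - x k))),
      split i rfl (fun k => (b i : ℝ) * b k * (κ - ℓ * (x k - x i))), internalForce_eq_neg hf X x b i]
    simp only [internalForce, mul_sub, Finset.sum_sub_distrib, sub_self, mul_zero, neg_sub,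
      signType_mul_self hi, signType_mul_self hj] at r1 r2 ⊢
    linarith
  have hN := hA.net_charge hX hi hj hmin hmax
  have hN' : ∑ k with X k = X i, (b k : ℝ) = if b i = b j then (b i : ℝ) else 0 := by
    have : ((∑ k with X k = X i, (b k : ℤ) : ℤ) : ℝ) = if b i = b j then (b i : ℝ) else 0 := by
      rw [hN]; split_ifs <;> simp
    rw [← this]; push_cast; rfl
  -- If the outermost signs agree, the net charge is `b i`, and the tangent at `R` leaves exactly `R
  -- * deriv f R`. If they differ, the net charge is zero, and the constant `f R` leaves `-2 * f R`.
  by_cases hb : b i = b j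
  · rw [if_pos hb] at hN'
    refine (main (f R - deriv f R * R) (-deriv f R) (fun u v hu huv hv => ?_)
      (fun u hu huR => ?_)).trans ?_
    · linarith [hf.tangent_le hu huv hv]
    · linarith [hf.tangent_le hu huR le_rfl]
    · have e : ∀ k, (b j : ℝ) * b k * ((f R - deriv f R * R) - -deriv f R * (x j - x k)) +
          (b i : ℝ) * b k * ((f R - deriv f R * R) - -deriv f R * (x k - x i)) =
          (b i : ℝ) * (2 * (f R - deriv f R * R) + deriv f R * R) * b k := fun k => by
        rw [← hb, hR]; ring
      rw [Finset.sum_congr rfl fun k _ => e k, ← Finset.mul_sum, hN']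
      have := signType_mul_self hi
      nlinarith
  · rw [if_neg hb] at hN'
    refine (main (f R) 0 (fun u v hu huv hv => ?_) (fun u hu huR => ?_)).trans ?_
    · linarith [hf.le_of_le hu huv]
    · linarith [hf.le_of_le hu huR]
    · have e : ∀ k, (b j : ℝ) * b k * (f R - 0 * (x j - x k)) +
          (b i : ℝ) * b k * (f R - 0 * (x k - x i)) = ((b j : ℝ) + b i) * f R * b k := fun k => by ring
      rw [Finset.sum_congr rfl fun k _ => e k, ← Finset.mul_sum, hN']
      linarith

/-! ### Collapse of alternating clusters -/

lemma one_div_mul_le {n : ℕ} (i : Fin n) {F r : ℝ} (h : F ≤ n * r) : 1 / (n : ℝ) * F ≤ r := by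
  have : (0 : ℝ) < n := by exact_mod_cast i.pos
  rwa [one_div, inv_mul_le_iff₀ this]

lemma abs_charge_mul_le (s : SignType) {u G : ℝ} (h : |u| ≤ G) : |(s : ℝ) * u| ≤ G := by
  rw [abs_mul]
  calc _ ≤ 1 * G := mul_le_mul (abs_signType_le s) h (abs_nonneg _) zero_le_one
    _ = G := one_mul G

lemma exists_separation (X : Fin n → ℝ) : ∃ ρ > 0, ∀ i j, X i ≠ X j → 4 * ρ ≤ |X i - X j| := by
  classical
  obtain ⟨c, hc, hle⟩ := exists_pos_le
    (φ := fun k : Fin n × Fin n => if X k.1 ≠ X k.2 then |X k.1 - X k.2| else 1) fun k => by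
      split_ifs with hk
      · exact abs_pos.2 (sub_ne_zero.2 hk)
      · exact one_pos
  refine ⟨c / 4, by linarith, fun i j hij => ?_⟩
  have := hle (i, j)
  simp only [ne_eq, hij, not_false_eq_true, if_true] at this
  linarith

/-- As long as particles of different clusters do not touch, every annihilation takes place inside a
cluster, so alternation and the net charges of the clusters are inherited. -/
lemma Sol.alternating_of_tube {f g : ℝ → ℝ} {p q : ℝ} {x : ℝ → Fin n → ℝ}
    {b : ℝ → Fin n → SignType} (h : Sol f g p q x b) {X : Fin n → ℝ}
    (hX : ∀ t ∈ Icc p q, ∀ i j, x t i = x t j → X i = X j) (hA : Alternating X (b p)) :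
    ∀ t ∈ Icc p q, Alternating X (b t) ∧
      ∀ y, ∑ i with X i = y, (b t i : ℤ) = ∑ i with X i = y, (b p i : ℤ) := by
  refine icc_induction ⟨hA, fun _ => rfl⟩ (fun t ht hP => ?_) (fun t ht hP => ?_)
  · filter_upwards [h.right t ht] with s hs
    rw [hs]; exact hP t ⟨ht.1, le_rfl⟩
  · obtain ⟨β, hβ, h1, h2⟩ := h.left t ht
    obtain ⟨u, hu, hut⟩ := ((hasLeftLimit_iff.1 hβ).and (eventually_nhdsLT_mem_Ico ht.1)).exists
    obtain ⟨h3, h4⟩ := hP u hut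
    rw [hu] at h3 h4
    have ht' : t ∈ Icc p q := ⟨ht.1.le, ht.2⟩
    refine ⟨h3.annihilate h2 (fun i j hij hi hj => h.left_le ht hβ hij hi hj) (h.mem t ht')
      (hX t ht'), fun y => ?_⟩
    rw [← h4 y]
    refine sum_eq_of_fibers h2 fun i hi j hij => ?_
    simp only [Finset.mem_filter, Finset.mem_univ, true_and] at hi ⊢
    rw [← hi]; exact hX t ht' j i hij

/-- Charges which are close to an alternating configuration stay close to it for a short time, in
which each cluster is reduced to at most one charge. -/
theorem collapse {f g : ℝ → ℝ} (hf : Repulsive f) (hg : Continuous g) {X : Fin n → ℝ}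
    {β : Fin n → SignType} (hA : Alternating X β) {ε : ℝ} (hε : 0 < ε) :
    ∃ η > 0, ∃ h > 0, h ≤ ε ∧ ∀ (g' : ℝ → ℝ) (s e : ℝ) (x : ℝ → Fin n → ℝ)
      (b : ℝ → Fin n → SignType), (∀ u, |g' u - g u| ≤ 1) → Sol f g' s e x b → s ≤ e → e ≤ s + h →
      (∀ i, |x s i - X i| ≤ η) → b s = β →
      (∀ t ∈ Icc s e, ∀ i, |x t i - X i| ≤ ε) ∧
      (∀ t ∈ Icc s e, ∀ y, ∑ i with X i = y, (b t i : ℤ) = ∑ i with X i = y, (β i : ℤ)) ∧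
      (e = s + h → ∀ i j, X i = X j → b e i ≠ 0 → b e j ≠ 0 → i = j) := by
  obtain ⟨ρ₀, hρ₀, hsep₀⟩ := exists_separation X
  set ρ := min ρ₀ ε with hρdef
  have hρ : 0 < ρ := lt_min hρ₀ hε
  have hsep : ∀ i j, X i ≠ X j → 4 * ρ ≤ |X i - X j| := fun i j hij =>
    le_trans (by linarith [min_le_left ρ₀ ε]) (hsep₀ i j hij)
  set L := ∑ i, |X i| + ρ with hL
  obtain ⟨G₀, hG₀⟩ := (isCompact_Icc (a := -L) (b := L)).exists_bound_of_continuousOn hg.continuousOn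
  have hG : ∀ (g' : ℝ → ℝ), (∀ u, |g' u - g u| ≤ 1) → ∀ u i, |u - X i| ≤ ρ → |g' u| ≤ |G₀| + 1 := by
    intro g' hg' u i hu
    have h1 : |X i| ≤ ∑ i, |X i| :=
      Finset.single_le_sum (f := fun i => |X i|) (fun _ _ => abs_nonneg _) (Finset.mem_univ i)
    have h2 : |u| ≤ L := by
      have := abs_add_le (u - X i) (X i)
      rw [sub_add_cancel] at this; linarith
    have h3 := hG₀ u (abs_le.1 h2)
    rw [Real.norm_eq_abs] at h3
    have h4 := abs_add_le (g' u - g u) (g u)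
    rw [sub_add_cancel] at h4
    linarith [hg' u, le_abs_self G₀]
  set G := |G₀| + 1
  have hGpos : 0 < G := by positivity
  -- `V` bounds the speed caused by the other clusters and by `g'`. With attraction at least `M`,
  -- the diameter of a cluster shrinks at speed at least `2` in spite of it.
  set V := f (2 * ρ) + G with hV
  have hfρ : 0 ≤ f (2 * ρ) := hf.nonneg _ (by linarith)
  have hVpos : 0 < V := by linarith
  set M := (n : ℝ) * (2 * V + 2) with hM
  obtain ⟨r₁, hr₁, hM1⟩ := hf.exists_le M
  obtain ⟨r₂, hr₂, hM2⟩ := hf.exists_le_neg_mul_deriv M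
  -- The initial diameters are at most `2 * η`, in the range where `f R` and `-R * f'(R)` exceed
  -- `M`. The bound `ρ / (3 + 2 * V)` keeps the tube of radius `η + (V + 1) * (t - s)` inside radius
  -- `ρ` for the duration `2 * η`.
  set η := min (min (r₁ / 2) (r₂ / 2)) (min (ρ / (3 + 2 * V)) (ε / 2)) with hη
  have hηpos : 0 < η := by positivity
  have hη1 : η ≤ r₁ / 2 := (min_le_left _ _).trans (min_le_left _ _)
  have hη2 : η ≤ r₂ / 2 := (min_le_left _ _).trans (min_le_right _ _)
  have hη3 : η * (3 + 2 * V) ≤ ρ := by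
    rw [← le_div_iff₀ (by linarith)]; exact (min_le_right _ _).trans (min_le_left _ _)
  have hη4 : η ≤ ε / 2 := (min_le_right _ _).trans (min_le_right _ _)
  refine ⟨η, hηpos, 2 * η, by linarith, by linarith, ?_⟩
  intro g' s e x b hg' h hse he h0 hb0
  have hrad : ∀ t ∈ Icc s e, η + (V + 1) * (t - s) ≤ ρ := fun t ht => by
    have : (V + 1) * (t - s) ≤ (V + 1) * (2 * η) :=
      mul_le_mul_of_nonneg_left (by linarith [ht.2]) (by linarith)
    nlinarith
  -- consequences of closeness
  have close : ∀ t ∈ Icc s e, (∀ u ∈ Icc s t, ∀ i, |x u i - X i| ≤ ρ) →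
      Alternating X (b t) ∧ (∀ y, ∑ i with X i = y, (b t i : ℤ) = ∑ i with X i = y, (β i : ℤ)) ∧
      (∀ i, |force f (x t) (b t) i - internalForce X f (x t) (b t) i| ≤ n * f (2 * ρ)) ∧
      (∀ i, |(b t i : ℝ) * g' (x t i)| ≤ G) := by
    intro t ht hP
    have htt : t ∈ Icc s t := ⟨ht.1, le_rfl⟩
    obtain ⟨h1, h2⟩ := (h.mono le_rfl ht.2).alternating_of_tube (X := X) (fun u hu i j hij => by
      by_contra hne
      have h1 := hsep i j hne
      have h2 := abs_sub_le (X i) (x u i) (X j)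
      rw [abs_sub_comm (X i) (x u i)] at h2
      have h3 := hP u hu i
      have h4 := hP u hu j
      rw [← hij] at h4
      linarith) (hb0 ▸ hA) t htt
    refine ⟨h1, hb0 ▸ h2, fun i => ?_, fun i => abs_charge_mul_le _ (hG g' hg' _ i (hP t htt i))⟩
    refine abs_force_sub_internalForce_le hf (by linarith) fun k hk => ?_
    have h1 := hsep k i hk
    have h2 := abs_sub_le (X k) (x t k) (X i)
    have h3 := abs_sub_le (x t k) (x t i) (X i)
    rw [abs_sub_comm (X k) (x t k)] at h2
    rw [abs_sub_comm (x t k) (x t i)] at h3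
    linarith [hP t htt i, hP t htt k]
  have hB : ∀ t, HasDerivAt (fun t => η + (V + 1) * (t - s)) (V + 1) t := fun t => by
    simpa using (((hasDerivAt_id t).sub_const s).const_mul (V + 1)).const_add η
  have tube : ∀ t ∈ Icc s e, ∀ k : Fin n ⊕ Fin n, True → 0 ≤ (k.elim
      (fun i t => η + (V + 1) * (t - s) - (x t i - X i))
      (fun i t => η + (V + 1) * (t - s) + (x t i - X i)) : ℝ → ℝ) t := by
    refine barrier (fun k => ?_) (fun _ _ _ _ _ _ _ => trivial) (fun k _ => ?_)
      (fun t ht hP k _ hk => ?_)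
    · rcases k with i | i
      · exact ContinuousOn.sub (by fun_prop) ((h.cont_apply i).sub continuousOn_const)
      · exact ContinuousOn.add (by fun_prop) ((h.cont_apply i).sub continuousOn_const)
    · have hi := fun i => abs_le.1 (h0 i)
      rcases k with i | i
      · simp only [Sum.elim_inl, sub_self, mul_zero, add_zero]; linarith [(hi i).2]
      · simp only [Sum.elim_inr, sub_self, mul_zero, add_zero]; linarith [(hi i).1]
    · have ht' : t ∈ Icc s e := ⟨ht.1, ht.2.le⟩
      have hP1 : ∀ u ∈ Icc s t, ∀ i, x u i - X i ≤ η + (V + 1) * (u - s) := fun u hu i => by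
        have := hP u hu (Sum.inl i) trivial
        simp only [Sum.elim_inl] at this; linarith
      have hP2 : ∀ u ∈ Icc s t, ∀ i, -(η + (V + 1) * (u - s)) ≤ x u i - X i := fun u hu i => by
        have := hP u hu (Sum.inr i) trivial
        simp only [Sum.elim_inr] at this; linarith
      have hPu : ∀ u ∈ Icc s t, ∀ i, |x u i - X i| ≤ ρ := fun u hu i => by
        have := hrad u ⟨hu.1, hu.2.trans ht'.2⟩
        exact abs_le.2 ⟨by linarith [hP2 u hu i], by linarith [hP1 u hu i]⟩
      obtain ⟨hAt, -, hext, hgb⟩ := close t ht' hPu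
      have htt : t ∈ Icc s t := ⟨ht.1, le_rfl⟩
      have hmem := h.mem t ht'
      rcases k with i | i
      · simp only [Sum.elim_inl] at hk
        refine ⟨V + 1 - velocity f g' (x t) (b t) i, ?_,
          ((hB t).hasDerivWithinAt).sub ((h.deriv_apply ht i).sub_const _)⟩
        by_cases hi : b t i = 0
        · rw [velocity_of_neutral hi]; linarith
        -- A charge on the boundary of the tube is outermost in its cluster, as a charge beyond it
        -- would be outside the tube. Its cluster pulls it inward, and the tube widens faster than
        -- `V`.
        have h1 : internalForce X f (x t) (b t) i ≤ 0 :=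
          hAt.internalForce_rightmost_nonpos hf hmem fun j hij hX => by
            by_contra hj
            have := charged_lt hmem hij hi hj
            linarith [hP1 t htt j]
        have h2 := one_div_mul_le i (by linarith [(abs_le.1 (hext i)).2] :
          force f (x t) (b t) i ≤ n * f (2 * ρ))
        rw [velocity_eq hf]
        linarith [(abs_le.1 (hgb i)).2]
      · simp only [Sum.elim_inr] at hk
        refine ⟨V + 1 + velocity f g' (x t) (b t) i, ?_,
          ((hB t).hasDerivWithinAt).add ((h.deriv_apply ht i).sub_const _)⟩
        by_cases hi : b t i = 0
        · rw [velocity_of_neutral hi]; linarith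
        have h1 : 0 ≤ internalForce X f (x t) (b t) i :=
          hAt.internalForce_leftmost_nonneg hf hmem fun j hij hX => by
            by_contra hj
            have := charged_lt hmem hij hj hi
            linarith [hP2 t htt j]
        have h2 := one_div_mul_le i (by linarith [(abs_le.1 (hext i)).1] :
          -force f (x t) (b t) i ≤ n * f (2 * ρ))
        rw [velocity_eq hf]
        linarith [(abs_le.1 (hgb i)).1]
  have hPe : ∀ u ∈ Icc s e, ∀ i, |x u i - X i| ≤ ρ := fun u hu i => by
    have h1 := tube u hu (Sum.inl i) trivial
    have h2 := tube u hu (Sum.inr i) trivial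
    simp only [Sum.elim_inl, Sum.elim_inr] at h1 h2
    have := hrad u hu
    exact abs_le.2 ⟨by linarith, by linarith⟩
  have close' := fun t (ht : t ∈ Icc s e) =>
    close t ht fun u hu => hPe u ⟨hu.1, hu.2.trans ht.2⟩
  refine ⟨fun t ht i => (hPe t ht i).trans (min_le_right _ _), fun t ht => (close' t ht).2.1, ?_⟩
  have hC : ∀ t, HasDerivAt (fun t => 2 * η - (t - s)) (-1) t := fun t => by
    simpa using ((hasDerivAt_id t).sub_const s).const_sub (2 * η)
  -- Distances of charges in the same cluster stay below `2 * η - (t - s)`, which vanishes at `s + 2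
  -- * η`. A pair realizing the bound consists of the outermost charges of its cluster, since a
  -- wider pair would violate it.
  have shrink := barrier (p := s) (q := e)
    (φ := fun (k : Fin n × Fin n) t => 2 * η - (t - s) - (x t k.2 - x t k.1))
    (Act := fun t k => X k.1 = X k.2 ∧ k.1 < k.2 ∧ b t k.1 ≠ 0 ∧ b t k.2 ≠ 0)
    (fun k => ContinuousOn.sub (by fun_prop) ((h.cont_apply k.2).sub (h.cont_apply k.1)))
    (fun k u t hu hut ht ⟨h1, h2, h3, h4⟩ =>
      ⟨h1, h2, h.charged_before hu hut ht h3, h.charged_before hu hut ht h4⟩)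
    (fun k ⟨h1, _⟩ => by
      have h2 := abs_le.1 (h0 k.1)
      have h3 := abs_le.1 (h0 k.2)
      simp only [sub_self]
      linarith)
    (fun t ht hP k ⟨hX, hlt, hi, hj⟩ hk => by
      have ht' : t ∈ Icc s e := ⟨ht.1, ht.2.le⟩
      have hmem := h.mem t ht'
      obtain ⟨hAt, -, hext, hgb⟩ := close' t ht'
      refine ⟨-1 - (velocity f g' (x t) (b t) k.2 - velocity f g' (x t) (b t) k.1), ?_,
        ((hC t).hasDerivWithinAt).sub ((h.deriv_apply ht k.2).sub (h.deriv_apply ht k.1))⟩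
      have hP' : ∀ i j, X i = X j → i < j → b t i ≠ 0 → b t j ≠ 0 →
          x t j - x t i ≤ x t k.2 - x t k.1 := fun i j h1 h2 h3 h4 => by
        have := hP t ⟨ht.1, le_rfl⟩ (i, j) ⟨h1, h2, h3, h4⟩
        simp only at this; linarith
      have hdist : x t k.2 - x t k.1 ≤ 2 * η := by linarith [ht.1]
      have hdpos := charged_lt hmem hlt hi hj
      have h1 := hAt.internalForce_sub_le hf hmem hlt hX hi hj
        (fun l hl hXl => by
          by_contra hbl
          have := hP' l k.2 (hXl.trans hX) (hl.trans hlt) hbl hj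
          linarith [charged_lt hmem hl hbl hi])
        (fun l hl hXl => by
          by_contra hbl
          have := hP' k.1 l (hX.trans hXl.symm) (hlt.trans hl) hi hbl
          linarith [charged_lt hmem hl hj hbl])
        (M := M) (by positivity) (hM1 _ (by linarith) (by linarith))
        (hM2 _ (by linarith) (by linarith))
      have h2 := one_div_mul_le k.1 (by
        linarith [(abs_le.1 (hext k.1)).1, (abs_le.1 (hext k.2)).2] :
        force f (x t) (b t) k.2 - force f (x t) (b t) k.1 ≤ n * (2 * f (2 * ρ) - (2 * V + 2)))
      rw [velocity_eq hf, velocity_eq hf]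
      linarith [(abs_le.1 (hgb k.1)).1, (abs_le.1 (hgb k.2)).2])
  have hpair : e = s + 2 * η → ∀ i j, X i = X j → b e i ≠ 0 → b e j ≠ 0 → ¬ i < j :=
    fun hee i j hX hi hj hlt => by
      have h1 := shrink e ⟨hse, le_rfl⟩ (i, j) ⟨hX, hlt, hi, hj⟩
      simp only at h1
      linarith [charged_lt (h.mem e ⟨hse, le_rfl⟩) hlt hi hj]
  intro hee i j hX hi hj
  exact le_antisymm (not_lt.1 (hpair hee j i hX.symm hj hi)) (not_lt.1 (hpair hee i j hX hi hj))

/-! ### Continuous dependence between collisions -/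

/-- Configurations in which the charges are ordered with gaps of size at least `c`. -/
def gapped (c : ℝ) (b : Fin n → SignType) : Set (Fin n → ℝ) :=
  {y | ∀ i j, i < j → b i ≠ 0 → b j ≠ 0 → c ≤ y j - y i}

lemma exists_lipschitzOnWith_velocity {f g : ℝ → ℝ} (hf : Repulsive f) {K : NNReal}
    (hg : LipschitzWith K g) (b : Fin n → SignType) {c : ℝ} (hc : 0 < c) :
    ∃ L : NNReal, 1 ≤ L ∧ LipschitzOnWith L (fun y => velocity f g y b) (gapped c b) := by
  obtain ⟨K', hK', hlip⟩ := hf.exists_lipschitz hc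
  -- The summand `1` ensures `1 ≤ L`, so that divisions by `L` in Grönwall's bound are harmless.
  obtain ⟨L, hL⟩ : ∃ L : NNReal, (L : ℝ) = 2 * K' + K + 1 :=
    ⟨⟨2 * K' + K + 1, by positivity⟩, rfl⟩
  refine ⟨L, ?_, LipschitzOnWith.of_dist_le_mul fun y hy z hz => ?_⟩
  · rw [← NNReal.coe_le_coe, hL, NNReal.coe_one]
    linarith [K.coe_nonneg]
  rw [hL]
  refine (dist_pi_le_iff (by positivity)).2 fun i => ?_
  have hcoord : ∀ j, |y j - z j| ≤ dist y z := fun j => by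
    rw [← Real.dist_eq]; exact dist_le_pi_dist y z j
  have hterm : ∀ j, |(b i : ℝ) * b j * f (y i - y j) - (b i : ℝ) * b j * f (z i - z j)| ≤
      2 * K' * dist y z := by
    intro j
    have hnn : 0 ≤ 2 * K' * dist y z := by positivity
    by_cases hb : b i = 0 ∨ b j = 0
    · rcases hb with hb | hb <;> simpa [hb] using hnn
    push Not at hb
    rw [← mul_sub, abs_mul]
    have h1 : |(b i : ℝ) * b j| ≤ 1 := by
      rw [abs_mul]; exact mul_le_one₀ (abs_signType_le _) (abs_nonneg _) (abs_signType_le _)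
    have h2 : |f (y i - y j) - f (z i - z j)| ≤ 2 * K' * dist y z := by
      have tri : ∀ k l, |y k - y l - (z k - z l)| ≤ 2 * dist y z := fun k l => by
        have := abs_sub (y k - z k) (y l - z l)
        rw [show y k - z k - (y l - z l) = y k - y l - (z k - z l) by ring] at this
        linarith [hcoord k, hcoord l]
      rcases lt_trichotomy i j with h | rfl | h
      · rw [hf.map_sub_comm (y i), hf.map_sub_comm (z i), neg_sub_neg, abs_sub_comm]
        refine (hlip _ _ (hy i j h hb.1 hb.2) (hz i j h hb.1 hb.2)).trans ?_
        nlinarith [tri j i]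
      · simpa using hnn
      · refine (hlip _ _ (hy j i h hb.2 hb.1) (hz j i h hb.2 hb.1)).trans ?_
        nlinarith [tri i j]
    calc _ ≤ 1 * (2 * K' * dist y z) := mul_le_mul h1 h2 (abs_nonneg _) zero_le_one
      _ = _ := one_mul _
  rw [Real.dist_eq, velocity_eq hf, velocity_eq hf]
  have h1 : |force f y b i - force f z b i| ≤ n * (2 * K' * dist y z) := by
    rw [force, force, ← Finset.sum_sub_distrib]
    refine (Finset.abs_sum_le_sum_abs _ _).trans
      ((Finset.sum_le_card_nsmul _ _ _ fun j _ => hterm j).trans ?_)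
    simp
  have h2 : |(b i : ℝ) * (g (y i) - g (z i))| ≤ K * dist y z := by
    refine abs_charge_mul_le _ ?_
    rw [← Real.dist_eq]
    exact (hg.dist_le_mul _ _).trans (mul_le_mul_of_nonneg_left (dist_le_pi_dist y z i) K.coe_nonneg)
  have h3 : |1 / (n : ℝ) * (force f y b i - force f z b i)| ≤ 2 * K' * dist y z := by
    rw [abs_mul, abs_of_nonneg (by positivity)]
    exact one_div_mul_le i h1
  have h4 := abs_add_le (1 / (n : ℝ) * (force f y b i - force f z b i))
    ((b i : ℝ) * (g (y i) - g (z i)))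
  have h5 : 0 ≤ dist y z := dist_nonneg
  calc _ = |1 / (n : ℝ) * (force f y b i - force f z b i) + (b i : ℝ) * (g (y i) - g (z i))| := by
        congr 1; ring
    _ ≤ _ := h4
    _ ≤ _ := by linarith

lemma Sol.exists_gapped {f g : ℝ → ℝ} {p q : ℝ} {x : ℝ → Fin n → ℝ}
    {b : ℝ → Fin n → SignType} (h : Sol f g p q x b) {β : Fin n → SignType}
    (hb : ∀ t ∈ Icc p q, b t = β) : ∃ c > 0, ∀ t ∈ Icc p q, x t ∈ gapped c β := by
  rcases lt_or_ge q p with hpq | hpq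
  · exact ⟨1, one_pos, fun t ht => absurd (ht.1.trans ht.2) (not_le.2 hpq)⟩
  classical
  have : ∀ k : Fin n × Fin n, ∃ c > 0, (k.1 < k.2 → β k.1 ≠ 0 → β k.2 ≠ 0 →
      ∀ t ∈ Icc p q, c ≤ x t k.2 - x t k.1) := by
    intro k
    by_cases hk : k.1 < k.2 ∧ β k.1 ≠ 0 ∧ β k.2 ≠ 0
    · obtain ⟨t, ht, hmin⟩ := isCompact_Icc.exists_isMinOn ⟨p, le_rfl, hpq⟩
        ((h.cont_apply k.2).sub (h.cont_apply k.1))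
      exact ⟨x t k.2 - x t k.1, sub_pos.2 (charged_lt (h.mem t ht) hk.1 (hb t ht ▸ hk.2.1)
        (hb t ht ▸ hk.2.2)), fun _ _ _ s hs => hmin hs⟩
    · exact ⟨1, one_pos, fun h1 h2 h3 => absurd ⟨h1, h2, h3⟩ hk⟩
  choose C hC hle using this
  obtain ⟨c, hc, hcC⟩ := exists_pos_le hC
  exact ⟨c, hc, fun t ht i j hij hi hj => (hcC (i, j)).trans (hle (i, j) hij hi hj t ht)⟩

/-- While the charges of a solution are constant, solutions which start nearby stay nearby and
keep their charges. -/
theorem Sol.continuous_dependence {f g : ℝ → ℝ} (hf : Repulsive f) {K : NNReal}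
    (hg : LipschitzWith K g) {p q : ℝ} {x : ℝ → Fin n → ℝ} {b : ℝ → Fin n → SignType}
    (h : Sol f g p q x b) {β : Fin n → SignType} (hb : ∀ t ∈ Icc p q, b t = β) {ε : ℝ}
    (hε : 0 < ε) :
    ∃ η > 0, ∀ s ∈ Icc p q, ∀ (g' : ℝ → ℝ) (x' : ℝ → Fin n → ℝ) (b' : ℝ → Fin n → SignType),
      (∀ u, |g' u - g u| ≤ η) → Sol f g' s q x' b' → (∀ i, |x' s i - x s i| ≤ η) → b' s = β →
      ∀ t ∈ Icc s q, (∀ i, |x' t i - x t i| ≤ ε) ∧ b' t = β := by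
  obtain ⟨c, hc, hgap⟩ := h.exists_gapped hb
  obtain ⟨L, hL1, hL⟩ := exists_lipschitzOnWith_velocity hf hg β (by linarith : 0 < c / 2)
  -- A displacement of each particle by `c / 4` leaves gaps of size `c / 2`, where the velocity is
  -- Lipschitz.
  set ε' := min ε (c / 4) with hε'
  have hε'0 : 0 < ε' := lt_min hε (by linarith)
  set E := Real.exp (L * (q - p)) with hE
  have hE0 : 0 < E := Real.exp_pos _
  -- Grönwall's bound is at most `2 * η * E = ε' / 2`, strictly inside the tolerance, so the
  -- estimate can be continued. The choice does not depend on the starting time `s`.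
  refine ⟨ε' / (4 * E), by positivity, fun s hs g' x' b' hg' h' hx' hb' => ?_⟩
  have hE1 : 1 ≤ E := Real.one_le_exp (mul_nonneg L.coe_nonneg (by linarith [hs.1, hs.2]))
  set η := ε' / (4 * E) with hη
  have hη0 : 0 < η := by positivity
  have hηE : η * E = ε' / 4 := by rw [hη]; field_simp
  have hηε : η ≤ ε' / 4 := by nlinarith
  suffices hP : ∀ t ∈ Icc s q, (∀ i, |x' t i - x t i| ≤ ε') ∧ b' t = β from
    fun t ht => ⟨fun i => ((hP t ht).1 i).trans (min_le_left _ _), (hP t ht).2⟩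
  refine icc_induction ⟨fun i => (hx' i).trans (by linarith), hb'⟩ (fun t ht hP => ?_)
    (fun t ht hP => ?_)
  · have htpq : t ∈ Ico p q := ⟨hs.1.trans ht.1, ht.2⟩
    have hgr := dist_le_of_approx_trajectories_ODE_of_mem (K := L) (a := s) (b := t) (f := x')
      (g := x) (v := fun _ y => velocity f g y β) (s := fun _ => gapped (c / 2) β)
      (f' := fun u => velocity f g' (x' u) (b' u)) (g' := fun u => velocity f g (x u) (b u))
      (εf := η) (εg := 0) (δ := η) (fun _ _ => hL)
      (h'.cont.mono (Icc_subset_Icc_right ht.2.le))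
      (fun u hu => h'.deriv u ⟨hu.1, hu.2.trans ht.2⟩)
      (fun u hu => by
        rw [(hP u ⟨hu.1, hu.2.le⟩).2]
        refine (dist_pi_le_iff hη0.le).2 fun i => ?_
        rw [Real.dist_eq, velocity_eq hf, velocity_eq hf, add_sub_add_left_eq_sub, ← mul_sub]
        exact abs_charge_mul_le _ (hg' _))
      (fun u hu i j hij hi hj => by
        have h1 := hgap u ⟨hs.1.trans hu.1, hu.2.le.trans ht.2.le⟩ i j hij hi hj
        have h2 := abs_le.1 ((hP u ⟨hu.1, hu.2.le⟩).1 i)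
        have h3 := abs_le.1 ((hP u ⟨hu.1, hu.2.le⟩).1 j)
        linarith [min_le_right ε (c / 4), h2.2, h3.1])
      (h.cont.mono (Icc_subset_Icc hs.1 ht.2.le))
      (fun u hu => h.deriv u ⟨hs.1.trans hu.1, hu.2.trans ht.2⟩)
      (fun u hu => by rw [hb u ⟨hs.1.trans hu.1, hu.2.le.trans ht.2.le⟩, dist_self])
      (fun u hu i j hij hi hj => by
        have h1 := hgap u ⟨hs.1.trans hu.1, hu.2.le.trans ht.2.le⟩ i j hij hi hj
        linarith)
      ((dist_pi_le_iff hη0.le).2 fun i => by rw [Real.dist_eq]; exact hx' i)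
      t ⟨ht.1, le_rfl⟩
    have hLpos : (0 : ℝ) < L := lt_of_lt_of_le one_pos (by exact_mod_cast hL1)
    rw [gronwallBound_of_K_ne_0 hLpos.ne', add_zero] at hgr
    have hexp : Real.exp (L * (t - s)) ≤ E :=
      Real.exp_le_exp.2 (mul_le_mul_of_nonneg_left (by linarith [hs.1, ht.2]) hLpos.le)
    have h1 : η / L ≤ η := div_le_self hη0.le (by exact_mod_cast hL1)
    have h2 : 1 ≤ Real.exp (L * (t - s)) :=
      Real.one_le_exp (mul_nonneg hLpos.le (by linarith [ht.1]))
    have hbound : dist (x' t) (x t) ≤ ε' / 2 := by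
      have h3 : η / L * (Real.exp (L * (t - s)) - 1) ≤ η * E :=
        mul_le_mul h1 (by linarith) (by linarith) hη0.le
      have h4 : η * Real.exp (L * (t - s)) ≤ η * E := mul_le_mul_of_nonneg_left hexp hη0.le
      linarith
    have hnear : ∀ᶠ u in 𝓝[>] t, ∀ i, |x' u i - x u i| < ε' := by
      rw [eventually_all]
      intro i
      have hc' := ((ContinuousOn.tendsto_nhdsGT (h'.cont_apply i) ht).sub
        (ContinuousOn.tendsto_nhdsGT (h.cont_apply i) htpq)).abs
      refine hc'.eventually (gt_mem_nhds ?_)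
      have := (dist_le_pi_dist (x' t) (x t) i).trans hbound
      rw [Real.dist_eq] at this
      linarith
    filter_upwards [hnear, h'.right t ht] with u hu hu'
    exact ⟨fun i => (hu i).le, hu'.trans (hP t ⟨ht.1, le_rfl⟩).2⟩
  · have htpq : t ∈ Ioc p q := ⟨hs.1.trans_lt ht.1, ht.2⟩
    have hclose : ∀ i, |x' t i - x t i| ≤ ε' := fun i => by
      refine le_of_tendsto ((ContinuousOn.tendsto_nhdsLT (h'.cont_apply i) ht).sub
        (ContinuousOn.tendsto_nhdsLT (h.cont_apply i) htpq)).abs ?_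
      filter_upwards [eventually_nhdsLT_mem_Ico ht.1] with u hu
      exact (hP u hu).1 i
    refine ⟨hclose, ?_⟩
    have hleft : HasLeftLimit b' t β := by
      rw [hasLeftLimit_iff]
      filter_upwards [eventually_nhdsLT_mem_Ico ht.1] with u hu
      exact (hP u hu).2
    -- A change of the charges requires a collision, which is impossible because the gaps are still
    -- bounded below at time `t`.
    by_contra hne
    obtain ⟨i, hi⟩ := Function.ne_iff.1 hne
    obtain ⟨j, hji, hi0, hj0, hxx⟩ := h'.exists_collision ht hleft hi
    have hmin : ε' ≤ c / 4 := min_le_right _ _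
    have key : ∀ k l, k < l → β k ≠ 0 → β l ≠ 0 → x' t k ≠ x' t l := fun k l hkl hk hl heq => by
      have h1 := hgap t ⟨htpq.1.le, htpq.2⟩ k l hkl hk hl
      have h2 := abs_le.1 (hclose k)
      have h3 := abs_le.1 (hclose l)
      linarith [h2.2, h3.1]
    rcases hji.lt_or_gt with h1 | h1
    · exact key j i h1 hj0 hi0 hxx
    · exact key i j h1 hi0 hj0 hxx.symm

/-! ### Existence of solutions -/

namespace Sol

variable {f g : ℝ → ℝ} {p q : ℝ} {x x' : ℝ → Fin n → ℝ} {b b' : ℝ → Fin n → SignType}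

lemma congr (h : Sol f g p q x b) (hx : ∀ t ∈ Icc p q, x' t = x t)
    (hb : ∀ t ∈ Icc p q, b' t = b t) : Sol f g p q x' b' where
  cont := h.cont.congr hx
  mem t ht := by rw [hx t ht, hb t ht]; exact h.mem t ht
  right t ht := by
    rw [hb t ⟨ht.1, ht.2.le⟩]
    filter_upwards [h.right t ht, eventually_nhdsGT_mem_Ioc ht.2] with s hs hst
    rw [hb s ⟨ht.1.trans hst.1.le, hst.2⟩, hs]
  left t ht := by
    obtain ⟨β, hβ, h1⟩ := h.left t ht
    rw [hb t ⟨ht.1.le, ht.2⟩, hx t ⟨ht.1.le, ht.2⟩]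
    refine ⟨β, ?_, h1⟩
    rw [hasLeftLimit_iff] at hβ ⊢
    filter_upwards [hβ, eventually_nhdsLT_mem_Ico ht.1] with s hs hst
    rw [hb s ⟨hst.1, hst.2.le.trans ht.2⟩, hs]
  deriv t ht := by
    have htt : t ∈ Icc p q := ⟨ht.1, ht.2.le⟩
    rw [hb t htt, hx t htt]
    refine (h.deriv t ht).congr_of_eventuallyEq ?_ (hx t htt)
    filter_upwards [Icc_mem_nhdsGE ht.2] with s hs
    exact hx s ⟨ht.1.trans hs.1, hs.2⟩

/-- A solution on `[p, τ)` with a limit at `τ`. -/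
lemma extend {τ : ℝ} (hp : p < τ) (h : ∀ s ∈ Ico p τ, Sol f g p s x b)
    (hlim : Tendsto x (𝓝[<] τ) (𝓝 (x τ))) (hmem : (x τ, b τ) ∈ stateSpace n)
    (hleft : ∃ β, HasLeftLimit b τ β ∧ (∀ i, b τ i = β i ∨ b τ i = 0) ∧
      ∀ y, ∑ i with x τ i = y, (b τ i : ℤ) = ∑ i with x τ i = y, (β i : ℤ)) :
    Sol f g p τ x b where
  cont t ht := by
    rcases ht.2.eq_or_lt with rfl | htτ
    · have h1 : ContinuousWithinAt x (Iio t) t := hlim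
      refine (h1.union continuousWithinAt_singleton).mono fun s hs => ?_
      rcases hs.2.eq_or_lt with h' | h'
      · exact Or.inr h'
      · exact Or.inl h'
    · obtain ⟨s, hts, hsτ⟩ := exists_between htτ
      have := (h s ⟨ht.1.trans hts.le, hsτ⟩).cont t ⟨ht.1, hts.le⟩
      refine this.mono_of_mem_nhdsWithin ?_
      filter_upwards [nhdsWithin_le_nhds (Iio_mem_nhds hts), self_mem_nhdsWithin] with u hu hu'
      exact ⟨hu'.1, (mem_Iio.1 hu).le⟩
  mem t ht := by
    rcases ht.2.eq_or_lt with rfl | htτ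
    · exact hmem
    · exact (h t ⟨ht.1, htτ⟩).mem t ⟨ht.1, le_rfl⟩
  right t ht := by
    obtain ⟨s, hts, hsτ⟩ := exists_between ht.2
    exact (h s ⟨ht.1.trans hts.le, hsτ⟩).right t ⟨ht.1, hts⟩
  left t ht := by
    rcases ht.2.eq_or_lt with rfl | htτ
    · exact hleft
    · exact (h t ⟨ht.1.le, htτ⟩).left t ⟨ht.1, le_rfl⟩
  deriv t ht := by
    obtain ⟨s, hts, hsτ⟩ := exists_between ht.2
    exact (h s ⟨ht.1.trans hts.le, hsτ⟩).deriv t ⟨ht.1, hts⟩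

lemma unique_of_const (hf : Repulsive f) {K : NNReal} (hg : LipschitzWith K g)
    {β : Fin n → SignType} (h : Sol f g p q x fun _ => β) (h' : Sol f g p q x' fun _ => β)
    (h0 : x' p = x p) : ∀ t ∈ Icc p q, x' t = x t := by
  intro t ht
  funext i
  refine eq_of_abs_sub_nonpos (le_of_forall_pos_le_add fun ε hε => ?_)
  obtain ⟨η, hη, hd⟩ := h.continuous_dependence hf hg (fun _ _ => rfl) hε
  have := (hd p ⟨le_rfl, ht.1.trans ht.2⟩ g x' (fun _ => β) (by simp [hη.le]) h'
    (by simp [h0, hη.le]) rfl t ht).1 i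
  simpa using this

/-- A priori bound on the positions. -/
lemma abs_le_of_sep (hf : Repulsive f) {K : NNReal} (hg : LipschitzWith K g)
    (h : Sol f g p q x b) {c : ℝ} (hc : 0 < c) (hsep : ∀ t ∈ Icc p q, SameSignSep c (x t) (b t))
    {D : ℝ} (hD : 1 + (n + 1) * f c + |g 0| ≤ D) (hxD : ∀ i, |x p i| ≤ D) :
    ∀ t ∈ Icc p q, ∀ i, |x t i| ≤ D * Real.exp ((K + 1) * (t - p)) := by
  -- An outermost charge feels an outward interaction of at most `(n + 1) * f c`, and `g` grows
  -- linearly with slope `K`. The constant terms are absorbed in the additional `1` of the rate,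
  -- because `D ≤ B t`.
  set B : ℝ → ℝ := fun t => D * Real.exp ((K + 1) * (t - p)) with hB
  have hfc := hf.nonneg c hc
  have hD0 : 0 < D := by
    have : 0 ≤ (n + 1) * f c := by positivity
    linarith [abs_nonneg (g 0)]
  have hBd : ∀ t, HasDerivAt B ((K + 1) * B t) t := fun t => by
    have h1 : HasDerivAt (fun t : ℝ => ((K : ℝ) + 1) * (t - p)) (K + 1) t := by
      simpa using ((hasDerivAt_id t).sub_const p).const_mul ((K : ℝ) + 1)
    have := (h1.exp).const_mul D
    rw [show (K + 1) * B t = D * (Real.exp ((K + 1) * (t - p)) * (K + 1)) by simp only [hB]; ring]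
    exact this
  have hBc : ContinuousOn B (Icc p q) := fun t _ => (hBd t).continuousAt.continuousWithinAt
  have hBD : ∀ t ∈ Icc p q, D ≤ B t := fun t ht =>
    le_mul_of_one_le_right hD0.le (Real.one_le_exp
      (mul_nonneg (by linarith [K.coe_nonneg]) (by linarith [ht.1])))
  have hgb : ∀ u, |g u| ≤ |g 0| + K * |u| := fun u => by
    have h1 := hg.dist_le_mul u 0
    rw [Real.dist_eq, Real.dist_eq, sub_zero] at h1
    have h2 := abs_add_le (g u - g 0) (g 0)
    rw [sub_add_cancel] at h2
    linarith
  have hforce : ∀ i : Fin n, ∀ F : ℝ, F ≤ (n + 1) * f c → 1 / (n : ℝ) * F ≤ (n + 1) * f c :=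
    fun i F hF => one_div_mul_le i <| hF.trans <| le_mul_of_one_le_left (by positivity)
      (by exact_mod_cast i.pos)
  have key : ∀ t ∈ Icc p q, ∀ k : Fin n ⊕ Fin n, True → 0 ≤ (k.elim
      (fun i t => B t - x t i) (fun i t => B t + x t i) : ℝ → ℝ) t := by
    refine barrier (fun k => ?_) (fun _ _ _ _ _ _ _ => trivial) (fun k _ => ?_)
      (fun t ht hP k _ hk => ?_)
    · rcases k with i | i
      · exact hBc.sub (h.cont_apply i)
      · exact hBc.add (h.cont_apply i)
    · have hi := fun i => abs_le.1 (hxD i)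
      have hBp : B p = D := by simp [hB]
      rcases k with i | i
      · simp only [Sum.elim_inl, hBp]; linarith [(hi i).2]
      · simp only [Sum.elim_inr, hBp]; linarith [(hi i).1]
    · have ht' : t ∈ Icc p q := ⟨ht.1, ht.2.le⟩
      have hP1 : ∀ i, x t i ≤ B t := fun i => by
        have := hP t ⟨ht.1, le_rfl⟩ (Sum.inl i) trivial
        simp only [Sum.elim_inl] at this; linarith
      have hP2 : ∀ i, -B t ≤ x t i := fun i => by
        have := hP t ⟨ht.1, le_rfl⟩ (Sum.inr i) trivial
        simp only [Sum.elim_inr] at this; linarith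
      have hmem := h.mem t ht'
      have hgi : ∀ i, |(b t i : ℝ) * g (x t i)| ≤ |g 0| + K * B t := fun i =>
        abs_charge_mul_le _ ((hgb _).trans (by
          have := mul_le_mul_of_nonneg_left (abs_le.2 ⟨hP2 i, hP1 i⟩) K.coe_nonneg
          linarith))
      have hDt := hBD t ht'
      have hBpos : 0 < (K + 1) * B t := by nlinarith [K.coe_nonneg]
      rcases k with i | i
      · simp only [Sum.elim_inl] at hk
        refine ⟨(K + 1) * B t - velocity f g (x t) (b t) i, ?_,
          (hBd t).hasDerivWithinAt.sub (h.deriv_apply ht i)⟩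
        by_cases hi : b t i = 0
        · rw [velocity_of_neutral hi]; linarith
        have h1 := hforce i _ ((hsep t ht').force_rightmost_le hf hmem hc (i := i) fun j hij => by
          by_contra hj
          linarith [charged_lt hmem hij hi hj, hP1 j])
        rw [velocity_eq hf]
        linarith [(abs_le.1 (hgi i)).2]
      · simp only [Sum.elim_inr] at hk
        refine ⟨(K + 1) * B t + velocity f g (x t) (b t) i, ?_,
          (hBd t).hasDerivWithinAt.add (h.deriv_apply ht i)⟩
        by_cases hi : b t i = 0
        · rw [velocity_of_neutral hi]; linarith
        have h1 := hforce i (-force f (x t) (b t) i) (by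
          linarith [(hsep t ht').le_force_leftmost hf hmem hc (i := i) fun j hij => by
            by_contra hj
            linarith [charged_lt hmem hij hj hi, hP2 j]])
        rw [velocity_eq hf]
        linarith [(abs_le.1 (hgi i)).1]
  intro t ht i
  have h1 := key t ht (Sum.inl i) trivial
  have h2 := key t ht (Sum.inr i) trivial
  simp only [Sum.elim_inl, Sum.elim_inr] at h1 h2
  exact abs_le.2 ⟨by linarith, by linarith⟩

end Sol

/-- Charges remaining after an annihilation. -/
lemma Alternating.exists_annihilate {X : Fin n → ℝ} {β : Fin n → SignType}
    (hA : Alternating X β) (hX : ∀ i j, i < j → β i ≠ 0 → β j ≠ 0 → X i ≤ X j) :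
    ∃ b : Fin n → SignType, (X, b) ∈ stateSpace n ∧ (∀ i, b i = β i ∨ b i = 0) ∧
      ∀ y, ∑ i with X i = y, (b i : ℤ) = ∑ i with X i = y, (β i : ℤ) := by
  classical
  -- Alternation bounds the net charge of a cluster by one in absolute value. If it is nonzero, some
  -- particle of the cluster has exactly this charge, and this one is kept.
  have hpick : ∀ y, ∑ i with X i = y, (β i : ℤ) ≠ 0 →
      ∃ i, X i = y ∧ (β i : ℤ) = ∑ i with X i = y, (β i : ℤ) := by
    intro y hy
    have h1 := hA y _ _ (isInitial_univ X β _) (isInitial_empty X β _)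
    have h2 := hA y _ _ (isInitial_empty X β _) (isInitial_univ X β _)
    simp only [Finset.filter_empty, Finset.sum_empty, sub_zero, zero_sub] at h1 h2
    by_contra! hcon
    set N := ∑ i with X i = y, (β i : ℤ) with hN
    have hcast : ∀ s : SignType, (s : ℤ) = 1 ∨ (s : ℤ) = 0 ∨ (s : ℤ) = -1 := fun s => by
      rcases s with _ | _ | _ <;> simp
    have hN1 : N = 1 ∨ N = -1 := by omega
    rcases hN1 with h | h
    · have : N ≤ 0 := Finset.sum_nonpos fun i hi => by
        have h3 := hcon i (by simpa using hi)
        rcases hcast (β i) with h4 | h4 | h4 <;> omega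
      omega
    · have : 0 ≤ N := Finset.sum_nonneg fun i hi => by
        have h3 := hcon i (by simpa using hi)
        rcases hcast (β i) with h4 | h4 | h4 <;> omega
      omega
  rcases isEmpty_or_nonempty (Fin n) with he | he
  · exact ⟨β, fun i => isEmptyElim i, fun i => isEmptyElim i, fun y => rfl⟩
  choose! pick hp1 hp2 using hpick
  set S : Fin n → Prop := fun i => ∑ k with X k = X i, (β k : ℤ) ≠ 0 ∧ i = pick (X i) with hS
  refine ⟨fun i => if S i then β i else 0, fun i j hij hb => ?_, fun i => ?_, fun y => ?_⟩
  · simp only at hb ⊢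
    have hi : S i := by by_contra h; simp [h] at hb
    have hj : S j := by by_contra h; simp [h] at hb
    simp only [hi, hj, if_true] at hb
    refine lt_of_le_of_ne (hX i j hij (left_ne_zero_of_mul hb) (right_ne_zero_of_mul hb)) fun h => ?_
    exact hij.ne (by rw [hi.2, hj.2, h])
  · by_cases h : S i
    · left; simp only [h, if_true]
    · right; simp only [h, if_false]
  · by_cases hy : ∑ k with X k = y, (β k : ℤ) = 0
    · rw [hy]
      refine Finset.sum_eq_zero fun i hi => ?_
      have hi : X i = y := by simpa using hi
      have : ¬ S i := fun h => h.1 (by rw [hi]; exact hy)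
      simp [this]
    · rw [Finset.sum_eq_single (pick y)]
      · have : S (pick y) := ⟨by rw [hp1 y hy]; exact hy, by rw [hp1 y hy]⟩
        simp only [if_pos this, hp2 y hy]
      · intro i hi hne
        have hi : X i = y := by simpa using hi
        have : ¬ S i := fun h => hne (by rw [h.2, hi])
        simp [this]
      · intro h
        exact absurd (by simp [hp1 y hy]) h

lemma mem_gapped_of_stateSpace {X : Fin n → ℝ} {β : Fin n → SignType}
    (h : (X, β) ∈ stateSpace n) : ∃ c > 0, X ∈ gapped c β := by
  classical
  obtain ⟨c, hc, hle⟩ := exists_pos_le (φ := fun k : Fin n × Fin n =>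
      if k.1 < k.2 ∧ β k.1 ≠ 0 ∧ β k.2 ≠ 0 then X k.2 - X k.1 else 1) fun k => by
    split_ifs with hk
    · exact sub_pos.2 (charged_lt h hk.1 hk.2.1 hk.2.2)
    · exact one_pos
  exact ⟨c, hc, fun i j hij hi hj => by simpa [hij, hi, hj] using hle (i, j)⟩

lemma stateSpace_of_gapped {X : Fin n → ℝ} {β : Fin n → SignType} {c : ℝ} (hc : 0 < c)
    (h : X ∈ gapped c β) : (X, β) ∈ stateSpace n := fun i j hij hb => by
  have := h i j hij (left_ne_zero_of_mul hb) (right_ne_zero_of_mul hb)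
  simp only; linarith

/-- Local existence. -/
lemma exists_local_sol {f g : ℝ → ℝ} (hf : Repulsive f) {K : NNReal} (hg : LipschitzWith K g)
    {X : Fin n → ℝ} {β : Fin n → SignType} (h : (X, β) ∈ stateSpace n) (p : ℝ) {q : ℝ}
    (hpq : p < q) : ∃ r ∈ Ioc p q, ∃ x, Sol f g p r x (fun _ => β) ∧ x p = X := by
  obtain ⟨c, hc, hgap⟩ := mem_gapped_of_stateSpace h
  have hball : Metric.closedBall X (c / 4) ⊆ gapped (c / 2) β := fun y hy i j hij hi hj => by
    have h1 := hgap i j hij hi hj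
    have hd : ∀ k, |y k - X k| ≤ c / 4 := fun k => by
      rw [← Real.dist_eq]; exact (dist_le_pi_dist y X k).trans hy
    linarith [(abs_le.1 (hd i)).2, (abs_le.1 (hd j)).1]
  obtain ⟨L, -, hL⟩ := exists_lipschitzOnWith_velocity hf hg β (by linarith : 0 < c / 2)
  have hL := hL.mono hball
  set v : (Fin n → ℝ) → Fin n → ℝ := fun y => velocity f g y β with hv
  set B : NNReal := ‖v X‖₊ + L * ⟨c / 4, by linarith⟩ with hB
  -- On the ball of radius `c / 4` the speed is at most `B`, so the ball is not left before time
  -- `δ`.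
  set δ : ℝ := c / 4 / (B + 1) with hδ
  have hB1 : (0 : ℝ) < B + 1 := by positivity
  have hδ0 : 0 < δ := by positivity
  have hPL : IsPicardLindelof (fun _ => v) (⟨p, le_rfl, by linarith⟩ : Icc p (p + δ)) X
      ⟨c / 4, by linarith⟩ 0 B L := by
    refine IsPicardLindelof.of_time_independent (fun y hy => ?_) hL ?_
    · have h1 := hL.dist_le_mul y hy X (Metric.mem_closedBall_self (by positivity))
      have h2 := norm_le_norm_add_norm_sub' (v y) (v X)
      rw [← dist_eq_norm] at h2
      have h3 : (L : ℝ) * dist y X ≤ L * (c / 4) := mul_le_mul_of_nonneg_left hy L.coe_nonneg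
      have h4 : (B : ℝ) = ‖v X‖ + L * (c / 4) := by rw [hB]; push_cast; rfl
      rw [h4]; linarith
    · show (B : ℝ) * max (p + δ - p) (p - p) ≤ c / 4 - 0
      rw [add_sub_cancel_left, sub_self, max_eq_left hδ0.le, sub_zero, hδ, mul_div_assoc',
        div_le_iff₀ hB1]
      nlinarith [B.coe_nonneg]
  obtain ⟨α, hα0, hα⟩ := hPL.exists_eq_forall_mem_Icc_hasDerivWithinAt₀
  have hα0 : α p = X := hα0
  have hcont : ContinuousOn α (Icc p (p + δ)) := fun t ht => (hα t ht).continuousWithinAt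
  have hnear : ∀ᶠ t in 𝓝[>] p, α t ∈ Metric.closedBall X (c / 4) := by
    have := ContinuousOn.tendsto_nhdsGT hcont ⟨le_rfl, by linarith⟩
    rw [hα0] at this
    exact this.eventually (Metric.closedBall_mem_nhds X (by linarith))
  obtain ⟨r, hr, hrs⟩ := mem_nhdsGT_iff_exists_Ioc_subset.1 hnear
  have hr : p < r := hr
  set e := min r (min q (p + δ)) with he
  have hpe : p < e := lt_min hr (lt_min hpq (by linarith))
  have hin : ∀ t ∈ Icc p e, (α t, β) ∈ stateSpace n := fun t ht => by
    rcases ht.1.eq_or_lt with rfl | h'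
    · rw [hα0]; exact h
    · exact stateSpace_of_gapped (by linarith : 0 < c / 2)
        (hball (hrs ⟨h', ht.2.trans (min_le_left _ _)⟩))
  have heδ : e ≤ p + δ := (min_le_right _ _).trans (min_le_right _ _)
  refine ⟨e, ⟨hpe, (min_le_right _ _).trans (min_le_left _ _)⟩, α, ⟨?_, hin, ?_, ?_, ?_⟩, hα0⟩
  · exact hcont.mono (Icc_subset_Icc_right heδ)
  · exact fun t _ => Eventually.of_forall fun _ => rfl
  · exact fun t _ => ⟨β, hasLeftLimit_iff.2 (Eventually.of_forall fun _ => rfl),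
      fun i => Or.inl rfl, fun y => rfl⟩
  · intro t ht
    refine (hα t ⟨ht.1, ht.2.le.trans heδ⟩).mono_of_mem_nhdsWithin ?_
    filter_upwards [Icc_mem_nhdsGE (ht.2.trans_le heδ)] with s hs
    exact ⟨ht.1.trans hs.1, hs.2⟩

/-- Solutions with constant charges have limits at the end of their interval of existence. -/
lemma exists_limit {f g : ℝ → ℝ} (hf : Repulsive f) {K : NNReal} (hg : LipschitzWith K g)
    {p τ : ℝ} (hp : p < τ) {x : ℝ → Fin n → ℝ} {β : Fin n → SignType}
    (h : ∀ s ∈ Ico p τ, Sol f g p s x fun _ => β) :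
    ∃ Y, Tendsto x (𝓝[<] τ) (𝓝 Y) ∧ Alternating Y β ∧
      ∀ i j, i < j → β i ≠ 0 → β j ≠ 0 → Y i ≤ Y j := by
  have hx0 := (h p ⟨le_rfl, hp⟩).mem p ⟨le_rfl, le_rfl⟩
  obtain ⟨c₀, hc₀, hsep₀⟩ := exists_sameSignSep hx0
  set c := c₀ * Real.exp (-(K + 1) * (τ - p)) with hc
  have hc0 : 0 < c := by positivity
  have hsep : ∀ t ∈ Ico p τ, SameSignSep c (x t) β := fun t ht => by
    refine ((h t ht).sameSignSep_of_const hf hg (fun _ _ => rfl) hc₀ hsep₀ t ⟨ht.1, le_rfl⟩).anti ?_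
    refine mul_le_mul_of_nonneg_left (Real.exp_le_exp.2 ?_) hc₀.le
    nlinarith [K.coe_nonneg, ht.2]
  obtain ⟨D, hD1, hD2⟩ : ∃ D, 1 + (n + 1) * f c + |g 0| ≤ D ∧ ∀ i, |x p i| ≤ D := by
    obtain ⟨D, hD⟩ := (Set.finite_range fun i => |x p i|).bddAbove
    exact ⟨max D (1 + (n + 1) * f c + |g 0|), le_max_right _ _,
      fun i => (hD ⟨i, rfl⟩).trans (le_max_left _ _)⟩
  have hD0 : 0 ≤ D := by
    have := hf.nonneg c hc0
    have : 0 ≤ (n + 1) * f c := by positivity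
    linarith [abs_nonneg (g 0)]
  set R := D * Real.exp ((K + 1) * (τ - p)) with hR
  have hbdd : ∀ t ∈ Ico p τ, ∀ i, |x t i| ≤ R := fun t ht i => by
    refine ((h t ht).abs_le_of_sep hf hg hc0 (fun s hs => hsep s ⟨hs.1, hs.2.trans_lt ht.2⟩)
      hD1 hD2 t ⟨ht.1, le_rfl⟩ i).trans ?_
    refine mul_le_mul_of_nonneg_left (Real.exp_le_exp.2 ?_) hD0
    nlinarith [K.coe_nonneg, ht.2]
  set C : Set (Fin n → ℝ) := Metric.closedBall 0 R ∩
    {y | (∀ i j, i < j → β i ≠ 0 → β j ≠ 0 → y i ≤ y j) ∧ SameSignSep c y β} with hC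
  have hCcomp : IsCompact C := by
    refine (isCompact_closedBall _ _).inter_right ?_
    have h1 : IsClosed {y : Fin n → ℝ | ∀ i j, i < j → β i ≠ 0 → β j ≠ 0 → y i ≤ y j} := by
      simp only [ofPred_forall]
      exact isClosed_iInter fun i => isClosed_iInter fun j => isClosed_iInter fun _ =>
        isClosed_iInter fun _ => isClosed_iInter fun _ =>
          isClosed_le (continuous_apply i) (continuous_apply j)
    have h2 : IsClosed {y : Fin n → ℝ | SameSignSep c y β} := by
      simp only [SameSignSep, ofPred_forall]
      exact isClosed_iInter fun i => isClosed_iInter fun j => isClosed_iInter fun _ =>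
        isClosed_iInter fun _ => isClosed_le continuous_const
          ((continuous_apply j).sub (continuous_apply i))
    exact h1.inter h2
  have hxC : ∀ᶠ t in 𝓝[<] τ, x t ∈ C := by
    filter_upwards [eventually_nhdsLT_mem_Ico hp] with t ht
    refine ⟨?_, fun i j hij hi hj => ?_, hsep t ht⟩
    · rw [mem_closedBall_zero_iff]
      refine (pi_norm_le_iff_of_nonneg (by positivity)).2 fun i => ?_
      rw [Real.norm_eq_abs]; exact hbdd t ht i
    · exact (charged_lt ((h t ht).mem t ⟨ht.1, le_rfl⟩) hij hi hj).le
  -- Compactness yields only a cluster point. It alternates, so `collapse` applies from a time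
  -- shortly before `τ` at which `x` is near `Y`, and keeps `x` near `Y` until `τ`; hence `Y` is the
  -- limit.
  obtain ⟨Y, ⟨-, hY1, hY2⟩, hY⟩ := hCcomp.exists_mapClusterPt_of_frequently hxC.frequently
  have hA : Alternating Y β := alternating_of_neighbors hY1 fun i j hij hXX hb => by
    have := hY2 i j hij hb
    linarith
  refine ⟨Y, ?_, hA, hY1⟩
  rw [tendsto_pi_nhds]
  intro i
  rw [Metric.tendsto_nhds]
  intro ε hε
  obtain ⟨η, hη, k, hk, -, hcol⟩ := collapse hf hg.continuous hA (half_pos hε)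
  have hfreq : ∃ᶠ t in 𝓝[<] τ, x t ∈ Metric.closedBall Y η :=
    hY.frequently (Metric.closedBall_mem_nhds Y hη)
  obtain ⟨t₁, ht₁, ht₂⟩ := (hfreq.and_eventually (eventually_nhdsLT_mem_Ico
    (show max p (τ - k) < τ from max_lt hp (by linarith)))).exists
  have hpt : p ≤ t₁ := (le_max_left _ _).trans ht₂.1
  have hkt : τ - k ≤ t₁ := (le_max_right _ _).trans ht₂.1
  filter_upwards [eventually_nhdsLT_mem_Ico ht₂.2] with t ht
  have := (hcol g t₁ t x (fun _ => β) (by simp) ((h t ⟨hpt.trans ht.1, ht.2⟩).mono hpt le_rfl)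
    ht.1 (by linarith [ht.2]) (fun i => by
      rw [← Real.dist_eq]; exact (dist_le_pi_dist _ _ i).trans ht₁) rfl).1 t ⟨ht.1, le_rfl⟩ i
  rw [Real.dist_eq]
  linarith

/-- A solution exists until the final time or until some charges annihilate. -/
lemma exists_sol_until_jump {f g : ℝ → ℝ} (hf : Repulsive f) {K : NNReal} (hg : LipschitzWith K g)
    {X : Fin n → ℝ} {β : Fin n → SignType} (h0 : (X, β) ∈ stateSpace n) {p T : ℝ} (hpT : p < T) :
    ∃ τ ∈ Ioc p T, ∃ x b, Sol f g p τ x b ∧ x p = X ∧ b p = β ∧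
      (τ = T ∨ Sol.chargeCount (b τ) < Sol.chargeCount β) := by
  classical
  set A : Set ℝ := {s | s ∈ Ioc p T ∧ ∃ x, Sol f g p s x (fun _ => β) ∧ x p = X} with hA
  obtain ⟨r, hr, hrA⟩ := exists_local_sol hf hg h0 p hpT
  have hAne : A.Nonempty := ⟨r, hr, hrA⟩
  have hAbdd : BddAbove A := ⟨T, fun s hs => hs.1.2⟩
  set τ := sSup A with hτ
  have hpτ : p < τ := hr.1.trans_le (le_csSup hAbdd ⟨hr, hrA⟩)
  have hτT : τ ≤ T := csSup_le hAne fun s hs => hs.1.2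
  have hex : ∀ t, t < τ → ∃ s y, t < s ∧ s ∈ A ∧ Sol f g p s y (fun _ => β) ∧ y p = X :=
    fun t ht => by
      obtain ⟨s, hs, hts⟩ := exists_lt_of_lt_csSup hAne ht
      obtain ⟨y, hy⟩ := hs.2
      exact ⟨s, y, hts, hs, hy⟩
  choose! S y hS1 hS2 hy1 hy2 using hex
  -- For `t < τ`, `y t` is a solution that reaches beyond `t`. By uniqueness these solutions agree
  -- where they overlap, so the diagonal `t ↦ y t t` is a solution on every `[p, s]` with `s < τ`.
  have hsol : ∀ s ∈ Ico p τ, Sol f g p s (fun t => y t t) fun _ => β := fun s hs => by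
    refine ((hy1 s hs.2).mono le_rfl (hS1 s hs.2).le).congr (fun t ht => ?_) fun _ _ => rfl
    have htτ : t < τ := ht.2.trans_lt hs.2
    exact ((hy1 s hs.2).mono le_rfl (ht.2.trans (hS1 s hs.2).le)).unique_of_const hf hg
      ((hy1 t htτ).mono le_rfl (hS1 t htτ).le) (by rw [hy2 s hs.2, hy2 t htτ]) t ⟨ht.1, le_rfl⟩
  obtain ⟨Y, hY, hYA, hYle⟩ := exists_limit hf hg hpτ hsol
  obtain ⟨b', hb1, hb2, hb3⟩ := hYA.exists_annihilate hYle
  set x : ℝ → Fin n → ℝ := fun t => if t < τ then y t t else Y with hx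
  set b : ℝ → Fin n → SignType := fun t => if t < τ then β else b' with hb
  have hxτ : x τ = Y := if_neg (lt_irrefl _)
  have hbτ : b τ = b' := if_neg (lt_irrefl _)
  have hSol : Sol f g p τ x b := by
    refine Sol.extend hpτ (fun s hs => (hsol s hs).congr (fun t ht => if_pos (ht.2.trans_lt hs.2))
      (fun t ht => if_pos (ht.2.trans_lt hs.2))) ?_ ?_ ⟨β, ?_, ?_⟩
    · rw [hxτ]
      refine hY.congr' ?_
      filter_upwards [self_mem_nhdsWithin] with t ht
      exact (if_pos ht).symm
    · rw [hxτ, hbτ]; exact hb1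
    · rw [hasLeftLimit_iff]
      filter_upwards [self_mem_nhdsWithin] with t ht
      exact if_pos ht
    · rw [hxτ, hbτ]; exact ⟨hb2, hb3⟩
  have hxp : x p = X := by
    rw [hx]; simp only [if_pos hpτ]; exact hy2 p hpτ
  refine ⟨τ, ⟨hpτ, hτT⟩, x, b, hSol, hxp, if_pos hpτ, ?_⟩
  by_contra! hcon
  obtain ⟨hne, hcount⟩ := hcon
  have hbβ : b' = β := by
    by_contra hne'
    have := Sol.chargeCount_lt hb2 hne'
    rw [hbτ] at hcount
    omega
  have hSol' : Sol f g p τ x fun _ => β := hSol.congr (fun _ _ => rfl) fun t _ => by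
    simp only [hb]; split_ifs
    · rfl
    · exact hbβ.symm
  -- If no charge were lost at `τ < T`, restarting at `τ` would prolong the solution with the same
  -- charges beyond the supremum.
  obtain ⟨r', hr', x', hx', hx'0⟩ := exists_local_sol hf hg
    (hSol'.mem τ ⟨hpτ.le, le_rfl⟩) τ (lt_of_le_of_ne hτT hne)
  have hglue := hSol'.glue hpτ.le hr'.1.le hx' hx'0 rfl
  have : r' ≤ τ := le_csSup hAbdd ⟨⟨hpτ.trans hr'.1, hr'.2⟩, _,
    hglue.congr (fun _ _ => rfl) (fun _ _ => by simp), by simp [hpτ, hxp]⟩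
  exact absurd hr'.1 (not_lt.2 this)

/-- Induction on the number of charges, which drops at every restart before `T`. -/
theorem exists_sol {f g : ℝ → ℝ} (hf : Repulsive f) {K : NNReal} (hg : LipschitzWith K g) {T : ℝ} :
    ∀ (N : ℕ) (X : Fin n → ℝ) (β : Fin n → SignType), Sol.chargeCount β = N →
      (X, β) ∈ stateSpace n → ∀ p ≤ T, ∃ x b, Sol f g p T x b ∧ x p = X ∧ b p = β := by
  intro N
  induction N using Nat.strong_induction_on with
  | _ N ih =>
    intro X β hβ h0 p hpT
    rcases hpT.eq_or_lt with rfl | hpT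
    · exact ⟨fun _ => X, fun _ => β, ⟨continuousOn_const, fun _ _ => h0,
        fun t ht => absurd (ht.1.trans_lt ht.2) (lt_irrefl _),
        fun t ht => absurd (ht.1.trans_le ht.2) (lt_irrefl _),
        fun t ht => absurd (ht.1.trans_lt ht.2) (lt_irrefl _)⟩, rfl, rfl⟩
    obtain ⟨τ, hτ, x, b, hsol, hx, hb, hcase⟩ := exists_sol_until_jump hf hg h0 hpT
    rcases hcase with rfl | hlt
    · exact ⟨x, b, hsol, hx, hb⟩
    · obtain ⟨x', b', hsol', hx', hb'⟩ := ih _ (hβ ▸ hlt) (x τ) (b τ) rfl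
        (hsol.mem τ ⟨hτ.1.le, le_rfl⟩) τ hτ.2
      exact ⟨_, _, hsol.glue hτ.1.le hτ.2 hsol' hx' hb', by simp [hτ.1, hx], by simp [hτ.1, hb]⟩

/-! ### Stability and uniqueness -/

/-- The net charge `s` determines how often each nonzero charge occurs. The predicate `P` covers
both a prescribed nonzero sign and the property of being charged; counts of the value `0` follow by
complement. -/
lemma exists_charge_of_subsingleton {A : Finset (Fin n)} {b : Fin n → SignType}
    (hb : ∀ i ∈ A, ∀ j ∈ A, b i ≠ 0 → b j ≠ 0 → i = j) :
    ∃ s : SignType, (s : ℤ) = ∑ i ∈ A, (b i : ℤ) ∧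
      ∀ P : SignType → Prop, [DecidablePred P] → ¬ P 0 →
        (A.filter fun i => P (b i)).card = if P s then 1 else 0 := by
  by_cases h : ∃ i ∈ A, b i ≠ 0
  · obtain ⟨i, hi, hbi⟩ := h
    have hz : ∀ j ∈ A, j ≠ i → b j = 0 := fun j hj hji => by
      by_contra h; exact hji (hb j hj i hi h hbi)
    refine ⟨b i, (Finset.sum_eq_single_of_mem (f := fun j => (b j : ℤ)) i hi fun j hj hji => by
      simp [hz j hj hji]).symm,
      fun P _ hP => ?_⟩
    split_ifs with hs
    · rw [Finset.card_eq_one]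
      refine ⟨i, Finset.ext fun j => ?_⟩
      simp only [Finset.mem_filter, Finset.mem_singleton]
      refine ⟨fun hj => ?_, fun hj => hj ▸ ⟨hi, hs⟩⟩
      by_contra hji
      exact hP (hz j hj.1 hji ▸ hj.2)
    · rw [Finset.card_eq_zero, Finset.filter_eq_empty_iff]
      intro j hj hPj
      by_cases hji : j = i
      · exact hs (hji ▸ hPj)
      · exact hP (hz j hj hji ▸ hPj)
  · push Not at h
    refine ⟨0, ?_, fun P _ hP => ?_⟩
    · rw [Finset.sum_eq_zero fun i hi => by simp [h i hi]]; rfl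
    · rw [if_neg hP, Finset.card_eq_zero, Finset.filter_eq_empty_iff]
      intro j hj hPj
      exact hP (h j hj ▸ hPj)

/-- Two charge vectors with at most one charge in each cluster and the same net charges agree up
to a permutation within the clusters. -/
lemma exists_perm_of_net_charge {X : Fin n → ℝ} {b b' : Fin n → SignType}
    (hb : ∀ i j, X i = X j → b i ≠ 0 → b j ≠ 0 → i = j)
    (hb' : ∀ i j, X i = X j → b' i ≠ 0 → b' j ≠ 0 → i = j)
    (hsum : ∀ y, ∑ i with X i = y, (b' i : ℤ) = ∑ i with X i = y, (b i : ℤ)) :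
    ∃ ν : Equiv.Perm (Fin n), (∀ i, X (ν i) = X i) ∧ ∀ i, b' (ν i) = b i := by
  classical
  have hcard : ∀ y s, ((Finset.univ.filter fun i => X i = y).filter fun i => b i = s).card =
      ((Finset.univ.filter fun i => X i = y).filter fun i => b' i = s).card := by
    intro y s
    obtain ⟨u, hu, hu'⟩ := exists_charge_of_subsingleton
      (A := Finset.univ.filter fun i => X i = y) (b := b) fun i hi j hj =>
        hb i j (by simp at hi hj; rw [hi, hj])
    obtain ⟨v, hv, hv'⟩ := exists_charge_of_subsingleton
      (A := Finset.univ.filter fun i => X i = y) (b := b') fun i hi j hj =>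
        hb' i j (by simp at hi hj; rw [hi, hj])
    have huv : v = u := by
      have : (v : ℤ) = u := by rw [hu, hv, hsum]
      revert this
      rcases u with _ | _ | _ <;> rcases v with _ | _ | _ <;> simp
    subst huv
    by_cases hs : s = 0
    · subst hs
      have h1 := Finset.card_filter_add_card_filter_not
        (s := Finset.univ.filter fun i => X i = y) (fun i => b i = 0)
      have h2 := Finset.card_filter_add_card_filter_not
        (s := Finset.univ.filter fun i => X i = y) (fun i => b' i = 0)
      have h3 := hu' (fun s => ¬ s = 0) (by simp)
      have h4 := hv' (fun s => ¬ s = 0) (by simp)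
      omega
    · rw [hu' (· = s) (fun h => hs h.symm), hv' (· = s) (fun h => hs h.symm)]
  -- Each pair of a position and a charge has equally many particles on both sides; bijections of
  -- these fibers assemble to the permutation.
  have e : ∀ k : ℝ × SignType, Nonempty ({i // (X i, b i) = k} ≃ {i // (X i, b' i) = k}) := by
    rintro ⟨y, s⟩
    refine ⟨Fintype.equivOfCardEq ?_⟩
    rw [Fintype.card_subtype, Fintype.card_subtype]
    simpa only [Prod.mk.injEq, Finset.filter_filter] using hcard y s
  have e' := fun k => (e k).some
  set ν := (Equiv.sigmaFiberEquiv fun i => (X i, b i)).symm.trans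
    ((Equiv.sigmaCongrRight e').trans (Equiv.sigmaFiberEquiv fun i => (X i, b' i))) with hν
  have hkey : ∀ i, (X (ν i), b' (ν i)) = (X i, b i) := fun i => (e' (X i, b i) ⟨i, rfl⟩).2
  exact ⟨ν, fun i => (Prod.mk.inj (hkey i)).1, fun i => (Prod.mk.inj (hkey i)).2⟩

/-- After relabeling by `μ`, the family `(y σ, c σ)` converges to `(x, b)` on `[p, q]`. -/
structure ConvergesOn {ι : Type*} (l : Filter ι) (y : ι → ℝ → Fin n → ℝ)
    (c : ι → ℝ → Fin n → SignType) (μ : ι → Equiv.Perm (Fin n)) (x : ℝ → Fin n → ℝ)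
    (b : ℝ → Fin n → SignType) (p q : ℝ) : Prop where
  pos : TendstoUniformlyOn (fun σ t i => y σ t (μ σ i)) x l (Icc p q)
  charge : ∀ t₀ t₁, p < t₀ → t₁ < q → ∀ᶠ σ in l, ∀ t ∈ Icc t₀ t₁, ∀ i, c σ t (μ σ i) = b t i

lemma tendstoUniformlyOn_pi_iff {ι : Type*} {l : Filter ι} {y : ι → ℝ → Fin n → ℝ}
    {x : ℝ → Fin n → ℝ} {s : Set ℝ} : TendstoUniformlyOn y x l s ↔
      ∀ ε > 0, ∀ᶠ σ in l, ∀ t ∈ s, ∀ i, |y σ t i - x t i| ≤ ε := by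
  rw [Metric.tendstoUniformlyOn_iff]
  refine ⟨fun h ε hε => ?_, fun h ε hε => ?_⟩
  · filter_upwards [h ε hε] with σ hσ t ht i
    rw [← Real.dist_eq, dist_comm]
    exact (dist_le_pi_dist _ _ i).trans (hσ t ht).le
  · filter_upwards [h (ε / 2) (by linarith)] with σ hσ t ht
    refine lt_of_le_of_lt ((dist_pi_le_iff (by linarith)).2 fun i => ?_) (half_lt_self hε)
    rw [dist_comm, Real.dist_eq]; exact hσ t ht i

lemma eventually_abs_sub_le {ι : Type*} {l : Filter ι} {gσ : ι → ℝ → ℝ} {g : ℝ → ℝ}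
    (h : TendstoUniformly gσ g l) {ε : ℝ} (hε : 0 < ε) : ∀ᶠ σ in l, ∀ u, |gσ σ u - g u| ≤ ε := by
  filter_upwards [Metric.tendstoUniformly_iff.1 h ε hε] with σ hσ u
  rw [← Real.dist_eq, dist_comm]; exact (hσ u).le

namespace ConvergesOn

variable {ι : Type*} {l : Filter ι} {f g : ℝ → ℝ} {gσ : ι → ℝ → ℝ} {y : ι → ℝ → Fin n → ℝ}
  {c : ι → ℝ → Fin n → SignType} {μ : ι → Equiv.Perm (Fin n)} {x : ℝ → Fin n → ℝ}
  {b : ℝ → Fin n → SignType} {o p q r T : ℝ} {K : NNReal}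

/-- Convergence of the initial data gives convergence as long as the charges are constant. -/
lemma of_initial (hf : Repulsive f) (hg : LipschitzWith K g) (hgσ : TendstoUniformly gσ g l)
    (hx : Sol f g p q x b) (hpq : p ≤ q) (hb : ∀ t ∈ Icc p q, b t = b p)
    (hy : ∀ᶠ σ in l, Sol f (gσ σ) p q (fun t i => y σ t (μ σ i)) (fun t i => c σ t (μ σ i)))
    (h0 : ∀ ε > 0, ∀ᶠ σ in l, ∀ i, |y σ p (μ σ i) - x p i| ≤ ε)
    (hc : ∀ᶠ σ in l, ∀ i, c σ p (μ σ i) = b p i) :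
    TendstoUniformlyOn (fun σ t i => y σ t (μ σ i)) x l (Icc p q) ∧
      ∀ᶠ σ in l, ∀ t ∈ Icc p q, ∀ i, c σ t (μ σ i) = b t i := by
  have main : ∀ ε > 0, ∀ᶠ σ in l, ∀ t ∈ Icc p q, (∀ i, |y σ t (μ σ i) - x t i| ≤ ε) ∧
      ∀ i, c σ t (μ σ i) = b t i := by
    intro ε hε
    obtain ⟨η, hη, hd⟩ := hx.continuous_dependence hf hg hb hε
    filter_upwards [hy, h0 η hη, hc, eventually_abs_sub_le hgσ hη] with σ h1 h2 h3 h4 t ht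
    have := hd p ⟨le_rfl, hpq⟩ _ _ _ h4 h1 h2 (funext h3) t ht
    exact ⟨this.1, fun i => by rw [hb t ht]; exact congrFun this.2 i⟩
  refine ⟨tendstoUniformlyOn_pi_iff.2 fun ε hε => ?_, ?_⟩
  · filter_upwards [main ε hε] with σ h t ht using (h t ht).1
  · filter_upwards [main 1 one_pos] with σ h t ht using (h t ht).2

/-- The relabeled solutions are eventually solutions. -/
lemma eventually_sol (h : ConvergesOn l y c μ x b p r) (hx : Sol f g o T x b)
    (hy : ∀ᶠ σ in l, Sol f (gσ σ) o T (y σ) (c σ)) {m : ℝ} (hm : m ∈ Ioo p r)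
    (hop : o ≤ p) (hrT : r ≤ T) :
    ∀ᶠ σ in l, Sol f (gσ σ) m T (fun t i => y σ t (μ σ i)) (fun t i => c σ t (μ σ i)) := by
  have hmT : m ∈ Icc o T := ⟨hop.trans hm.1.le, hm.2.le.trans hrT⟩
  obtain ⟨d, hd, hgap⟩ := mem_gapped_of_stateSpace (hx.mem m hmT)
  filter_upwards [hy, tendstoUniformlyOn_pi_iff.1 h.pos (d / 3) (by linarith),
    h.charge m m hm.1 hm.2] with σ h1 h2 h3
  have hc := h3 m ⟨le_rfl, le_rfl⟩
  have hpos := h2 m ⟨hm.1.le, hm.2.le⟩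
  refine (h1.mono hmT.1 le_rfl).perm hmT.2 (μ σ) fun i j hij hi hj => ?_
  rw [hc] at hi hj
  have := hgap i j hij hi hj
  have h4 := abs_le.1 (hpos i)
  have h5 := abs_le.1 (hpos j)
  linarith [h4.2, h5.1]

lemma of_mid (hf : Repulsive f) (hg : LipschitzWith K g) (hgσ : TendstoUniformly gσ g l)
    (h : ConvergesOn l y c μ x b p r) (hx : Sol f g o T x b)
    (hy : ∀ᶠ σ in l, Sol f (gσ σ) o T (y σ) (c σ)) {m q : ℝ} (hm : m ∈ Ioo p r)
    (hop : o ≤ p) (hrT : r ≤ T) (hmq : m ≤ q) (hqT : q ≤ T) (hb : ∀ t ∈ Icc m q, b t = b m) :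
    TendstoUniformlyOn (fun σ t i => y σ t (μ σ i)) x l (Icc m q) ∧
      ∀ᶠ σ in l, ∀ t ∈ Icc m q, ∀ i, c σ t (μ σ i) = b t i := by
  refine of_initial hf hg hgσ (hx.mono (hop.trans hm.1.le) hqT) hmq hb ?_ ?_ ?_
  · filter_upwards [h.eventually_sol hx hy hm hop hrT] with σ hσ using hσ.mono le_rfl hqT
  · intro ε hε
    filter_upwards [tendstoUniformlyOn_pi_iff.1 h.pos ε hε] with σ hσ using hσ m ⟨hm.1.le, hm.2.le⟩
  · filter_upwards [h.charge m m hm.1 hm.2] with σ hσ using hσ m ⟨le_rfl, le_rfl⟩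

lemma exists_near (hx : ContinuousOn x (Icc o T)) (hq : q ∈ Ioc o T) {η : ℝ} (hη : 0 < η) :
    ∀ᶠ s in 𝓝[<] q, ∀ t ∈ Icc s q, ∀ i, |x t i - x q i| ≤ η := by
  have h1 := ContinuousOn.tendsto_nhdsLT hx hq
  have h2 := h1.eventually (Metric.closedBall_mem_nhds (x q) hη)
  obtain ⟨l, hl, hs⟩ := mem_nhdsLT_iff_exists_Ico_subset.1 h2
  filter_upwards [eventually_nhdsLT_mem_Ico hl] with s hs' t ht i
  rcases ht.2.eq_or_lt with rfl | h'
  · simp [hη.le]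
  · rw [← Real.dist_eq]
    exact (dist_le_pi_dist _ _ i).trans (hs ⟨hs'.1.trans ht.1, h'⟩)

/-- Convergence extends up to the next change of the charges. -/
lemma extend (hf : Repulsive f) (hg : LipschitzWith K g) (hgσ : TendstoUniformly gσ g l)
    (hx : Sol f g o T x b) (hy : ∀ᶠ σ in l, Sol f (gσ σ) o T (y σ) (c σ))
    (h : ConvergesOn l y c μ x b p r) (hop : o ≤ p) (hpr : p < r) (hrq : r ≤ q) (hqT : q ≤ T)
    (hb : ∀ t ∈ Ico p q, b t = b p) : ConvergesOn l y c μ x b p q := by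
  have hrT := hrq.trans hqT
  have hpq := hpr.trans_le hrq
  have hmid : ∀ m ∈ Ioo p r, ∀ s, m ≤ s → s < q →
      TendstoUniformlyOn (fun σ t i => y σ t (μ σ i)) x l (Icc m s) ∧
      ∀ᶠ σ in l, ∀ t ∈ Icc m s, ∀ i, c σ t (μ σ i) = b t i := fun m hm s hms hs =>
    of_mid hf hg hgσ h hx hy hm hop hrT hms (hs.le.trans hqT) fun t ht => by
      rw [hb t ⟨hm.1.le.trans ht.1, ht.2.trans_lt hs⟩, hb m ⟨hm.1.le, hms.trans_lt hs⟩]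
  refine ⟨tendstoUniformlyOn_pi_iff.2 fun ε hε => ?_, fun t₀ t₁ h0 h1 => ?_⟩
  · have hqo : q ∈ Ioc o T := ⟨hop.trans_lt hpq, hqT⟩
    have hβ : HasLeftLimit b q (b p) := by
      rw [hasLeftLimit_iff]
      filter_upwards [eventually_nhdsLT_mem_Ico hpq] with s hs using hb s hs
    obtain ⟨d, hd, hsep⟩ := hx.exists_sameSignSep_left hf hg hqo hβ
    have hA : Alternating (x q) (b p) := alternating_of_neighbors
      (fun i j hij hi hj => hx.left_le hqo hβ hij hi hj) fun i j hij hX hbb => by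
        have := hsep i j hij hbb
        linarith
    -- From a time `s` shortly before `q` on, `collapse` traps the perturbed solution near `x q`,
    -- whatever happens to its charges; `x` is near `x q` by continuity.
    obtain ⟨η, hη, k, hk, -, hcol⟩ := collapse hf hg.continuous hA (half_pos hε)
    obtain ⟨m, hm⟩ := exists_between hpr
    obtain ⟨s, hs1, hs2⟩ := ((exists_near hx.cont hqo (lt_min (half_pos hη)
      (half_pos hε))).and (eventually_nhdsLT_mem_Ico
      (show max m (q - k) < q from max_lt (hm.2.trans_le hrq) (by linarith)))).exists
    have hs3 := hs2.2
    have hms : m ≤ s := (le_max_left _ _).trans hs2.1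
    have hks : q - k ≤ s := (le_max_right _ _).trans hs2.1
    obtain ⟨hm1, hm2⟩ := hmid m hm s hms hs3
    filter_upwards [h.eventually_sol hx hy hm hop hrT,
      tendstoUniformlyOn_pi_iff.1 h.pos ε hε, tendstoUniformlyOn_pi_iff.1 hm1 ε hε,
      tendstoUniformlyOn_pi_iff.1 hm1 (η / 2) (half_pos hη), hm2,
      eventually_abs_sub_le hgσ one_pos] with σ a1 a2 a3 a4 a5 a6 t ht i
    rcases le_or_gt t r with htr | htr
    · exact a2 t ⟨ht.1, htr⟩ i
    rcases le_or_gt t s with hts | hts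
    · exact a3 t ⟨hm.2.le.trans htr.le, hts⟩ i
    have hsq : q ∈ Icc s q := ⟨hs3.le, le_rfl⟩
    have hss : s ∈ Icc s q := ⟨le_rfl, hs3.le⟩
    have c1 := (hcol _ s q _ _ a6 (a1.mono hms hqT) hs3.le (by linarith) (fun i => by
      have e1 := abs_le.1 (a4 s ⟨hms, le_rfl⟩ i)
      have e2 := abs_le.1 ((hs1 s hss i).trans (min_le_left _ _))
      exact abs_le.2 ⟨by linarith [e1.1, e2.1], by linarith [e1.2, e2.2]⟩) (by
        funext i
        rw [a5 s ⟨hms, le_rfl⟩ i, hb s ⟨hm.1.le.trans hms, hs3⟩])).1 t ⟨hts.le, ht.2⟩ i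
    have c2 := abs_le.1 ((hs1 t ⟨hts.le, ht.2⟩ i).trans (min_le_right _ _))
    have c3 := abs_le.1 c1
    exact abs_le.2 ⟨by linarith [c2.2, c3.1], by linarith [c2.1, c3.2]⟩
  · rcases lt_or_ge t₁ t₀ with hlt | hle
    · exact Eventually.of_forall fun σ t ht => absurd (ht.1.trans ht.2) (not_le.2 hlt)
    obtain ⟨m, hm1, hm2⟩ := exists_between (lt_min h0 hpr)
    have hm : m ∈ Ioo p r := ⟨hm1, hm2.trans_le (min_le_right _ _)⟩
    have hm0 : m < t₀ := hm2.trans_le (min_le_left _ _)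
    filter_upwards [(hmid m hm t₁ (hm0.le.trans hle) h1).2] with σ hσ t ht
    exact hσ t ⟨hm0.le.trans ht.1, ht.2⟩

/-- Passing a change of the charges requires a new labeling. -/
lemma restart (hf : Repulsive f) (hg : LipschitzWith K g) (hgσ : TendstoUniformly gσ g l)
    (hx : Sol f g o T x b) (hy : ∀ᶠ σ in l, Sol f (gσ σ) o T (y σ) (c σ))
    (h : ConvergesOn l y c μ x b p q) (hop : o ≤ p) (hpq : p < q) (hqr : q < r) (hrT : r ≤ T)
    (hb : ∀ t ∈ Ico p q, b t = b p) (hbr : ∀ t ∈ Icc q r, b t = b q) :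
    ∃ μ' : ι → Equiv.Perm (Fin n), ConvergesOn l y c μ' x b q r := by
  classical
  have hqT := hqr.le.trans hrT
  have hqo : q ∈ Ioc o T := ⟨hop.trans_lt hpq, hqT⟩
  have hqo' : q ∈ Ico o T := ⟨hqo.1.le, hqr.trans_le hrT⟩
  have hβ : HasLeftLimit b q (b p) := by
    rw [hasLeftLimit_iff]
    filter_upwards [eventually_nhdsLT_mem_Ico hpq] with s hs using hb s hs
  obtain ⟨d, hd, hsep⟩ := hx.exists_sameSignSep_left hf hg hqo hβ
  have hA : Alternating (x q) (b p) := alternating_of_neighbors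
    (fun i j hij hi hj => hx.left_le hqo hβ hij hi hj) fun i j hij hX hbb => by
      have := hsep i j hij hbb
      linarith
  have hnet := (hx.left_of_ne hop hpq hqT hβ).2.2
  have hmemq := hx.mem q ⟨hqo.1.le, hqT⟩
  obtain ⟨γ, hγ, hgap⟩ := mem_gapped_of_stateSpace hmemq
  -- The labeling has to serve all `ε` at once. It is therefore characterized by the charges at the
  -- fixed time `r`, not at the end `e` of the collapse, which depends on `ε`.
  have main : ∀ ε > 0, ∀ᶠ σ in l,
      (∃ ν : Equiv.Perm (Fin n), (∀ i, x q (ν i) = x q i) ∧ ∀ i, c σ r (μ σ (ν i)) = b q i) ∧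
      ∀ ν : Equiv.Perm (Fin n), (∀ i, x q (ν i) = x q i) → (∀ i, c σ r (μ σ (ν i)) = b q i) →
        (∀ t ∈ Icc q r, ∀ i, |y σ t (μ σ (ν i)) - x t i| ≤ ε) ∧
        ∀ t ∈ Icc (q + ε) r, ∀ i, c σ t (μ σ (ν i)) = b q i := by
    intro ε hε
    obtain ⟨η₁, hη₁, hcd⟩ := (hx.mono hqo.1.le hrT).continuous_dependence hf hg hbr hε
    set ζ := min (η₁ / 2) (ε / 2) with hζ
    have hζ0 : 0 < ζ := lt_min (half_pos hη₁) (half_pos hε)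
    obtain ⟨δ, hδ, hnear⟩ : ∃ δ > 0, ∀ t ∈ Icc q (q + δ), ∀ i, |x t i - x q i| ≤ ζ := by
      have h1 := (ContinuousOn.tendsto_nhdsGT hx.cont hqo').eventually
        (Metric.closedBall_mem_nhds (x q) hζ0)
      obtain ⟨u, hu, hs⟩ := mem_nhdsGT_iff_exists_Ioc_subset.1 h1
      refine ⟨u - q, sub_pos.2 hu, fun t ht i => ?_⟩
      rcases ht.1.eq_or_lt with rfl | h'
      · simp [hζ0.le]
      · rw [← Real.dist_eq]
        exact (dist_le_pi_dist _ _ i).trans (hs ⟨h', by linarith [ht.2]⟩)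
    set ε₂ := min (min ζ (min δ (γ / 3))) (r - q) with hε₂
    have hε₂0 : 0 < ε₂ := lt_min (lt_min hζ0 (lt_min hδ (by linarith))) (by linarith)
    have hε₂ζ : ε₂ ≤ ζ := (min_le_left _ _).trans (min_le_left _ _)
    have hε₂δ : ε₂ ≤ δ := (min_le_left _ _).trans ((min_le_right _ _).trans (min_le_left _ _))
    have hε₂γ : ε₂ ≤ γ / 3 := (min_le_left _ _).trans ((min_le_right _ _).trans (min_le_right _ _))
    have hε₂r : ε₂ ≤ r - q := min_le_right _ _
    obtain ⟨η, hη, k, hk, hkε, hcol⟩ := collapse hf hg.continuous hA hε₂0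
    obtain ⟨s, hs1, hs2⟩ := ((exists_near hx.cont hqo (half_pos hη)).and
      (eventually_nhdsLT_mem_Ico (show max ((p + q) / 2) (q - k / 2) < q from
        max_lt (by linarith) (by linarith)))).exists
    have hps : p < s := by linarith [(le_max_left ((p + q) / 2) (q - k / 2)).trans hs2.1]
    have hks : q - k / 2 ≤ s := (le_max_right _ _).trans hs2.1
    have hsq := hs2.2
    -- As `q - k / 2 ≤ s < q` and `k ≤ ε₂`, the time `e` lies after `q` but before `q + ε₂`; at `e`
    -- the collapse is complete.
    set e := s + k with he
    have hqe : q < e := by linarith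
    have her : e ≤ r := by linarith
    have heδ : e ≤ q + δ := by linarith
    filter_upwards [h.eventually_sol hx hy ⟨hps, hsq⟩ hop hqT,
      tendstoUniformlyOn_pi_iff.1 h.pos (η / 2) (half_pos hη), h.charge s s hps hsq,
      eventually_abs_sub_le hgσ one_pos, eventually_abs_sub_le hgσ hη₁] with σ a1 a2 a3 a4 a5
    obtain ⟨k1, k2, k3⟩ := hcol _ s e _ _ a4 (a1.mono le_rfl (her.trans hrT)) (by linarith) le_rfl
      (fun i => by
        have e1 := abs_le.1 (a2 s ⟨hps.le, hsq.le⟩ i)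
        have e2 := abs_le.1 (hs1 s ⟨le_rfl, hsq.le⟩ i)
        exact abs_le.2 ⟨by linarith [e1.1, e2.1], by linarith [e1.2, e2.2]⟩) (by
        funext i
        rw [a3 s ⟨le_rfl, le_rfl⟩ i, hb s ⟨hps.le, hsq⟩])
    have hse : s ≤ e := by linarith
    have hee : e ∈ Icc s e := ⟨hse, le_rfl⟩
    have claim : ∀ ν : Equiv.Perm (Fin n), (∀ i, x q (ν i) = x q i) →
        (∀ i, c σ e (μ σ (ν i)) = b q i) → ∀ t ∈ Icc e r,
          (∀ i, |y σ t (μ σ (ν i)) - x t i| ≤ ε) ∧ ∀ i, c σ t (μ σ (ν i)) = b q i := by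
      intro ν hν1 hν2
      have hsol : Sol f (gσ σ) e r (fun t i => y σ t (μ σ (ν i)))
          (fun t i => c σ t (μ σ (ν i))) :=
        (a1.mono hse hrT).perm her ν fun i j hij hi hj => by
          rw [hν2] at hi hj
          have g1 := hgap i j hij hi hj
          have g2 := abs_le.1 (k1 e hee (ν i))
          have g3 := abs_le.1 (k1 e hee (ν j))
          rw [hν1] at g2 g3
          linarith [g2.2, g3.1]
      intro t ht
      have := hcd e ⟨hqe.le, her⟩ _ _ _ a5 hsol (fun i => by
        have g2 := abs_le.1 ((k1 e hee (ν i)).trans (hε₂ζ.trans (min_le_left _ _)))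
        have g3 := abs_le.1 ((hnear e ⟨hqe.le, heδ⟩ i).trans (min_le_left _ _))
        rw [hν1] at g2
        exact abs_le.2 ⟨by linarith [g2.1, g3.2], by linarith [g2.2, g3.1]⟩) (funext hν2) t ht
      exact ⟨this.1, fun i => congrFun this.2 i⟩
    -- At time `e` the perturbed solution has at most one charge per cluster, like `b q`, and both
    -- have inherited the net charges from before the collision.
    obtain ⟨ν, hν1, hν2⟩ := exists_perm_of_net_charge (X := x q) (b := b q)
      (b' := fun i => c σ e (μ σ i)) (fun i j hX hi hj => by
        by_contra hij; exact stateSpace_ne hmemq i j hij hi hj hX) (k3 rfl)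
      (fun z => by rw [hnet z]; exact k2 e hee z)
    have hν3 := (claim ν hν1 hν2 r ⟨her, le_rfl⟩).2
    refine ⟨⟨ν, hν1, hν3⟩, fun ν' h1 h2 => ?_⟩
    -- No charge changes between `e` and `r`, so a labeling that is correct at `r` is already
    -- correct at `e`.
    have h3 : ∀ j, c σ e (μ σ j) = c σ r (μ σ j) := fun j => by
      obtain ⟨i, rfl⟩ := ν.surjective j
      rw [hν2, hν3]
    have h4 := claim ν' h1 fun i => by rw [h3, h2]
    refine ⟨fun t ht i => ?_, fun t ht => (h4 t ⟨by
      linarith [ht.1, min_le_right (η₁ / 2) (ε / 2)], ht.2⟩).2⟩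
    rcases le_or_gt e t with hte | hte
    · exact (h4 t ⟨hte, ht.2⟩).1 i
    · have g2 := abs_le.1 ((k1 t ⟨hsq.le.trans ht.1, hte.le⟩ (ν' i)).trans
        (hε₂ζ.trans (min_le_right _ _)))
      have g3 := abs_le.1 ((hnear t ⟨ht.1, hte.le.trans heδ⟩ i).trans (min_le_right _ _))
      rw [h1] at g2
      exact abs_le.2 ⟨by linarith [g2.1, g3.2], by linarith [g2.2, g3.1]⟩
  set ν : ι → Equiv.Perm (Fin n) := fun σ =>
    if hσ : ∃ ν : Equiv.Perm (Fin n), (∀ i, x q (ν i) = x q i) ∧ ∀ i, c σ r (μ σ (ν i)) = b q i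
    then hσ.choose else 1 with hν
  have main' : ∀ ε > 0, ∀ᶠ σ in l, (∀ t ∈ Icc q r, ∀ i, |y σ t (μ σ (ν σ i)) - x t i| ≤ ε) ∧
        ∀ t ∈ Icc (q + ε) r, ∀ i, c σ t (μ σ (ν σ i)) = b q i := by
    intro ε hε
    filter_upwards [main ε hε] with σ hσ
    have hc := hσ.1.choose_spec
    have e1 : ν σ = hσ.1.choose := by simp only [hν, dif_pos hσ.1]
    rw [e1]
    exact hσ.2 _ hc.1 hc.2
  refine ⟨fun σ => (ν σ).trans (μ σ), tendstoUniformlyOn_pi_iff.2 fun ε hε => ?_,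
    fun t₀ t₁ h0 h1 => ?_⟩
  · filter_upwards [main' ε hε] with σ hσ using hσ.1
  · filter_upwards [main' (t₀ - q) (by linarith)] with σ hσ t ht i
    rw [hbr t ⟨by linarith [ht.1], by linarith [ht.2]⟩]
    exact hσ.2 t ⟨by linarith [ht.1], by linarith [ht.2]⟩ i

end ConvergesOn

/-! ### Chaining the intervals between jump times. -/

/-- The jump times of the charges in `(0, T]`, together with the initial time. -/
def startTimes (T : ℝ) (b : ℝ → Fin n → SignType) : Set ℝ :=
  insert 0 {t | t ∈ Ioc 0 T ∧ IsJumpTime b t}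

section

variable {ι : Type*} {l : Filter ι} {f g : ℝ → ℝ} {gσ : ι → ℝ → ℝ} {y : ι → ℝ → Fin n → ℝ}
  {c : ι → ℝ → Fin n → SignType} {x : ℝ → Fin n → ℝ}
  {b : ℝ → Fin n → SignType} {p q T : ℝ} {K : NNReal}

lemma Sol.finite_startTimes (hx : Sol f g 0 T x b) : (startTimes T b).Finite :=
  hx.finite_jumpTimes.insert 0

lemma Sol.charge_const_Ico (hx : Sol f g 0 T x b) (hp : 0 ≤ p) (hqT : q ≤ T)
    (hJ : ∀ u ∈ Ioo p q, u ∉ startTimes T b) : ∀ t ∈ Ico p q, b t = b p := fun _ ht =>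
  hx.charge_const hp ht.1 (ht.2.le.trans hqT) fun u hu hj =>
    hJ u ⟨hu.1, hu.2.trans_lt ht.2⟩
      (Or.inr ⟨⟨hp.trans_lt hu.1, hu.2.trans (ht.2.le.trans hqT)⟩, hj⟩)

lemma Sol.exists_pred (hx : Sol f g 0 T x b) (hq : 0 < q) :
    ∃ p ∈ startTimes T b, p < q ∧ ∀ u ∈ Ioo p q, u ∉ startTimes T b := by
  have hfin : (startTimes T b ∩ Iio q).Finite := hx.finite_startTimes.inter_of_left _
  have hne : (startTimes T b ∩ Iio q).Nonempty := ⟨0, mem_insert _ _, hq⟩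
  have hmem := hne.csSup_mem hfin
  exact ⟨_, hmem.1, hmem.2, fun u hu huF =>
    hu.1.not_ge (le_csSup hfin.bddAbove ⟨huF, hu.2⟩)⟩

/-- Between consecutive jump times the family converges after a relabeling. -/
theorem exists_convergesOn (hf : Repulsive f) (hg : LipschitzWith K g)
    (hgσ : TendstoUniformly gσ g l) (hx : Sol f g 0 T x b)
    (hy : ∀ᶠ σ in l, Sol f (gσ σ) 0 T (y σ) (c σ))
    (h0 : Tendsto (fun σ => y σ 0) l (𝓝 (x 0))) (hc0 : ∀ᶠ σ in l, c σ 0 = b 0) :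
    ∀ p ∈ startTimes T b, p < T → ∃ μ, ∀ q, p < q → q ≤ T →
      (∀ u ∈ Ioo p q, u ∉ startTimes T b) → ConvergesOn l y c μ x b p q := by
  -- The labeling is found on a short interval after `p`, before `q` is given; `ConvergesOn.extend`
  -- then carries it to any `q` with no jump time in between.
  have step : ∀ p ∈ startTimes T b, 0 ≤ p → p < T →
      (∀ r, p < r → r ≤ T → (∀ t ∈ Icc p r, b t = b p) → ∃ μ, ConvergesOn l y c μ x b p r) →
      ∃ μ, ∀ q, p < q → q ≤ T →
        (∀ u ∈ Ioo p q, u ∉ startTimes T b) → ConvergesOn l y c μ x b p q := by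
    intro p _ hp0 hpT h
    obtain ⟨r, hr, hrT, hbr⟩ := hx.exists_right ⟨hp0, hpT⟩
    obtain ⟨μ, hμ⟩ := h r hr hrT hbr
    refine ⟨μ, fun q hpq hqT hJ => ?_⟩
    have hm : p < min q r := lt_min hpq hr
    have hμ' : ConvergesOn l y c μ x b p (min q r) :=
      ⟨hμ.pos.mono (Icc_subset_Icc_right (min_le_right _ _)), fun t₀ t₁ h1 h2 =>
        hμ.charge t₀ t₁ h1 (h2.trans_le (min_le_right _ _))⟩
    exact hμ'.extend hf hg hgσ hx hy hp0 hm (min_le_left _ _) hqT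
      (hx.charge_const_Ico hp0 hqT hJ)
  intro p hp
  refine (hx.finite_startTimes.wellFoundedOn (r := (· < ·))).induction
    (P := fun p => p < T → ∃ μ, ∀ q, p < q → q ≤ T →
      (∀ u ∈ Ioo p q, u ∉ startTimes T b) → ConvergesOn l y c μ x b p q) hp ?_
  · intro p hp ih hpT
    rcases hp with rfl | hp
    · refine step 0 (mem_insert _ _) le_rfl hpT fun r hr hrT hbr => ⟨1, ?_⟩
      have := ConvergesOn.of_initial (l := l) (y := y) (c := c) (μ := 1) hf hg hgσ
        (hx.mono le_rfl hrT) hr.le hbr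
        (hy.mono fun σ hσ => hσ.mono le_rfl hrT) (fun ε hε => by
          filter_upwards [h0.eventually (Metric.closedBall_mem_nhds _ hε)] with σ hσ i
          rw [← Real.dist_eq]
          exact (dist_le_pi_dist _ _ i).trans hσ)
        (hc0.mono fun σ hσ i => congrFun hσ i)
      exact ⟨this.1, fun t₀ t₁ h1 h2 => this.2.mono fun σ hσ t ht =>
        hσ t ⟨h1.le.trans ht.1, ht.2.trans h2.le⟩⟩
    · refine step p (Or.inr hp) hp.1.1.le hpT fun r hr hrT hbr => ?_
      obtain ⟨o, ho, hop, hJ⟩ := hx.exists_pred hp.1.1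
      obtain ⟨μ, hμ⟩ := ih o ho hop (hop.trans hpT)
      have ho0 : 0 ≤ o := by
        rcases ho with rfl | ho
        · exact le_rfl
        · exact ho.1.1.le
      exact (hμ p hop hpT.le hJ).restart hf hg hgσ hx hy ho0 hop hr hrT
        (hx.charge_const_Ico ho0 hpT.le hJ) hbr

/-- Includes the degenerate interval `p = q`, as for a collision at time `T`: convergence at this
point is inherited from the preceding interval, and the statement on charges is vacuous. -/
theorem exists_convergesOn_of_le (hf : Repulsive f) (hg : LipschitzWith K g)
    (hgσ : TendstoUniformly gσ g l) (hT : 0 < T) (hx : Sol f g 0 T x b)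
    (hy : ∀ᶠ σ in l, Sol f (gσ σ) 0 T (y σ) (c σ))
    (h0 : Tendsto (fun σ => y σ 0) l (𝓝 (x 0))) (hc0 : ∀ᶠ σ in l, c σ 0 = b 0)
    (hp : p ∈ insert 0 (collisionTimes T x b)) (hq : q ∈ insert T (collisionTimes T x b))
    (hpq : p ≤ q) (hJ : Disjoint (Ioo p q) (collisionTimes T x b)) :
    ∃ μ, ConvergesOn l y c μ x b p q := by
  have hcoll : ∀ u, u ∈ startTimes T b ↔ u ∈ insert 0 (collisionTimes T x b) := fun u =>
    or_congr Iff.rfl hx.mem_collisionTimes_iff.symm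
  have hqT : 0 < q ∧ q ≤ T := by
    rcases hq with rfl | hq
    · exact ⟨hT, le_rfl⟩
    · exact (hx.mem_collisionTimes_iff.1 hq).1
  have key := exists_convergesOn hf hg hgσ hx hy h0 hc0
  have hp0 : 0 ≤ p := by
    rcases hp with rfl | hp
    · exact le_rfl
    · exact (hx.mem_collisionTimes_iff.1 hp).1.1.le
  rcases hpq.eq_or_lt with rfl | hlt
  · obtain ⟨o, ho, hop, hJ'⟩ := hx.exists_pred hqT.1
    obtain ⟨μ, hμ⟩ := key o ho (hop.trans_le hqT.2)
    exact ⟨μ, (hμ p hop hqT.2 hJ').pos.mono (Icc_subset_Icc_left hop.le), fun t₀ t₁ h1 h2 =>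
      Eventually.of_forall fun σ t ht => absurd (h1.trans_le (ht.1.trans ht.2)) h2.not_gt⟩
  · obtain ⟨μ, hμ⟩ := key p ((hcoll p).2 hp) (hlt.trans_le hqT.2)
    refine ⟨μ, hμ q hlt hqT.2 fun u hu huF => ?_⟩
    rcases (hcoll u).1 huF with rfl | h
    · exact hp0.not_gt hu.1
    · exact Set.disjoint_left.1 hJ hu h

end

/-! ### Uniqueness as stability of a constant family. -/

section

variable {f g : ℝ → ℝ} {x x' : ℝ → Fin n → ℝ} {b b' : ℝ → Fin n → SignType} {T T' : ℝ}
  {K : NNReal}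

/-- Solutions with equal initial data agree up to relabeling. -/
lemma Sol.exists_relabeling (hf : Repulsive f) (hg : LipschitzWith K g) (hx : Sol f g 0 T' x b)
    (hx' : Sol f g 0 T' x' b') (h0 : x' 0 = x 0) (hb0 : b' 0 = b 0) :
    ∃ μ : ℝ → Equiv.Perm (Fin n),
      (∀ s t, 0 ≤ s → s ≤ t → (∀ u ∈ Ioc s t, u ∉ startTimes T' b) → μ s = μ t) ∧
      ∀ t ∈ Ico 0 T', ∀ i, x' t (μ t i) = x t i ∧ b' t (μ t i) = b t i := by
  -- The family consists of the second solution alone, and convergence along the filter `pure ()` of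
  -- a one-point index set is equality.
  have key := exists_convergesOn (l := (pure () : Filter Unit)) (gσ := fun _ => g)
    (y := fun _ => x') (c := fun _ => b') hf hg
    (Metric.tendstoUniformly_iff.2 fun ε hε => Eventually.of_forall fun _ _ => by simpa using hε)
    hx (Eventually.of_forall fun _ => hx') (by rw [h0]; exact tendsto_const_nhds)
    (Eventually.of_forall fun _ => hb0)
  choose! ν hν using key
  set F := startTimes T' b with hF
  set m : ℝ → ℝ := fun t => sSup (F ∩ Iic t) with hm
  have hfin : ∀ t, (F ∩ Iic t).Finite := fun t => hx.finite_startTimes.inter_of_left _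
  have hmem : ∀ t, 0 ≤ t → m t ∈ F ∩ Iic t := fun t ht =>
    Set.Nonempty.csSup_mem ⟨0, mem_insert _ _, ht⟩ (hfin t)
  refine ⟨fun t => ν (m t) (), fun s t hs hst hJ => ?_, fun t ht i => ?_⟩
  · have : m s = m t := by
      simp only [hm]
      congr 1
      ext u
      refine and_congr_right fun huF => ⟨fun h => le_trans h hst, fun h => ?_⟩
      by_contra hcon
      exact hJ u ⟨not_le.1 hcon, h⟩ huF
    simp only [this]
  · obtain ⟨h1, h2⟩ := hmem t ht.1
    have hm0 : 0 ≤ m t := le_csSup (hfin t).bddAbove ⟨mem_insert _ _, ht.1⟩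
    have hmT : m t < T' := lt_of_le_of_lt h2 ht.2
    obtain ⟨r, hr, hrT, hbr⟩ := hx.exists_right ht
    obtain ⟨r', hr', hrT', hbr'⟩ := hx'.exists_right ht
    have hJ : ∀ u ∈ Ioo (m t) r, u ∉ F := fun u hu huF => by
      rcases le_or_gt u t with hut | hut
      · exact hu.1.not_ge (le_csSup (hfin t).bddAbove ⟨huF, hut⟩)
      · rcases huF with rfl | huF
        · exact hm0.not_gt hu.1
        · refine huF.2 (hasLeftLimit_iff.2 ?_)
          filter_upwards [eventually_nhdsLT_mem_Ico hut] with s hs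
          rw [hbr s ⟨hs.1, hs.2.le.trans hu.2.le⟩, hbr u ⟨hut.le, hu.2.le⟩]
    have hcv := hν (m t) h1 hmT r (lt_of_le_of_lt h2 hr) hrT hJ
    constructor
    · refine eq_of_abs_sub_nonpos (le_of_forall_pos_le_add fun ε hε => ?_)
      have := tendstoUniformlyOn_pi_iff.1 hcv.pos ε hε
      rw [eventually_pure] at this
      simpa using this t ⟨h2, hr.le⟩ i
    -- The charges are compared only inside the open interval, while `t` may be its left end. Right
    -- continuity allows them to be read off at a slightly later time.
    · obtain ⟨s, hs, hs'⟩ := exists_between (lt_min hr hr')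
      have hsr := hs'.trans_le (min_le_left _ _)
      have hsr' := hs'.trans_le (min_le_right _ _)
      have := hcv.charge s s (lt_of_le_of_lt h2 hs) hsr
      rw [eventually_pure] at this
      have := this s ⟨le_rfl, le_rfl⟩ i
      rwa [hbr s ⟨hs.le, hsr.le⟩, hbr' s ⟨hs.le, hsr'.le⟩] at this

/-- A solution extends to a longer time interval. -/
lemma Sol.exists_extension (hf : Repulsive f) (hg : LipschitzWith K g) (hT : 0 ≤ T) (hTT : T ≤ T')
    (hx : Sol f g 0 T x b) : ∃ x' b', Sol f g 0 T' x' b' ∧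
      ∀ t ≤ T, x' t = x t ∧ b' t = b t := by
  obtain ⟨y, c, hy, hy0, hc0⟩ := exists_sol hf hg _ (x T) (b T) rfl (hx.mem T ⟨hT, le_rfl⟩) T hTT
  refine ⟨_, _, hx.glue hT hTT hy hy0 hc0, fun t ht => ?_⟩
  rcases ht.eq_or_lt with rfl | h
  · simp [hy0, hc0]
  · simp [h]

/-- Uniqueness modulo relabeling. -/
theorem Sol.isRelabeling (hf : Repulsive f) (hg : LipschitzWith K g) (hT : 0 ≤ T)
    (hx : Sol f g 0 T x b) (hx' : Sol f g 0 T x' b') (h0 : x' 0 = x 0) (hb0 : b' 0 = b 0) :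
    IsRelabeling T x b x' b' := by
  -- `Sol.exists_relabeling` excludes the final time, so both solutions are first continued beyond
  -- `T`.
  obtain ⟨y, c, hy, hyx⟩ := hx.exists_extension hf hg hT (by linarith : T ≤ T + 1)
  obtain ⟨y', c', hy', hyx'⟩ := hx'.exists_extension hf hg hT (by linarith : T ≤ T + 1)
  obtain ⟨μ, hμ1, hμ2⟩ := hy.exists_relabeling hf hg hy'
    (by rw [(hyx 0 hT).1, (hyx' 0 hT).1, h0]) (by rw [(hyx 0 hT).2, (hyx' 0 hT).2, hb0])
  refine ⟨fun t => (μ t)⁻¹, fun s t hs hst htT hJ => ?_, fun t ht i => ?_⟩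
  · simp only
    rw [hμ1 s t hs hst fun u hu huF => ?_]
    have hu0 := hs.trans_lt hu.1
    rcases huF with rfl | huF
    · exact hu0.false
    · refine Set.disjoint_left.1 hJ hu (hx.mem_collisionTimes_iff.2
        ⟨⟨hu0, hu.2.trans htT⟩, fun hl => huF.2 ?_⟩)
      rw [hasLeftLimit_iff] at hl ⊢
      filter_upwards [hl, self_mem_nhdsWithin] with v hv hvu
      rw [(hyx u (hu.2.trans htT)).2, (hyx v ((le_of_lt hvu).trans (hu.2.trans htT))).2, hv]
  · have := hμ2 t ⟨ht.1, by linarith [ht.2]⟩ ((μ t)⁻¹ i)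
    rw [(hyx t ht.2).1, (hyx t ht.2).2, (hyx' t ht.2).1, (hyx' t ht.2).2] at this
    simpa using this

end

/-! ### Collision rates -/

section rates

variable {D D' : ℝ → ℝ} {t τ κ a : ℝ}

lemma hasDerivWithinAt_rpow {s : ℝ} (hs : 0 < D s)
    (hd : HasDerivWithinAt D (D' s) (Ici s) s) :
    HasDerivWithinAt (fun u => D u ^ (2 + a)) (D' s * (2 + a) * D s ^ (1 + a)) (Ici s) s := by
  have := hd.rpow_const (p := 2 + a) (Or.inl hs.ne')
  rwa [show 2 + a - 1 = 1 + a by ring] at this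

/-- The right derivative of `D ^ (2 + a)` is `(2 + a) * D' * D ^ (1 + a)`, at least `-(2 + a) * κ`;
integrate up to `τ`, where `D` vanishes. -/
lemma rpow_le_of_neg_div_le_deriv (ha : -1 < a) (htτ : t ≤ τ) (hc : ContinuousOn D (Icc t τ))
    (h0 : D τ = 0) (hpos : ∀ s ∈ Ico t τ, 0 < D s)
    (hd : ∀ s ∈ Ico t τ, HasDerivWithinAt D (D' s) (Ici s) s)
    (hle : ∀ s ∈ Ico t τ, -(κ / D s ^ (1 + a)) ≤ D' s) :
    D t ^ (2 + a) ≤ (2 + a) * κ * (τ - t) := by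
  have hm : 0 < 2 + a := by linarith
  have key := image_le_of_deriv_right_le_deriv_boundary (f := fun u => -D u ^ (2 + a))
    (f' := fun s => -(D' s * (2 + a) * D s ^ (1 + a))) (a := t) (b := τ)
    (B := fun s => -D t ^ (2 + a) + (2 + a) * κ * (s - t)) (B' := fun _ => (2 + a) * κ)
    (hc.rpow_const fun _ _ => Or.inr hm.le).neg
    (fun s hs => (hasDerivWithinAt_rpow (hpos s hs) (hd s hs)).neg) (by simp)
    (by fun_prop) (fun s _ => by
      have h1 : HasDerivAt (fun s : ℝ => -D t ^ (2 + a) + (2 + a) * κ * (s - t))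
          ((2 + a) * κ) s := by
        simpa using (((hasDerivAt_id s).sub_const t).const_mul ((2 + a) * κ)).const_add
          (-D t ^ (2 + a))
      exact h1.hasDerivWithinAt) (fun s hs => by
      have hp := Real.rpow_pos_of_pos (hpos s hs) (1 + a)
      have h1 := mul_le_mul_of_nonneg_right (hle s hs) hp.le
      rw [neg_mul, div_mul_cancel₀ _ hp.ne'] at h1
      nlinarith) ⟨htτ, le_rfl⟩
  simp only [h0, Real.zero_rpow hm.ne'] at key
  linarith

lemma le_rpow_of_deriv_le_neg_div (ha : -1 < a) (htτ : t ≤ τ) (hc : ContinuousOn D (Icc t τ))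
    (h0 : D τ = 0) (hpos : ∀ s ∈ Ico t τ, 0 < D s)
    (hd : ∀ s ∈ Ico t τ, HasDerivWithinAt D (D' s) (Ici s) s)
    (hle : ∀ s ∈ Ico t τ, D' s ≤ -(κ / D s ^ (1 + a))) :
    (2 + a) * κ * (τ - t) ≤ D t ^ (2 + a) := by
  have hm : 0 < 2 + a := by linarith
  have key := image_le_of_deriv_right_le_deriv_boundary (f := fun u => D u ^ (2 + a))
    (f' := fun s => D' s * (2 + a) * D s ^ (1 + a)) (a := t) (b := τ)
    (B := fun s => D t ^ (2 + a) + -((2 + a) * κ) * (s - t)) (B' := fun _ => -((2 + a) * κ))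
    (hc.rpow_const fun _ _ => Or.inr hm.le)
    (fun s hs => hasDerivWithinAt_rpow (hpos s hs) (hd s hs)) (by simp)
    (by fun_prop) (fun s _ => by
      have h1 : HasDerivAt (fun s : ℝ => D t ^ (2 + a) + -((2 + a) * κ) * (s - t))
          (-((2 + a) * κ)) s := by
        simpa using (((hasDerivAt_id s).sub_const t).const_mul (-((2 + a) * κ))).const_add
          (D t ^ (2 + a))
      exact h1.hasDerivWithinAt) (fun s hs => by
      have hp := Real.rpow_pos_of_pos (hpos s hs) (1 + a)
      have h1 := mul_le_mul_of_nonneg_right (hle s hs) hp.le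
      rw [neg_mul, div_mul_cancel₀ _ hp.ne'] at h1
      nlinarith) ⟨htτ, le_rfl⟩
  simp only [h0, Real.zero_rpow hm.ne'] at key
  linarith

end rates

/-- The net charge of an initial segment of the truncated charges is that of an initial segment of
`b`, less the fixed net charge of the indices below `j`. Differences are thus differences for `b`.
-/
lemma Alternating.restrict_ge {X : Fin n → ℝ} {b : Fin n → SignType} (hA : Alternating X b)
    (j : Fin n) : Alternating X fun k => if j ≤ k then b k else 0 := by
  classical
  intro y
  have key : ∀ A, IsInitial X (fun k => if j ≤ k then b k else 0) y A →
      IsInitial X b y (A ∪ Finset.univ.filter (· < j)) ∧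
      ∑ i ∈ A with X i = y, ((if j ≤ i then b i else 0 : SignType) : ℤ) =
        ∑ i ∈ A ∪ Finset.univ.filter (· < j) with X i = y, (b i : ℤ) -
          ∑ i ∈ Finset.univ.filter (· < j) with X i = y, (b i : ℤ) := by
    intro A hin
    constructor
    · intro i hi k hk hbk hXk
      rcases lt_or_ge k j with h | h
      · simp [h]
      · refine Finset.mem_union_left _ (hin i ?_ k hk (by simpa [h] using hbk) hXk)
        rcases Finset.mem_union.1 hi with h' | h'
        · exact h'
        · simp only [Finset.mem_filter, Finset.mem_univ, true_and] at h'
          exact absurd (h'.trans_le h) hk.not_gt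
    · rw [eq_sub_iff_add_eq, Finset.sum_filter, Finset.sum_filter, Finset.sum_filter,
        Finset.sum_filter, ← Finset.sum_indicator_subset _ (Finset.subset_univ A),
        ← Finset.sum_indicator_subset _ (Finset.subset_univ (A ∪ Finset.univ.filter (· < j))),
        ← Finset.sum_add_distrib]
      refine Finset.sum_congr rfl fun i _ => ?_
      rcases lt_or_ge i j with h | h
      · simp [Set.indicator, h, h.not_ge]
      · simp [Set.indicator, h, h.not_gt]
  intro A B hA' hB'
  obtain ⟨a1, a2⟩ := key A hA'
  obtain ⟨b1, b2⟩ := key B hB'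
  rw [a2, b2]
  linarith [hA y _ _ a1 b1]

lemma Alternating.restrict_le {X : Fin n → ℝ} {b : Fin n → SignType} (hA : Alternating X b)
    (j : Fin n) : Alternating X fun k => if k ≤ j then b k else 0 := by
  classical
  intro y
  have key : ∀ A, IsInitial X (fun k => if k ≤ j then b k else 0) y A →
      IsInitial X b y (A.filter (· ≤ j)) ∧
      ∑ i ∈ A with X i = y, ((if i ≤ j then b i else 0 : SignType) : ℤ) =
        ∑ i ∈ A.filter (· ≤ j) with X i = y, (b i : ℤ) := by
    intro A hin
    constructor
    · intro i hi k hk hbk hXk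
      simp only [Finset.mem_filter] at hi ⊢
      have hkj := hk.le.trans hi.2
      exact ⟨hin i hi.1 k hk (by simpa [hkj] using hbk) hXk, hkj⟩
    · rw [Finset.filter_filter, Finset.sum_filter, Finset.sum_filter]
      refine Finset.sum_congr rfl fun i _ => ?_
      by_cases h : i ≤ j <;> simp [h]
  intro A B hA' hB'
  obtain ⟨a1, a2⟩ := key A hA'
  obtain ⟨b1, b2⟩ := key B hB'
  rw [a2, b2]
  exact hA y _ _ a1 b1

/-- Within an alternating cluster, the other charges pull opposite neighbors apart. -/
lemma Alternating.neg_two_mul_le_internalForce_sub {f : ℝ → ℝ} (hf : Repulsive f)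
    {X x : Fin n → ℝ} {b : Fin n → SignType} (hA : Alternating X b) (hx : (x, b) ∈ stateSpace n)
    {i j : Fin n} (hij : AreNeighbors b i j) (hX : X i = X j) (hb : b i ≠ b j) :
    -(2 * f (x j - x i)) ≤ internalForce X f x b j - internalForce X f x b i := by
  classical
  have hi := left_ne_zero_of_mul hij.2.1
  have hj := right_ne_zero_of_mul hij.2.1
  have hbij : (b i : ℝ) = -b j := by
    revert hi hj hb
    rcases b i with _ | _ | _ <;> rcases b j with _ | _ | _ <;> simp
  set R := x j - x i with hR
  have hRpos : 0 < R := sub_pos.2 (charged_lt hx hij.1 hi hj)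
  -- Up to sign, an outer charge at distance `u` from the nearer of the two opposite neighbors
  -- changes their relative force by `f u + f (u + R)`. The charges from `j` on form an alternating
  -- cluster with leftmost charge `j`, those up to `i` one with rightmost charge `i`, so both outer
  -- sums have a sign.
  set φ : ℝ → ℝ := fun u => f u + f (u + R) with hφ
  have hφ1 : ∀ u v, 0 < u → u ≤ v → φ v ≤ φ u := fun u v hu huv =>
    add_le_add (hf.le_of_le hu huv) (hf.le_of_le (by linarith) (by linarith))
  have hφ2 : ∀ u, 0 < u → 0 ≤ φ u := fun u hu =>
    add_nonneg (hf.nonneg _ hu) (hf.nonneg _ (by linarith))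
  obtain ⟨L, hL⟩ : ∃ L, ∀ k l, x k - x l ≤ L := by
    obtain ⟨L, hL⟩ := (Set.finite_range fun k : Fin n × Fin n => x k.1 - x k.2).bddAbove
    exact ⟨L, fun k l => hL ⟨(k, l), rfl⟩⟩
  have hmem : ∀ P : Fin n → Prop, ∀ [DecidablePred P],
      (x, fun k => if P k then b k else 0) ∈ stateSpace n := fun P _ k l hkl hbb => by
    refine charged_lt hx hkl (fun h => left_ne_zero_of_mul hbb ?_)
      fun h => right_ne_zero_of_mul hbb ?_ <;> simp [h]
  have r1 := (hA.restrict_ge j).sum_leftmost_nonpos (hmem (j ≤ ·)) (j := j) (by simpa using hj)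
    (fun k hk _ => by simp [hk.not_ge]) (φ := φ) (R := L) (fun u v hu huv _ => hφ1 u v hu huv)
    (fun u hu _ => hφ2 u hu) fun k _ _ => hL k j
  have r2 := (hA.restrict_le i).sum_rightmost_nonpos (hmem (· ≤ i)) (j := i) (by simpa using hi)
    (fun k hk _ => by simp [hk.not_ge]) (φ := φ) (R := L) (fun u v hu huv _ => hφ1 u v hu huv)
    (fun u hu _ => hφ2 u hu) fun k _ _ => hL i k
  have ext : ∀ (m : Fin n), X m = X j → ∀ F : Fin n → ℝ, ∑ k with X k = X m ∧ k ≠ m, F k =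
      ∑ k with X k = X j, if k = m then 0 else F k := fun m hm F => by
    rw [hm, ← Finset.filter_filter, Finset.sum_filter]
    exact Finset.sum_congr rfl fun k _ => by by_cases h : k = m <;> simp [h]
  have sgl : ∀ m, X m = X j → f R = ∑ k with X k = X j, if k = m then f R else 0 := fun m hm => by
    rw [Finset.sum_ite_eq' _ m fun _ => f R, if_pos (by simp [hm])]
  have e : internalForce X f x b j - internalForce X f x b i = -(2 * f R) -
      internalForce X (fun u => φ (-u)) x (fun k => if j ≤ k then b k else 0) j -
      internalForce X φ x (fun k => if k ≤ i then b k else 0) i := by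
    simp only [internalForce]
    rw [ext j rfl, ext i hX, ext j rfl, ext i hX, two_mul]
    conv_rhs => rw [sgl i hX]
    conv_rhs =>
      enter [1, 1, 1, 2]
      rw [← sgl i hX, sgl j rfl]
    rw [← Finset.sum_add_distrib, ← Finset.sum_neg_distrib, ← Finset.sum_sub_distrib,
      ← Finset.sum_sub_distrib, ← Finset.sum_sub_distrib]
    refine Finset.sum_congr rfl fun k _ => ?_
    have hjj := signType_mul_self hj
    rcases lt_trichotomy k i with h | rfl | h
    · have h1 := h.trans hij.1
      simp only [h.ne, h1.ne, h1.not_ge, h.le, if_true, if_false, le_rfl, hφ, hbij]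
      rw [show x i - x k + R = x j - x k by rw [hR]; ring]
      simp; ring
    · simp only [hij.1.ne, hij.1.not_ge, if_true, if_false, hbij]
      simp only [← hR]
      simp; linear_combination f R * hjj
    · rcases lt_trichotomy k j with h' | rfl | h'
      · simp [hij.2.2 k h h', h.ne', h'.ne]
      · simp only [hij.1.ne', hij.1.not_ge, if_true, if_false, hbij, hf.map_sub_comm (x i), ← hR]
        simp; linear_combination f R * hjj
      · have h1 := hij.1.trans h'
        simp only [h'.ne', h1.ne', h1.not_ge, h'.le, if_true, if_false, le_rfl, hφ, hbij]
        rw [hf.map_sub_comm (x j), hf.map_sub_comm (x i),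
          show -(x j - x k) + R = x k - x i by rw [hR]; ring, neg_sub]
        simp; ring
  linarith

namespace Sol

variable {f g : ℝ → ℝ} {p q : ℝ} {x : ℝ → Fin n → ℝ} {b : ℝ → Fin n → SignType}

/-- Just before a given time, the velocities are given by the interactions within the clusters
formed at this time, up to a bounded error. -/
lemma exists_velocity_bound (hf : Repulsive f) {K : NNReal} (hg : LipschitzWith K g)
    (h : Sol f g p q x b) {τ : ℝ} (hτ : τ ∈ Ioc p q) {β : Fin n → SignType}
    (hβ : HasLeftLimit b τ β) : Alternating (x τ) β ∧
      ∃ l ∈ Ico p τ, ∃ C > 0, ∀ t ∈ Ico l τ, b t = β ∧ ∀ i,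
        |velocity f g (x t) β i - 1 / (n : ℝ) * internalForce (x τ) f (x t) β i| ≤ C := by
  obtain ⟨d, hd, hsep⟩ := h.exists_sameSignSep_left hf hg hτ hβ
  refine ⟨alternating_of_neighbors (fun i j hij hi hj => h.left_le hτ hβ hij hi hj)
    fun i j hij hX hbb => by linarith [hsep i j hij hbb], ?_⟩
  obtain ⟨ρ, hρ, hρs⟩ := exists_separation (x τ)
  obtain ⟨l, hl, hl'⟩ := ((ConvergesOn.exists_near h.cont hτ hρ).and
    (eventually_nhdsLT_mem_Ico hτ.1)).exists
  obtain ⟨β', hβ', l', hpl', hl'τ, hb⟩ := h.exists_left hτ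
  obtain rfl := hβ.unique hβ'
  have hG : ∀ i, ∃ G, ∀ t ∈ Icc p q, |g (x t i)| ≤ G := fun i => by
    obtain ⟨G, hG⟩ := isCompact_Icc.exists_bound_of_continuousOn
      (hg.continuous.comp_continuousOn (h.cont_apply i))
    exact ⟨G, hG⟩
  choose G hG using hG
  have hfρ := hf.nonneg (2 * ρ) (by linarith)
  refine ⟨max l l', ⟨hpl'.trans (le_max_right _ _), max_lt hl'.2 hl'τ⟩,
    f (2 * ρ) + ∑ i, |G i| + 1, by positivity, fun t ht => ?_⟩
  have htl : t ∈ Icc l τ := ⟨(le_max_left _ _).trans ht.1, ht.2.le⟩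
  have htp : t ∈ Icc p q := ⟨hl'.1.trans htl.1, ht.2.le.trans hτ.2⟩
  refine ⟨hb t ⟨(le_max_right _ _).trans ht.1, ht.2⟩, fun i => ?_⟩
  have h1 := abs_force_sub_internalForce_le hf (X := x τ) (x := x t) (b := β) (r := 2 * ρ)
    (by linarith) (i := i) fun k hk => by
      have e1 := hρs k i hk
      have e2 := hl t htl k
      have e3 := hl t htl i
      have e4 := abs_sub_le (x τ k) (x t k) (x τ i)
      have e5 := abs_sub_le (x t k) (x t i) (x τ i)
      rw [abs_sub_comm (x τ k) (x t k)] at e4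
      rw [abs_sub_comm (x t i) (x t k)]
      linarith
  have h2 : |1 / (n : ℝ) * (force f (x t) β i - internalForce (x τ) f (x t) β i)| ≤ f (2 * ρ) := by
    rw [abs_mul, abs_of_nonneg (by positivity)]
    exact one_div_mul_le i h1
  have h3 : |(β i : ℝ) * g (x t i)| ≤ ∑ i, |G i| := abs_charge_mul_le _
    ((hG i t htp).trans ((le_abs_self _).trans
      (Finset.single_le_sum (f := fun i => |G i|) (fun _ _ => abs_nonneg _) (Finset.mem_univ i))))
  rw [velocity_eq hf, show 1 / (n : ℝ) * force f (x t) β i + β i * g (x t i) -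
    1 / (n : ℝ) * internalForce (x τ) f (x t) β i = 1 / (n : ℝ) * (force f (x t) β i -
    internalForce (x τ) f (x t) β i) + β i * g (x t i) by ring]
  linarith [abs_add_le (1 / (n : ℝ) * (force f (x t) β i - internalForce (x τ) f (x t) β i))
    (β i * g (x t i))]

/-- Neighbors stay apart for a short time. -/
lemma exists_gap_lower (h : Sol f g p q x b) {a : ℝ} (ha : -1 < a) {t₀ : ℝ} (ht₀ : t₀ ∈ Icc p q)
    {i j : Fin n} (hij : AreNeighbors (b t₀) i j) :
    ∃ c : ℝ, 0 < c ∧ ∀ t ∈ Icc t₀ q, t ≤ t₀ + c →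
      (c - (t - t₀)) ^ (1 / (2 + a)) ≤ x t j - x t i := by
  have hm : 0 < 2 + a := by linarith
  have hD := sub_pos.2 (h.mem t₀ ht₀ i j hij.1 hij.2.1)
  simp only at hD
  set d := (x t₀ j - x t₀ i) / 2 with hd
  have hc := ((h.cont_apply j).sub (h.cont_apply i)) t₀ ht₀
  obtain ⟨δ, hδ, hball⟩ := Metric.mem_nhdsWithin_iff.1
    (hc.eventually (lt_mem_nhds (show d < x t₀ j - x t₀ i by linarith)))
  have hd0 : 0 < d := by linarith
  have hdp := Real.rpow_pos_of_pos hd0 (2 + a)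
  -- As `c` may depend on `t₀`, `i` and `j`, continuity suffices: up to time `t₀ + δ / 2` the gap
  -- exceeds `d`, half its initial value, and `c ≤ d ^ (2 + a)` keeps the claimed bound below `d`.
  refine ⟨min (δ / 2) (d ^ (2 + a)), lt_min (half_pos hδ) hdp, fun t ht htc => ?_⟩
  have h1 : d < x t j - x t i := hball ⟨by
    rw [Metric.mem_ball, Real.dist_eq, abs_of_nonneg (by linarith [ht.1])]
    linarith [min_le_left (δ / 2) (d ^ (2 + a))], ht₀.1.trans ht.1, ht.2⟩
  refine le_trans ?_ h1.le
  calc _ ≤ (d ^ (2 + a)) ^ (1 / (2 + a)) :=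
        Real.rpow_le_rpow (by linarith) (by linarith [ht.1, min_le_right (δ / 2) (d ^ (2 + a))])
          (by positivity)
    _ = d := by rw [← Real.rpow_mul hd0.le, mul_one_div_cancel hm.ne', Real.rpow_one]

/-- Since the rest of the cluster pulls the pair apart, the gap satisfies `D' ≥ -2 * f D - 2 * V`,
hence `D' ≥ -κ / D ^ (1 + a)` once `D < 1`. Integration gives the rate near `τ`; at earlier times a
bound on the compact interval is enough. -/
lemma exists_collision_upper (hf : Repulsive f) {K : NNReal} (hg : LipschitzWith K g)
    (h : Sol f g p q x b) {a C : ℝ} (ha : -1 < a) (hC : 0 < C)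
    (hfC : ∀ u ∈ Ioo (0 : ℝ) 1, f u ≤ C / u ^ (1 + a)) {τ : ℝ} (hτ : τ ∈ Ioc p q)
    {β : Fin n → SignType} (hβ : HasLeftLimit b τ β) {i j : Fin n} (hij : AreNeighbors β i j)
    (hX : x τ i = x τ j) :
    ∃ C : ℝ, 0 < C ∧ ∀ t ∈ Icc p τ, x t j - x t i ≤ C * (τ - t) ^ (1 / (2 + a)) := by
  have hm : 0 < 2 + a := by linarith
  have hi := left_ne_zero_of_mul hij.2.1
  have hj := right_ne_zero_of_mul hij.2.1
  obtain ⟨hA, l, hl, V, hV, hvel⟩ := h.exists_velocity_bound hf hg hτ hβ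
  have hb : β i ≠ β j := fun hbb => by
    obtain ⟨d, hd, hsep⟩ := h.exists_sameSignSep_left hf hg hτ hβ
    linarith [hsep i j hij hbb]
  obtain ⟨l', hl', hl''⟩ := ((ConvergesOn.exists_near h.cont hτ
    (show (0 : ℝ) < 1 / 3 by norm_num)).and (eventually_nhdsLT_mem_Ico hl.2)).exists
  have hpl' : p ≤ l' := hl.1.trans hl''.1
  set κ := 2 * C + 2 * V with hκ
  have hn : (0 : ℝ) < n := by exact_mod_cast i.pos
  have near : ∀ t ∈ Ico l' τ, x t j - x t i ≤ ((2 + a) * κ) ^ (1 / (2 + a)) *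
      (τ - t) ^ (1 / (2 + a)) := by
    intro t ht
    have hpos : ∀ s ∈ Ico l' τ, 0 < x s j - x s i := fun s hs => by
      have hbs := (hvel s ⟨hl''.1.trans hs.1, hs.2⟩).1
      exact sub_pos.2 (charged_lt (h.mem s ⟨hpl'.trans hs.1, hs.2.le.trans hτ.2⟩) hij.1
        (hbs ▸ hi) (hbs ▸ hj))
    have key := rpow_le_of_neg_div_le_deriv (D := fun s => x s j - x s i)
      (D' := fun s => velocity f g (x s) β j - velocity f g (x s) β i) (κ := κ) ha ht.2.le
      (((h.cont_apply j).sub (h.cont_apply i)).mono (Icc_subset_Icc (hpl'.trans ht.1) hτ.2))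
      (by simp [hX]) (fun s hs => hpos s ⟨ht.1.trans hs.1, hs.2⟩)
      (fun s hs => by
        have hbs := (hvel s ⟨hl''.1.trans (ht.1.trans hs.1), hs.2⟩).1
        have hs' : s ∈ Ico p q := ⟨hpl'.trans (ht.1.trans hs.1), hs.2.trans_le hτ.2⟩
        have := (h.deriv_apply hs' j).sub (h.deriv_apply hs' i)
        rw [hbs] at this
        exact this)
      (fun s hs => by
        have hs1 : s ∈ Ico l' τ := ⟨ht.1.trans hs.1, hs.2⟩
        obtain ⟨hbs, hvs⟩ := hvel s ⟨hl''.1.trans hs1.1, hs.2⟩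
        have hD := hpos s hs1
        have hmem := h.mem s ⟨hpl'.trans hs1.1, hs.2.le.trans hτ.2⟩
        rw [hbs] at hmem
        have hD1 : x s j - x s i < 1 := by
          have e1 := abs_le.1 (hl' s ⟨hs1.1, hs.2.le⟩ i)
          have e2 := abs_le.1 (hl' s ⟨hs1.1, hs.2.le⟩ j)
          linarith [e1.1, e2.2]
        have e1 := hA.neg_two_mul_le_internalForce_sub hf hmem hij hX hb
        have e2 := abs_le.1 (hvs i)
        have e3 := abs_le.1 (hvs j)
        have hp := Real.rpow_pos_of_pos hD (1 + a)
        have hp1 : (x s j - x s i) ^ (1 + a) ≤ 1 :=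
          Real.rpow_le_one hD.le hD1.le (by linarith)
        have e4 := hfC _ ⟨hD, hD1⟩
        have e5 : V ≤ V / (x s j - x s i) ^ (1 + a) := by
          rw [le_div_iff₀ hp]; nlinarith
        have e6 : 1 / (n : ℝ) * -(internalForce (x τ) f (x s) β j -
            internalForce (x τ) f (x s) β i) ≤ 2 * f (x s j - x s i) := by
          have h1n : (1 : ℝ) ≤ n := by exact_mod_cast i.pos
          refine one_div_mul_le i ((neg_le.1 e1).trans ?_)
          exact le_mul_of_one_le_left (by linarith [hf.nonneg _ hD]) h1n
        have e7 : κ / (x s j - x s i) ^ (1 + a) = 2 * (C / (x s j - x s i) ^ (1 + a)) +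
          2 * (V / (x s j - x s i) ^ (1 + a)) := by rw [hκ]; ring
        rw [e7]
        have e8 : 1 / (n : ℝ) * -(internalForce (x τ) f (x s) β j -
            internalForce (x τ) f (x s) β i) = 1 / (n : ℝ) * internalForce (x τ) f (x s) β i -
            1 / (n : ℝ) * internalForce (x τ) f (x s) β j := by ring
        linarith [e2.2, e3.1])
    have hD := hpos t ht
    calc x t j - x t i = ((x t j - x t i) ^ (2 + a)) ^ (1 / (2 + a)) := by
          rw [← Real.rpow_mul hD.le, mul_one_div_cancel hm.ne', Real.rpow_one]
      _ ≤ ((2 + a) * κ * (τ - t)) ^ (1 / (2 + a)) :=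
          Real.rpow_le_rpow (by positivity) key (by positivity)
      _ = _ := Real.mul_rpow (by positivity) (by linarith [ht.2])
  obtain ⟨M, hM⟩ := isCompact_Icc.exists_bound_of_continuousOn
    ((h.cont_apply j).sub (h.cont_apply i))
  have hδ : 0 < (τ - l') ^ (1 / (2 + a)) := Real.rpow_pos_of_pos (by linarith [hl''.2]) _
  refine ⟨max (((2 + a) * κ) ^ (1 / (2 + a))) (|M| / (τ - l') ^ (1 / (2 + a))),
    lt_max_of_lt_left (by positivity), fun t ht => ?_⟩
  rcases ht.2.eq_or_lt with rfl | htτ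
  · rw [hX, sub_self]
    exact mul_nonneg (le_max_of_le_left (by positivity)) (Real.rpow_nonneg (by linarith) _)
  have hr : 0 ≤ (τ - t) ^ (1 / (2 + a)) := Real.rpow_nonneg (by linarith) _
  rcases le_or_gt l' t with hlt | hlt
  · exact (near t ⟨hlt, htτ⟩).trans (mul_le_mul_of_nonneg_right (le_max_left _ _) hr)
  · have h1 := (le_abs_self _).trans (hM t ⟨ht.1, htτ.le.trans hτ.2⟩)
    have h2 : (τ - l') ^ (1 / (2 + a)) ≤ (τ - t) ^ (1 / (2 + a)) :=
      Real.rpow_le_rpow (by linarith [hl''.2]) (by linarith) (by positivity)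
    calc x t j - x t i ≤ |M| := h1.trans (le_abs_self M)
      _ = |M| / (τ - l') ^ (1 / (2 + a)) * (τ - l') ^ (1 / (2 + a)) := by field_simp
      _ ≤ _ := mul_le_mul (le_max_right _ _) h2 hδ.le (le_max_of_le_left (by positivity))

end Sol

/-- Newton's third law: as `f` is odd, exchanging the two particles turns the double sum into its
negative. -/
lemma sum_internalForce_eq_zero {f : ℝ → ℝ} (hf : Repulsive f) (X x : Fin n → ℝ)
    (β : Fin n → SignType) (y : ℝ) :
    ∑ k with X k = y ∧ β k ≠ 0, internalForce X f x β k = 0 := by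
  classical
  have e1 : ∑ k with X k = y ∧ β k ≠ 0, internalForce X f x β k =
      ∑ k with X k = y, ∑ l with X l = y, (β k : ℝ) * β l * f (x k - x l) := by
    rw [← Finset.filter_filter, Finset.sum_filter]
    refine Finset.sum_congr rfl fun k hk => ?_
    have hk : X k = y := by simpa using hk
    by_cases hβ : β k = 0
    · simp [hβ]
    · rw [if_pos hβ, internalForce, hk]
      refine Finset.sum_subset (fun l hl => ?_) (fun l hl hl' => ?_)
      · simp only [Finset.mem_filter, Finset.mem_univ, true_and] at hl ⊢
        exact hl.1
      · simp only [Finset.mem_filter, Finset.mem_univ, true_and, not_and, not_not, ne_eq] at hl hl'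
        simp [hl' hl, hf.map_zero]
  rw [e1]
  have e2 : ∑ k with X k = y, ∑ l with X l = y, (β k : ℝ) * β l * f (x k - x l) =
      -∑ k with X k = y, ∑ l with X l = y, (β k : ℝ) * β l * f (x k - x l) := by
    conv_lhs => rw [Finset.sum_comm]
    rw [← Finset.sum_neg_distrib]
    refine Finset.sum_congr rfl fun k _ => ?_
    rw [← Finset.sum_neg_distrib]
    refine Finset.sum_congr rfl fun l _ => ?_
    rw [hf.map_sub_comm]; ring
  linarith

lemma exists_outermost {A : Finset (Fin n)} {i₀ j₀ : Fin n} (hi : i₀ ∈ A) (hj : j₀ ∈ A)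
    (hij : i₀ ≠ j₀) : ∃ i ∈ A, ∃ j ∈ A, i < j ∧ (∀ k ∈ A, i ≤ k) ∧ ∀ k ∈ A, k ≤ j := by
  have hne : A.Nonempty := ⟨i₀, hi⟩
  refine ⟨A.min' hne, A.min'_mem hne, A.max' hne, A.max'_mem hne,
    A.min'_lt_max' hi hj hij, fun k hk => A.min'_le k hk, fun k hk => A.le_max' k hk⟩

/-- The extreme values of a family in terms of its spread and its sum. -/
lemma extreme_bounds {A : Finset (Fin n)} {u : Fin n → ℝ} {i j : Fin n} (hi : i ∈ A) (hj : j ∈ A)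
    (hmin : ∀ k ∈ A, u i ≤ u k) (hmax : ∀ k ∈ A, u k ≤ u j) {E : ℝ}
    (hE : |∑ k ∈ A, u k| ≤ E) (hR : E ≤ u j - u i) :
    (u j - u i - E) / n ≤ u j ∧ u i ≤ -((u j - u i - E) / n) := by
  classical
  have hn : (0 : ℝ) < n := by exact_mod_cast i.pos
  have hE' := abs_le.1 hE
  have hcard : (A.card : ℝ) ≤ n := by exact_mod_cast (Finset.card_le_univ A).trans (by simp)
  have hcard0 : 0 < A.card := Finset.card_pos.2 ⟨i, hi⟩
  have up : ∑ k ∈ A, u k ≤ A.card * u j - (u j - u i) := by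
    have h1 : ∑ k ∈ A.erase i, u k ≤ (A.erase i).card • u j :=
      Finset.sum_le_card_nsmul _ _ _ fun k hk => hmax k (Finset.mem_of_mem_erase hk)
    rw [← Finset.add_sum_erase A u hi]
    rw [Finset.card_erase_of_mem hi, nsmul_eq_mul, Nat.cast_sub hcard0, Nat.cast_one] at h1
    linarith
  have low : A.card * u i + (u j - u i) ≤ ∑ k ∈ A, u k := by
    have h1 : (A.erase j).card • u i ≤ ∑ k ∈ A.erase j, u k :=
      Finset.card_nsmul_le_sum _ _ _ fun k hk => hmin k (Finset.mem_of_mem_erase hk)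
    rw [← Finset.add_sum_erase A u hj]
    rw [Finset.card_erase_of_mem hj, nsmul_eq_mul, Nat.cast_sub hcard0, Nat.cast_one] at h1
    linarith
  have hc0 : (0 : ℝ) < A.card := by exact_mod_cast hcard0
  have hj0 : 0 ≤ u j := by
    by_contra! h
    nlinarith
  have hi0 : u i ≤ 0 := by
    by_contra! h
    nlinarith
  constructor
  · rw [div_le_iff₀ hn]
    nlinarith
  · rw [le_neg, div_le_iff₀ hn]
    nlinarith

namespace Sol

variable {f g : ℝ → ℝ} {p q : ℝ} {x : ℝ → Fin n → ℝ} {b : ℝ → Fin n → SignType}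

/-- The outermost particles of a colliding cluster separate at least at the collision rate. -/
lemma exists_spread_lower (hf : Repulsive f) {K : NNReal} (hg : LipschitzWith K g)
    (h : Sol f g p q x b) {a c ε₀ : ℝ} (ha : -1 < a) (hc : 0 < c) (hε₀ : 0 < ε₀)
    (hfc : ∀ u ∈ Ioo 0 ε₀, c / u ^ (1 + a) ≤ |u * _root_.deriv f u|) {τ : ℝ} (hτ : τ ∈ Ioc p q)
    {β : Fin n → SignType} (hβ : HasLeftLimit b τ β) {i j : Fin n} (hij : i < j)
    (hX : x τ i = x τ j) (hi : β i ≠ 0) (hj : β j ≠ 0)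
    (hmin : ∀ k < i, x τ k = x τ i → β k = 0) (hmax : ∀ k, j < k → x τ k = x τ j → β k = 0) :
    ∃ κ > 0, ∀ᶠ t in 𝓝[<] τ, κ * (τ - t) ^ (1 / (2 + a)) ≤ x t j - x t i := by
  have hm : 0 < 2 + a := by linarith
  have hn : (0 : ℝ) < n := by exact_mod_cast i.pos
  obtain ⟨hA, l, hl, V, hV, hvel⟩ := h.exists_velocity_bound hf hg hτ hβ
  -- The bound on `f R` comes from `|u * deriv f u| / 2` at `u = 2 * R`, which accounts for the
  -- factor `2 * 2 ^ (1 + a)`.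
  set c₁ := c / (2 * 2 ^ (1 + a)) with hc₁
  have h2p : (1 : ℝ) ≤ 2 ^ (1 + a) := Real.one_le_rpow (by norm_num) (by linarith)
  have hc₁0 : 0 < c₁ := by positivity
  have hc₁c : c₁ ≤ c := div_le_self hc.le (by linarith)
  set κ := c₁ / (2 * n) with hκ
  have hκ0 : 0 < κ := by positivity
  -- For diameters `R ≤ δ` the bounded error `2 * V` uses up at most half of the attraction `2 * κ /
  -- R ^ (1 + a)`.
  obtain ⟨δ, hδ, hδ1⟩ : ∃ δ > 0, δ ^ (1 + a) * (2 * V) = κ := by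
    refine ⟨(κ / (2 * V)) ^ (1 / (1 + a)), by positivity, ?_⟩
    rw [← Real.rpow_mul (by positivity), one_div_mul_cancel (by linarith), Real.rpow_one]
    field_simp
  set δ' := min δ (ε₀ / 3) with hδ'
  have hδ'0 : 0 < δ' := lt_min hδ (by linarith)
  obtain ⟨l', hl', hl''⟩ := ((ConvergesOn.exists_near h.cont hτ (half_pos hδ'0)).and
    (eventually_nhdsLT_mem_Ico hl.2)).exists
  have hpl' : p ≤ l' := hl.1.trans hl''.1
  refine ⟨((2 + a) * κ) ^ (1 / (2 + a)), by positivity, ?_⟩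
  filter_upwards [eventually_nhdsLT_mem_Ico hl''.2] with t ht
  have hpos : ∀ s ∈ Ico l' τ, 0 < x s j - x s i := fun s hs => by
    have hbs := (hvel s ⟨hl''.1.trans hs.1, hs.2⟩).1
    exact sub_pos.2 (charged_lt (h.mem s ⟨hpl'.trans hs.1, hs.2.le.trans hτ.2⟩) hij
      (hbs ▸ hi) (hbs ▸ hj))
  have key := le_rpow_of_deriv_le_neg_div (D := fun s => x s j - x s i)
    (D' := fun s => velocity f g (x s) β j - velocity f g (x s) β i) (κ := κ) ha ht.2.le
    (((h.cont_apply j).sub (h.cont_apply i)).mono (Icc_subset_Icc (hpl'.trans ht.1) hτ.2))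
    (by simp [hX]) (fun s hs => hpos s ⟨ht.1.trans hs.1, hs.2⟩)
    (fun s hs => by
      have hbs := (hvel s ⟨hl''.1.trans (ht.1.trans hs.1), hs.2⟩).1
      have hs' : s ∈ Ico p q := ⟨hpl'.trans (ht.1.trans hs.1), hs.2.trans_le hτ.2⟩
      have := (h.deriv_apply hs' j).sub (h.deriv_apply hs' i)
      rw [hbs] at this
      exact this)
    (fun s hs => by
      have hs1 : s ∈ Ico l' τ := ⟨ht.1.trans hs.1, hs.2⟩
      obtain ⟨hbs, hvs⟩ := hvel s ⟨hl''.1.trans hs1.1, hs.2⟩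
      have hD := hpos s hs1
      have hmem := h.mem s ⟨hpl'.trans hs1.1, hs.2.le.trans hτ.2⟩
      rw [hbs] at hmem
      have hDδ : x s j - x s i ≤ δ' := by
        have e1 := abs_le.1 (hl' s ⟨hs1.1, hs.2.le⟩ i)
        have e2 := abs_le.1 (hl' s ⟨hs1.1, hs.2.le⟩ j)
        linarith [e1.1, e2.2]
      have hDδ1 := hDδ.trans (min_le_left _ _)
      have hDδ2 := hDδ.trans (min_le_right _ _)
      set R := x s j - x s i with hR
      have hp := Real.rpow_pos_of_pos hD (1 + a)
      have hM2 : c₁ / R ^ (1 + a) ≤ -(R * _root_.deriv f R) := by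
        have e1 := hfc R ⟨hD, by linarith⟩
        rw [abs_of_nonpos (mul_nonpos_of_nonneg_of_nonpos hD.le (hf.deriv_nonpos hD))] at e1
        exact (div_le_div_of_nonneg_right hc₁c hp.le).trans e1
      have hM1 : c₁ / R ^ (1 + a) ≤ f R := by
        have e1 := hfc (2 * R) ⟨by linarith, by linarith⟩
        rw [Real.mul_rpow (by norm_num) hD.le] at e1
        have e2 := hf.half_mul_abs_deriv_le hD
        have e3 : c₁ / R ^ (1 + a) = c / (2 ^ (1 + a) * R ^ (1 + a)) / 2 := by
          rw [hc₁]; field_simp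
        rw [e3]; linarith
      have e1 := hA.internalForce_sub_le hf hmem hij hX hi hj hmin hmax (M := c₁ / R ^ (1 + a))
        (by positivity) hM1 hM2
      have e2 := abs_le.1 (hvs i)
      have e3 := abs_le.1 (hvs j)
      have e4 : 2 * V ≤ κ / R ^ (1 + a) := by
        rw [le_div_iff₀ hp, ← hδ1, mul_comm]
        exact mul_le_mul_of_nonneg_right (Real.rpow_le_rpow hD.le hDδ1 (by linarith))
          (by linarith)
      have e5 : 1 / (n : ℝ) * (internalForce (x τ) f (x s) β j -
          internalForce (x τ) f (x s) β i) ≤ 1 / (n : ℝ) * -(c₁ / R ^ (1 + a)) :=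
        mul_le_mul_of_nonneg_left e1 (by positivity)
      have e6 : 1 / (n : ℝ) * -(c₁ / R ^ (1 + a)) = -(2 * (κ / R ^ (1 + a))) := by
        rw [hκ]; field_simp
      rw [e6, mul_sub] at e5
      linarith [e2.1, e3.2])
  have hD := hpos t ht
  calc _ = ((2 + a) * κ * (τ - t)) ^ (1 / (2 + a)) :=
        (Real.mul_rpow (by positivity) (by linarith [ht.2])).symm
    _ ≤ ((x t j - x t i) ^ (2 + a)) ^ (1 / (2 + a)) :=
        Real.rpow_le_rpow (mul_nonneg (by positivity) (by linarith [ht.2])) key (by positivity)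
    _ = _ := by rw [← Real.rpow_mul hD.le, mul_one_div_cancel hm.ne', Real.rpow_one]

/-- The center of mass moves by `O(τ - t)`, negligible against the diameter, which is at least of
order `(τ - t) ^ (1 / (2 + a))` with `2 + a > 1`. Hence both outermost charges are away from `y` by
this order. -/
lemma exists_collision_lower (hf : Repulsive f) {K : NNReal} (hg : LipschitzWith K g)
    (h : Sol f g p q x b) {a c ε₀ : ℝ} (ha : -1 < a) (hc : 0 < c) (hε₀ : 0 < ε₀)
    (hfc : ∀ u ∈ Ioo 0 ε₀, c / u ^ (1 + a) ≤ |u * _root_.deriv f u|) {τ y : ℝ} (hτ : τ ∈ Ioc p q)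
    {β : Fin n → SignType} (hβ : HasLeftLimit b τ β) {i₀ j₀ : Fin n} (hij₀ : i₀ ≠ j₀)
    (hi₀ : β i₀ ≠ 0) (hj₀ : β j₀ ≠ 0) (hXi₀ : x τ i₀ = y) (hXj₀ : x τ j₀ = y) :
    ∃ c : ℝ, 0 < c ∧ ∃ i j, i < j ∧ β i ≠ 0 ∧ β j ≠ 0 ∧ x τ i = y ∧ x τ j = y ∧
      ∀ᶠ t in 𝓝[<] τ, c * (τ - t) ^ (1 / (2 + a)) < x t j - y ∧
        x t i - y < -c * (τ - t) ^ (1 / (2 + a)) := by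
  classical
  have hm : 0 < 2 + a := by linarith
  set A := Finset.univ.filter fun k => x τ k = y ∧ β k ≠ 0 with hA
  have hmemA : ∀ k, k ∈ A ↔ x τ k = y ∧ β k ≠ 0 := fun k => by simp [hA]
  obtain ⟨i, hiA, j, hjA, hij, hmin, hmax⟩ := exists_outermost ((hmemA i₀).2 ⟨hXi₀, hi₀⟩)
    ((hmemA j₀).2 ⟨hXj₀, hj₀⟩) hij₀
  obtain ⟨hXi, hi⟩ := (hmemA i).1 hiA
  obtain ⟨hXj, hj⟩ := (hmemA j).1 hjA
  obtain ⟨κ, hκ, hspread⟩ := h.exists_spread_lower hf hg ha hc hε₀ hfc hτ hβ hij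
    (hXi.trans hXj.symm) hi hj
    (fun k hk hX => by
      by_contra hb; exact hk.not_ge (hmin k ((hmemA k).2 ⟨hX.trans hXi, hb⟩)))
    (fun k hk hX => by
      by_contra hb; exact hk.not_ge (hmax k ((hmemA k).2 ⟨hX.trans hXj, hb⟩)))
  obtain ⟨-, l, hl, V, hV, hvel⟩ := h.exists_velocity_bound hf hg hτ hβ
  have hn : (0 : ℝ) < n := by exact_mod_cast i.pos
  -- the center of mass of the cluster
  have hcm : ∀ t ∈ Ico l τ, |∑ k ∈ A, (x t k - y)| ≤ n * V * (τ - t) := by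
    intro t ht
    have key := norm_image_sub_le_of_norm_deriv_right_le_segment
      (f := fun s => ∑ k ∈ A, (x s k - y)) (a := t) (b := τ) (C := n * V)
      (f' := fun s => ∑ k ∈ A, velocity f g (x s) β k)
      ((continuousOn_finsetSum _ fun k _ => (h.cont_apply k).sub continuousOn_const).mono
        (Icc_subset_Icc (hl.1.trans ht.1) hτ.2))
      (fun s hs => by
        have hbs := (hvel s ⟨ht.1.trans hs.1, hs.2⟩).1
        refine HasDerivWithinAt.fun_sum fun k _ => ?_
        have := (h.deriv_apply (t := s) ⟨hl.1.trans (ht.1.trans hs.1), hs.2.trans_le hτ.2⟩ k).sub_const y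
        rwa [hbs] at this)
      (fun s hs => by
        obtain ⟨-, hvs⟩ := hvel s ⟨ht.1.trans hs.1, hs.2⟩
        have e1 : ∑ k ∈ A, velocity f g (x s) β k = ∑ k ∈ A, (velocity f g (x s) β k -
            1 / (n : ℝ) * internalForce (x τ) f (x s) β k) := by
          rw [Finset.sum_sub_distrib, ← Finset.mul_sum, hA, sum_internalForce_eq_zero hf]
          simp
        rw [e1, Real.norm_eq_abs]
        refine (Finset.abs_sum_le_sum_abs _ _).trans
          ((Finset.sum_le_card_nsmul _ _ V fun k _ => hvs k).trans ?_)
        rw [nsmul_eq_mul]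
        refine mul_le_mul_of_nonneg_right ?_ hV.le
        exact_mod_cast (Finset.card_le_univ _).trans (by simp)) τ ⟨ht.2.le, le_rfl⟩
    have e0 : ∑ k ∈ A, (x τ k - y) = 0 :=
      Finset.sum_eq_zero fun k hk => sub_eq_zero.2 ((hmemA k).1 hk).1
    rwa [e0, zero_sub, norm_neg, Real.norm_eq_abs] at key
  -- The drift takes at most half of the diameter bound `κ * r`, passing to a single particle costs
  -- a factor `n`, and another factor `2` makes the inequality strict.
  refine ⟨κ / (4 * n), by positivity, i, j, hij, hi, hj, hXi, hXj, ?_⟩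
  have hsmall : ∀ᶠ t in 𝓝[<] τ, n * V * (τ - t) ^ ((1 + a) / (2 + a)) < κ / 2 := by
    have hcont : ContinuousAt (fun t => n * V * (τ - t) ^ ((1 + a) / (2 + a))) τ := by
      refine continuousAt_const.mul (ContinuousAt.rpow_const (by fun_prop) (Or.inr ?_))
      exact div_nonneg (by linarith) hm.le
    refine (hcont.eventually (gt_mem_nhds ?_)).filter_mono nhdsWithin_le_nhds
    beta_reduce
    rw [sub_self, Real.zero_rpow (div_pos (by linarith) hm).ne', mul_zero]
    exact half_pos hκ
  filter_upwards [hspread, hsmall, eventually_nhdsLT_mem_Ico hl.2] with t h1 h2 ht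
  have hτt : 0 < τ - t := by linarith [ht.2]
  set r := (τ - t) ^ (1 / (2 + a)) with hr
  have hr0 : 0 < r := Real.rpow_pos_of_pos hτt _
  have hsplit : τ - t = (τ - t) ^ ((1 + a) / (2 + a)) * r := by
    rw [hr, ← Real.rpow_add hτt, ← add_div, show 1 + a + 1 = 2 + a by ring, div_self hm.ne',
      Real.rpow_one]
  have hE : n * V * (τ - t) ≤ κ / 2 * r := by
    rw [hsplit, ← mul_assoc]
    exact mul_le_mul_of_nonneg_right h2.le hr0.le
  have hbt := (hvel t ht).1
  have hmem := h.mem t ⟨hl.1.trans ht.1, ht.2.le.trans hτ.2⟩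
  rw [hbt] at hmem
  have hmono : ∀ k ∈ A, ∀ k' ∈ A, k ≤ k' → x t k ≤ x t k' := fun k hk k' hk' hkk => by
    rcases hkk.eq_or_lt with rfl | hlt
    · exact le_rfl
    · exact (charged_lt hmem hlt ((hmemA k).1 hk).2 ((hmemA k').1 hk').2).le
  obtain ⟨e1, e2⟩ := extreme_bounds (u := fun k => x t k - y) hiA hjA
    (fun k hk => sub_le_sub_right (hmono i hiA k hk (hmin k hk)) y)
    (fun k hk => sub_le_sub_right (hmono k hk j hjA (hmax k hk)) y) (hcm t ht)
    (by rw [sub_sub_sub_cancel_right]; nlinarith)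
  rw [sub_sub_sub_cancel_right] at e1 e2
  have e3 : κ / (4 * n) * r < (x t j - x t i - n * V * (τ - t)) / n := by
    rw [lt_div_iff₀ hn, show κ / (4 * n) * r * n = κ / 4 * r by field_simp]
    nlinarith
  exact ⟨e3.trans_le e1, e2.trans_lt (by rw [neg_mul]; exact neg_lt_neg e3)⟩

end Sol

end ParticleAnnihilation

/-! ### Assembly of the theorem. -/

theorem theorem2p4 (n : ℕ) (hn : 2 ≤ n) (T : ℝ) (hT : 0 < T)
    (x₀ : Fin n → ℝ) (b₀ : Fin n → SignType) (h₀ : (x₀, b₀) ∈ stateSpace n)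
    (f g : ℝ → ℝ) (a : ℝ) (hfg : ForceAssumption f g a) :
    -- existence
    (∃ x b, IsSolution T f g x₀ b₀ x b) ∧
    -- uniqueness modulo relabeling
    (∀ x b x' b', IsSolution T f g x₀ b₀ x b → IsSolution T f g x₀ b₀ x' b' →
      IsRelabeling T x b x' b') ∧
    ∀ x b, IsSolution T f g x₀ b₀ x b →
      (collisionTimes T x b).Finite ∧
      -- (i) lower bound on the distance between neighbors of equal sign
      (∃ c : ℝ, 0 < c ∧ ∀ t ∈ Icc 0 T,
        (c : EReal) ≤ sameSignDist 1 (x t) (b t) ∧ (c : EReal) ≤ sameSignDist (-1) (x t) (b t)) ∧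
      -- (ii) lower bound on the distance between neighbors of opposite sign
      (∃ C : ℝ, 0 < C ∧ ∀ t₀ ∈ Icc 0 T, ∀ i j, AreNeighbors (b t₀) i j → b t₀ i = -b t₀ j →
        ∃ c : ℝ, 0 < c ∧ ∀ t ∈ Icc t₀ T, t ≤ t₀ + c / C →
          (c - C * (t - t₀)) ^ (1 / (2 + a)) ≤ x t j - x t i) ∧
      -- (iii) upper bound prior to collision
      (∀ τ ∈ collisionTimes T x b, ∀ β, HasLeftLimit b τ β →
        ∀ i j, AreNeighbors β i j → x τ i = x τ j →
          ∃ C : ℝ, 0 < C ∧ ∀ t ∈ Icc 0 τ, x t j - x t i ≤ C * (τ - t) ^ (1 / (2 + a))) ∧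
      -- (iv) lower bound prior to collision
      (∀ a' c' ε₀ : ℝ, -1 < a' → a' ≤ a → 0 < c' → 0 < ε₀ →
        (∀ x ∈ Ioo 0 ε₀, c' / x ^ (1 + a') ≤ |x * deriv f x|) →
        ∀ τ y, IsCollisionPoint T x b τ y →
          ∃ c : ℝ, 0 < c ∧ ∃ β, HasLeftLimit b τ β ∧ ∃ i j, i < j ∧ β i ≠ 0 ∧ β j ≠ 0 ∧
            x τ i = y ∧ x τ j = y ∧
            ∀ᶠ t in 𝓝[<] τ, c * (τ - t) ^ (1 / (2 + a')) < x t j - y ∧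
              x t i - y < -c * (τ - t) ^ (1 / (2 + a'))) ∧
      -- (v) stability with respect to the initial positions and the external force
      (∀ (gσ : ℝ → ℝ → ℝ) (x₀σ : ℝ → Fin n → ℝ)
        (xσ : ℝ → ℝ → Fin n → ℝ) (bσ : ℝ → ℝ → Fin n → SignType),
        (∀ σ, 0 < σ → ∃ K, LipschitzWith K (gσ σ)) →
        TendstoUniformly gσ g (𝓝[>] 0) →
        (∀ σ, 0 < σ → (x₀σ σ, b₀) ∈ stateSpace n) →
        Tendsto x₀σ (𝓝[>] 0) (𝓝 x₀) →
        (∀ σ, 0 < σ → IsSolution T f (gσ σ) (x₀σ σ) b₀ (xσ σ) (bσ σ)) →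
        -- `p ≤ q` are consecutive among `0`, the collision times and `T`
        ∀ p ∈ insert 0 (collisionTimes T x b), ∀ q ∈ insert T (collisionTimes T x b), p ≤ q →
          Disjoint (Ioo p q) (collisionTimes T x b) →
          ∃ μ : ℝ → Equiv.Perm (Fin n),
            TendstoUniformlyOn (fun σ t i => xσ σ t (μ σ i)) x (𝓝[>] 0) (Icc p q) ∧
            ∀ t₀ t₁, p < t₀ → t₁ < q →
              ∀ᶠ σ in 𝓝[>] 0, ∀ t ∈ Icc t₀ t₁, ∀ i, bσ σ t (μ σ i) = b t i) := by
  have hf := hfg.repulsive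
  obtain ⟨K, hg⟩ := hfg.lipschitz
  have ha := hfg.neg_one_lt
  refine ⟨?_, fun x b x' b' hx hx' => ?_, fun x b hxb => ?_⟩
  · obtain ⟨x, b, h, rfl, rfl⟩ := exists_sol hf hg _ x₀ b₀ rfl h₀ 0 hT.le
    exact ⟨x, b, h.isSolution hT hf hg.continuous⟩
  · obtain ⟨-, S, -, -, -, -, -, h1, h2, -⟩ := id hx
    obtain ⟨-, S', -, -, -, -, -, h1', h2', -⟩ := id hx'
    exact (hx.sol hf hg.continuous).isRelabeling hf hg hT.le (hx'.sol hf hg.continuous)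
      (h1'.trans h1.symm) (h2'.trans h2.symm)
  obtain ⟨-, S, -, -, -, -, -, h1, h2, -⟩ := id hxb
  have h := hxb.sol hf hg.continuous
  -- In (ii) the constant `C = 1` serves, because `c` is chosen after `t₀`, `i` and `j`.
  refine ⟨h.finite_collisionTimes, ?_, ⟨1, one_pos, fun t₀ ht₀ i j hij _ => ?_⟩,
    fun τ hτ β hβ i j hij hX => ?_, fun a' c' ε₀ ha' _ hc' hε₀ hfc τ y hτy => ?_,
    fun gσ x₀σ xσ bσ hgσ hgg _ hx₀σ hsol p hp q hq hpq hJ => ?_⟩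
  · obtain ⟨c, hc, hsep⟩ := h.exists_sameSignSep hf hg hT.le
    exact ⟨c, hc, fun t ht => ⟨(hsep t ht).le_sameSignDist 1, (hsep t ht).le_sameSignDist (-1)⟩⟩
  · simpa using h.exists_gap_lower ha ht₀ hij
  · obtain ⟨C, hC, hfC⟩ := hfg.singUB
    exact h.exists_collision_upper hf hg ha hC hfC (h.mem_collisionTimes_iff.1 hτ).1 hβ hij hX
  · obtain ⟨hτ, β, hβ, i, j, hij, hi, hj, hXi, hXj⟩ := hτy
    obtain ⟨c, hc, hlow⟩ := h.exists_collision_lower hf hg ha' hc' hε₀ hfc hτ hβ hij hi hj hXi hXj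
    exact ⟨c, hc, β, hβ, hlow⟩
  · have hpos : ∀ᶠ σ in 𝓝[>] (0 : ℝ), 0 < σ := self_mem_nhdsWithin
    have hinit : ∀ᶠ σ in 𝓝[>] (0 : ℝ), xσ σ 0 = x₀σ σ ∧ bσ σ 0 = b₀ := hpos.mono fun σ hσ => by
      obtain ⟨-, S, -, -, -, -, -, h1, h2, -⟩ := hsol σ hσ
      exact ⟨h1, h2⟩
    obtain ⟨μ, hμ⟩ := exists_convergesOn_of_le hf hg hgg hT h
      (hpos.mono fun σ hσ => by
        obtain ⟨K', hK'⟩ := hgσ σ hσ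
        exact (hsol σ hσ).sol hf hK'.continuous)
      (by rw [h1]; exact hx₀σ.congr' (hinit.mono fun σ hσ => hσ.1.symm))
      (hinit.mono fun σ hσ => hσ.2.trans h2.symm) hp hq hpq hJ
    exact ⟨μ, hμ.pos, hμ.charge⟩
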